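/- Let $a\in C([0,1])\cap C^1(]0,1])$ satisfy $a(0)=0$, $a>0$ on $]0,1]$, $\mu_a:=\sup_{0<x\le 1}\frac{x|a'(x)|}{a(x)}<2$ and $a\in C^{[\mu_a]}([0,1])$, where $[\cdot]$ is the integer part. Put $$C_a=\frac1{a(1)}\min\Big\{4,\frac1{2-\mu_a}\Big\},\qquad T_a=\frac{4}{(2-\mu_a)\min\{1,a(1)\}}+2\mu_a\sqrt{C_a}.$$ Let $H^1_a(0,1)$ be the Hilbert space of all $u\in L^2(0,1)$ that are locally absolutely continuous on $]0,1]$ with $\sqrt a\,u'\in L^2(0,1)$, $u(1)=0$ and, if $\mu_a<1$, $u(0)=0$, with the norm $\big(\int_0^1(a|u'|^2+|u|^2)\,dx\big)^{1/2}$. Let $H^{-1}_a(0,1)$ be its dual with respect to the pivot space $L^2(0,1)$, and let $H^2_a(0,1)=\{u\in H^1_a(0,1): au'\in H^1(0,1)\}$. For $S>0$ and $W=(w^0,w^1)\in H^1_a(0,1)\times L^2(0,1)$, let $w\in C([0,S];H^1_a(0,1))\cap C^1([0,S];L^2(0,1))$ be the mild solution of $w_{tt}-(aw_x)_x=0$ on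 $[0,S]$ with $w(S)=w^0$, $w_t(S)=w^1$ (the operator being $(u,v)\mapsto(v,(au')')$ with domain $H^2_a(0,1)\times H^1_a(0,1)$). Let $w_x(\cdot,1)\in L^2(0,S)$ be its normal derivative at $x=1$, defined as the limit in $L^2(0,S)$ of the normal derivatives of classical solutions whose data at time $S$ converge to $W$ in $H^1_a(0,1)\times L^2(0,1)$. For $f\in L^2_{loc}([0,\infty[)$ and $(y_0,y_1)\in L^2(0,1)\times H^{-1}_a(0,1)$, a solution by transposition of $$y_{tt}-(ay_x)_x=0,\quad y(t,1)=f(t),\quad \begin{cases}y(t,0)=0&\text{if }\mu_a\in[0,1[,\\ \lim_{x\downarrow0}a(x)y_x(t,x)=0&\text{if }\mu_a\in[1,2[,\end{cases}\quad y(0)=y_0,\ y_t(0)=y_1,$$ is a function $y\in C([0,\infty[;L^2(0,1))\cap C^1([0,\infty[;H^{-1}_a(0,1))$ such that, for all $S>0$ and all $(w^0,w^1)\in H^1_a(0,1)\times L^2(0,1)$, with $w$ as above, $$\langle y'(S),w^0\rangle-\int_0^1y(S)w^1\,dx=\langle y_1,w(0)\rangle-\int_0^1y_0\,w_t(0)\,dx-a(1)\int_0^Sf(t)\,w_x(t,1)\,dt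 .$$ Let $T>T_a$. Then the controlled system is exactly controllable in $L^2(0,1)\times H^{-1}_a(0,1)$ in time $T$: for all $(y_0,y_1)$ and $(y_0^T,y_1^T)$ in $L^2(0,1)\times H^{-1}_a(0,1)$ there is $f\in L^2(0,T)$ such that, $f$ being extended by $0$, the controlled system has a solution by transposition, and every such solution $y$ satisfies $(y,y_t)(T)=(y_0^T,y_1^T)$. Moreover, the form $\Lambda(W,\widetilde W)=\int_0^Tw_x(t,1)\,\widetilde w_x(t,1)\,dt$ is coercive on $H^1_a(0,1)\times L^2(0,1)$, where $w,\widetilde w$ are the mild solutions on $[0,T]$ with final data $W,\widetilde W$ at time $T$. For every $(y_0,y_1)\in L^2(0,1)\times H^{-1}_a(0,1)$ there is exactly one $W\in H^1_a(0,1)\times L^2(0,1)$ with $$\Lambda(W,\widetilde W)=-\langle y_1,\widetilde w(0)\rangle+\int_0^1y_0\,\widetilde w_t(0)\,dx\qquad\text{for all }\widetilde W\in H^1_a(0,1)\times L^2(0,1),$$ and the control $f=-\frac1{a(1)}w_x(\cdot,1)$ steers $(y_0,y_1)$ to $(0,0)$ in time $T$, in the above sense. -/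

import Mathlib

open MeasureTheory Set Filter Topology

noncomputable section

namespace DegenerateWave

/-- Lebesgue measure on the interval `(0,1)`. -/
abbrev vol01 : Measure ℝ := volume.restrict (Ioo 0 1)

/-- The real Hilbert space `L²(0,1)`. -/
abbrev L2 : Type := Lp ℝ 2 vol01

/-! ### The coefficient -/

/-- The quotients `x |a'(x)| / a(x)`, `0 < x ≤ 1` (the derivative at `x = 1` is one-sided). -/
def degeneracySet (a : ℝ → ℝ) : Set ℝ :=
  (fun x => x * |derivWithin a (Ioc 0 1) x| / a x) '' Ioc 0 1

/-- The degeneracy parameter `μ_a = sup_{0 < x ≤ 1} x |a'(x)| / a(x)`. -/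
def mu (a : ℝ → ℝ) : ℝ := sSup (degeneracySet a)

/-- The standing assumptions on the coefficient `a`. -/
structure IsDegenerateCoefficient (a : ℝ → ℝ) : Prop where
  continuousOn : ContinuousOn a (Icc 0 1)
  contDiffOn : ContDiffOn ℝ 1 a (Ioc 0 1)
  pos : ∀ x ∈ Ioc (0 : ℝ) 1, 0 < a x
  zero : a 0 = 0
  /-- the supremum defining `μ_a` is finite -/
  bddAbove : BddAbove (degeneracySet a)
  mu_lt_two : mu a < 2
  /-- `a` is of class `C^{[μ_a]}` on `[0,1]`, where `[μ_a]` is the integer part -/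
  contDiffOn_floor : ContDiffOn ℝ (⌊mu a⌋₊ : ℕ) a (Icc 0 1)

/-- The constant `C_a = (1 / a(1)) min {4, 1 / (2 - μ_a)}` of Poincaré's inequality. -/
def poincareConst (a : ℝ → ℝ) : ℝ := 1 / a 1 * min 4 (1 / (2 - mu a))

/-- The time `T_a = 4 / ((2 - μ_a) min {1, a(1)}) + 2 μ_a √C_a`. -/
def controlTime (a : ℝ → ℝ) : ℝ :=
  4 / ((2 - mu a) * min 1 (a 1)) + 2 * mu a * √(poincareConst a)

/-! ### The weighted Sobolev spaces

A function `u ∈ V¹_a(0,1)` is recorded as the pair `(u, √a u')` in `L²(0,1) × L²(0,1)`; the second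
component is determined by the first, and the scalar product inherited from the Hilbert product is
`⟨u, v⟩ = ∫ (a u' v' + u v) dx`. -/

/-- The Hilbert product `L²(0,1) × L²(0,1)`. -/
abbrev L2Pair : Type := WithLp 2 (L2 × L2)

/-- `U` is the representative of `u` that is locally absolutely continuous in `]0,1]`, and
the second component of `u` is `√a U'`. -/
structure IsRep (a : ℝ → ℝ) (u : L2Pair) (U : ℝ → ℝ) : Prop where
  ae_eq : (u.fst : ℝ → ℝ) =ᵐ[vol01] U
  locallyAC : ∀ ε ∈ Ioo (0 : ℝ) 1, AbsolutelyContinuousOnInterval U ε 1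
  ae_eq_deriv : (u.snd : ℝ → ℝ) =ᵐ[vol01] fun x => √(a x) * deriv U x

theorem ae_differentiableAt_of_locallyAC {U : ℝ → ℝ}
    (h : ∀ ε ∈ Ioo (0 : ℝ) 1, AbsolutelyContinuousOnInterval U ε 1) :
    ∀ᵐ x ∂vol01, DifferentiableAt ℝ U x := by
  have key : ∀ n : ℕ, ∀ᵐ x, x ∈ uIcc (1 / ((n : ℝ) + 2)) 1 → DifferentiableAt ℝ U x := by
    intro n
    have hn : (1 / ((n : ℝ) + 2)) ∈ Ioo (0 : ℝ) 1 := by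
      have : (0 : ℝ) ≤ n := n.cast_nonneg
      refine ⟨by positivity, ?_⟩
      rw [div_lt_one (by positivity)]
      linarith
    exact (h _ hn).boundedVariationOn.ae_differentiableAt_of_mem_uIcc
  rw [ae_restrict_iff' measurableSet_Ioo]
  filter_upwards [ae_all_iff.2 key] with x hx hx01
  obtain ⟨n, hn⟩ := exists_nat_one_div_lt hx01.1
  refine hx n ?_
  rw [mem_uIcc]
  refine Or.inl ⟨le_trans ?_ hn.le, hx01.2.le⟩
  have : (0 : ℝ) ≤ n := n.cast_nonneg
  gcongr
  norm_num

theorem IsRep.zero (a : ℝ → ℝ) : IsRep a 0 (fun _ => 0) where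
  ae_eq := Lp.coeFn_zero ℝ 2 vol01
  locallyAC := fun _ _ => contDiffOn_const.absolutelyContinuousOnInterval
  ae_eq_deriv := by
    filter_upwards [Lp.coeFn_zero ℝ 2 vol01] with x hx
    simpa using hx

theorem IsRep.add {a : ℝ → ℝ} {u v : L2Pair} {U V : ℝ → ℝ} (hu : IsRep a u U)
    (hv : IsRep a v V) : IsRep a (u + v) (fun x => U x + V x) where
  ae_eq := by
    filter_upwards [Lp.coeFn_add u.fst v.fst, hu.ae_eq, hv.ae_eq] with x h1 h2 h3
    rw [WithLp.add_fst, h1, Pi.add_apply, h2, h3]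
  locallyAC := fun ε hε => (hu.locallyAC ε hε).add (hv.locallyAC ε hε)
  ae_eq_deriv := by
    filter_upwards [Lp.coeFn_add u.snd v.snd, hu.ae_eq_deriv, hv.ae_eq_deriv,
      ae_differentiableAt_of_locallyAC hu.locallyAC,
      ae_differentiableAt_of_locallyAC hv.locallyAC] with x h1 h2 h3 h4 h5
    rw [WithLp.add_snd, h1, Pi.add_apply, h2, h3, deriv_fun_add h4 h5]
    ring

theorem IsRep.smul {a : ℝ → ℝ} {u : L2Pair} {U : ℝ → ℝ} (c : ℝ) (hu : IsRep a u U) :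
    IsRep a (c • u) (fun x => c * U x) where
  ae_eq := by
    filter_upwards [Lp.coeFn_smul c u.fst, hu.ae_eq] with x h1 h2
    rw [WithLp.smul_fst, h1, Pi.smul_apply, h2, smul_eq_mul]
  locallyAC := fun ε hε => (hu.locallyAC ε hε).const_mul c
  ae_eq_deriv := by
    filter_upwards [Lp.coeFn_smul c u.snd, hu.ae_eq_deriv] with x h1 h2
    rw [WithLp.smul_snd, h1, Pi.smul_apply, h2, smul_eq_mul, deriv_const_mul_field]
    ring

/-- `H¹_a(0,1)`: the functions `u ∈ V¹_a(0,1)` with `u(1) = 0` and, in the weakly degenerate case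
`μ_a < 1`, also `u(0) = 0`. -/
def H1aSubmodule (a : ℝ → ℝ) : Submodule ℝ L2Pair where
  carrier := {u | ∃ U, IsRep a u U ∧ U 1 = 0 ∧ (mu a < 1 → Tendsto U (𝓝[>] 0) (𝓝 0))}
  zero_mem' := ⟨_, IsRep.zero a, rfl, fun _ => tendsto_const_nhds⟩
  add_mem' := by
    rintro u v ⟨U, hU, hU1, hU0⟩ ⟨V, hV, hV1, hV0⟩
    exact ⟨_, hU.add hV, by simp [hU1, hV1], fun h => by simpa using (hU0 h).add (hV0 h)⟩
  smul_mem' := by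
    rintro c u ⟨U, hU, hU1, hU0⟩
    exact ⟨_, hU.smul c, by simp [hU1], fun h => by simpa using (hU0 h).const_mul c⟩

/-- The Hilbert space `H¹_a(0,1)`. -/
abbrev H1a (a : ℝ → ℝ) : Type := H1aSubmodule a

/-- The inclusion `H¹_a(0,1) → L²(0,1)`. -/
def toL2 (a : ℝ → ℝ) : H1a a →L[ℝ] L2 :=
  (WithLp.fstL 2 ℝ L2 L2).comp (H1aSubmodule a).subtypeL

/-- `H^{-1}_a(0,1)`: the topological dual of `H¹_a(0,1)`, with the dual norm. -/
abbrev Hm1a (a : ℝ → ℝ) : Type := H1a a →L[ℝ] ℝ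

/-- The embedding `L²(0,1) → H^{-1}_a(0,1)` with `L²(0,1)` as pivot space:
`y ↦ (φ ↦ ∫ y φ dx)`. -/
def pivot (a : ℝ → ℝ) (y : L2) : Hm1a a := (innerSL ℝ y).comp (toL2 a)

/-- `u ∈ H²_a(0,1)` and `(a u')' = z ∈ L²(0,1)`: the function `a u'` has a representative `q` in
`H¹(0,1)`, that is, absolutely continuous on `[0,1]` with `q' = z ∈ L²(0,1)`. -/
def HasDiv (a : ℝ → ℝ) (u : H1a a) (z : L2) : Prop :=
  ∃ U q : ℝ → ℝ, IsRep a u U ∧ AbsolutelyContinuousOnInterval q 0 1 ∧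
    (q =ᵐ[vol01] fun x => a x * deriv U x) ∧ deriv q =ᵐ[vol01] z

/-- The (one-sided) derivative at `x = 1` of the continuous representative of `u` is `d`. -/
def HasNormalDeriv (a : ℝ → ℝ) (u : H1a a) (d : ℝ) : Prop :=
  ∃ U : ℝ → ℝ, IsRep a u U ∧ HasDerivWithinAt U d (Iic 1) 1

/-! ### Solutions of the homogeneous equation `w_tt - (a w_x)_x = 0` on `[0,T]`

The boundary conditions are `w(t,1) = 0`, and `w(t,0) = 0` if `μ_a < 1`, or
`lim_{x ↓ 0} a(x) w_x(t,x) = 0` if `1 ≤ μ_a < 2`; the first two are part of the space `H¹_a(0,1)`,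
the third is automatic in `H²_a(0,1)`. -/

/-- Classical solutions on `[0,T]`:
`w ∈ C²([0,T]; L²(0,1)) ∩ C¹([0,T]; H¹_a(0,1)) ∩ C([0,T]; H²_a(0,1))` and the equation holds.
Here `w'` and `w''` are the first and second derivatives in time; the continuity of
`(a w_x)_x = w''` in `L²(0,1)` is the continuity of `w` in `H²_a(0,1)`. -/
structure IsClassicalSolution (a : ℝ → ℝ) (T : ℝ) (w w' : ℝ → H1a a) (w'' : ℝ → L2) : Prop where
  hasDeriv : ∀ t ∈ Icc 0 T, HasDerivWithinAt w (w' t) (Icc 0 T) t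
  continuousOn_deriv : ContinuousOn w' (Icc 0 T)
  hasDeriv₂ : ∀ t ∈ Icc 0 T, HasDerivWithinAt (fun s => toL2 a (w' s)) (w'' t) (Icc 0 T) t
  continuousOn_deriv₂ : ContinuousOn w'' (Icc 0 T)
  equation : ∀ t ∈ Icc 0 T, HasDiv a (w t) (w'' t)

/-- Mild solutions on `[0,T]`: `w ∈ C¹([0,T]; L²(0,1)) ∩ C([0,T]; H¹_a(0,1))` with time derivative
`w'`, such that `W = (w, w')` satisfies `W(t) = W(0) + A ∫₀ᵗ W(s) ds`, where
`A (u, v) = (v, (a u')')` with domain `H²_a(0,1) × H¹_a(0,1)`. Here `Z(t) = ∫₀ᵗ w(s) ds` in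
`H¹_a(0,1)`; the second component of the identity reads `w'(t) = w'(0) + (a Z(t)_x)_x`, and the
first one says that `w'` is the continuous derivative of `w`. -/
structure IsMildSolution (a : ℝ → ℝ) (T : ℝ) (w : ℝ → H1a a) (w' : ℝ → L2) : Prop where
  continuousOn : ContinuousOn w (Icc 0 T)
  continuousOn_deriv : ContinuousOn w' (Icc 0 T)
  hasDeriv : ∀ t ∈ Icc 0 T, HasDerivWithinAt (fun s => toL2 a (w s)) (w' t) (Icc 0 T) t
  equation : ∃ Z : ℝ → H1a a, Z 0 = 0 ∧ ∀ t ∈ Icc 0 T,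
    HasDerivWithinAt Z (w t) (Icc 0 T) t ∧ HasDiv a (Z t) (w' t - w' 0)

/-- `g ∈ L²(0,T)` is the normal derivative `w_x(·,1)` of the mild solution `w` on `[0,T]`: the limit
in `L²(0,T)` of the normal derivatives of classical solutions whose data at time `T` converge to
those of `w` in `H¹_a(0,1) × L²(0,1)`. -/
def IsNormalTrace (a : ℝ → ℝ) (T : ℝ) (w : ℝ → H1a a) (w' : ℝ → L2) (g : ℝ → ℝ) : Prop :=
  MemLp g 2 (volume.restrict (Ioo 0 T)) ∧
  ∃ (z z' : ℕ → ℝ → H1a a) (z'' : ℕ → ℝ → L2) (h : ℕ → ℝ → ℝ),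
    (∀ n, IsClassicalSolution a T (z n) (z' n) (z'' n)) ∧
    (∀ n, ∀ t ∈ Icc 0 T, HasNormalDeriv a (z n t) (h n t)) ∧
    Tendsto (fun n => z n T) atTop (𝓝 (w T)) ∧
    Tendsto (fun n => toL2 a (z' n T)) atTop (𝓝 (w' T)) ∧
    Tendsto (fun n => eLpNorm (h n - g) 2 (volume.restrict (Ioo 0 T))) atTop (𝓝 0)

/-- `w` is the mild solution on `[0,T]` of the backward problem with final data
`W = (w(T), w'(T))`, and `g = w_x(·,1)` is its normal derivative. -/
structure IsBackwardSolution (a : ℝ → ℝ) (T : ℝ) (W : H1a a × L2)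
    (w : ℝ → H1a a) (w' : ℝ → L2) (g : ℝ → ℝ) : Prop where
  mild : IsMildSolution a T w w'
  final : w T = W.1
  final_deriv : w' T = W.2
  trace : IsNormalTrace a T w w' g

/-! ### The controlled problem -/

/-- `y ∈ C¹([0,∞); H^{-1}_a(0,1)) ∩ C([0,∞); L²(0,1))`, with time derivative `y'`, is a solution by
transposition of `y_tt - (a y_x)_x = 0`, `y(t,1) = f(t)`, `y(0) = y₀`, `y_t(0) = y₁`, with the
homogeneous boundary condition at `x = 0`. The weight `-a(1)` is the one that Green's formula
gives: `∫₀ˢ ∫₀¹ ((a y_x)_x w - y (a w_x)_x) dx dt = -a(1) ∫₀ˢ y(t,1) w_x(t,1) dt`. -/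
structure IsTranspositionSolution (a : ℝ → ℝ) (y₀ : L2) (y₁ : Hm1a a) (f : ℝ → ℝ)
    (y : ℝ → L2) (y' : ℝ → Hm1a a) : Prop where
  memLp_control : ∀ S > 0, MemLp f 2 (volume.restrict (Ioo 0 S))
  continuousOn : ContinuousOn y (Ici 0)
  hasDeriv : ∀ t ∈ Ici (0 : ℝ), HasDerivWithinAt (fun s => pivot a (y s)) (y' t) (Ici 0) t
  continuousOn_deriv : ContinuousOn y' (Ici 0)
  transposition : ∀ S > 0, ∀ (W : H1a a × L2) (w : ℝ → H1a a) (w' : ℝ → L2) (g : ℝ → ℝ),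
    IsBackwardSolution a S W w w' g →
      y' S W.1 - inner ℝ (y S) W.2 =
        y₁ (w 0) - inner ℝ y₀ (w' 0) - a 1 * ∫ t in Ioo 0 S, f t * g t

/-- The control `f ∈ L²(0,T)` (extended by zero) steers `(y₀, y₁)` to `(z₀, z₁)` in time `T`:
the controlled problem has a solution by transposition, and every such solution satisfies
`(y, y_t)(T) = (z₀, z₁)`. -/
def Steers (a : ℝ → ℝ) (T : ℝ) (f : ℝ → ℝ) (y₀ : L2) (y₁ : Hm1a a) (z₀ : L2) (z₁ : Hm1a a) :
    Prop :=
  MemLp f 2 (volume.restrict (Ioo 0 T)) ∧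
  (∃ y y', IsTranspositionSolution a y₀ y₁ ((Ioo 0 T).indicator f) y y') ∧
  ∀ y y', IsTranspositionSolution a y₀ y₁ ((Ioo 0 T).indicator f) y y' → y T = z₀ ∧ y' T = z₁

/-- Exact controllability in `L²(0,1) × H^{-1}_a(0,1)` in time `T`. -/
def IsExactlyControllable (a : ℝ → ℝ) (T : ℝ) : Prop :=
  ∀ (y₀ : L2) (y₁ : Hm1a a) (z₀ : L2) (z₁ : Hm1a a), ∃ f : ℝ → ℝ, Steers a T f y₀ y₁ z₀ z₁

/-- The form `Λ(W, W̃) = ∫₀ᵀ w_x(t,1) w̃_x(t,1) dt` is coercive on `H¹_a(0,1) × L²(0,1)`. -/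
def IsHUMCoercive (a : ℝ → ℝ) (T : ℝ) : Prop :=
  ∃ c > 0, ∀ (W : H1a a × L2) (w : ℝ → H1a a) (w' : ℝ → L2) (g : ℝ → ℝ),
    IsBackwardSolution a T W w w' g →
      c * (‖W.1‖ ^ 2 + ‖W.2‖ ^ 2) ≤ ∫ t in Ioo 0 T, g t * g t

/-- `W` solves the variational problem `Λ(W, W̃) = -𝓛(W̃)` for all `W̃ ∈ H¹_a(0,1) × L²(0,1)`, where
`𝓛(W̃) = ⟨y₁, w̃(0)⟩ - ∫₀¹ y₀ w̃'(0) dx`. -/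
def IsHUMDatum (a : ℝ → ℝ) (T : ℝ) (y₀ : L2) (y₁ : Hm1a a) (W : H1a a × L2) : Prop :=
  ∀ (w : ℝ → H1a a) (w' : ℝ → L2) (g : ℝ → ℝ), IsBackwardSolution a T W w w' g →
  ∀ (V : H1a a × L2) (v : ℝ → H1a a) (v' : ℝ → L2) (h : ℝ → ℝ), IsBackwardSolution a T V v v' h →
    ∫ t in Ioo 0 T, g t * h t = -(y₁ (v 0) - inner ℝ y₀ (v' 0))

end DegenerateWave

end

open MeasureTheory Set Filter Topology

noncomputable section

namespace DegenerateWave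

/-! ### Unitary groups generated by the inverse of a bounded skew-adjoint operator -/

section SkewGroup

variable {H : Type*} [NormedAddCommGroup H] [InnerProductSpace ℝ H] [CompleteSpace H]

/-! The homogeneous problem is written for the state `(√a w_x, w_t)`. Hardy's inequality makes `u ↦
√a u'` an isomorphism of `H¹_a` onto a closed subspace of `L²` (`energyEquiv`). If `B` (`energyEmb`)
sends `√a u'` back to `u`, then `(a u')' = z`, boundary condition at `0` included, is the same as
`√a u' = -B* z` (`hasDiv_iff`). The inverse of the wave generator is thus the bounded skew injective
operator `J (p, v) = (-B* v, B p)` (`waveInv`), and an abstract construction (`IsSkew.exists_group`)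
gives the unitary group `U`.

Observability comes from the multiplier `2 x w_x + (μ_a / 2) w`. Its derivative in time along a
classical solution is `a(1) w_x(t,1)²` minus a quantity that is at least `1 - μ_a / 2` times the
conserved energy and at most four times it (`multiplier_bounds`), while the multiplier itself is
bounded by the energy divided by `√a(1)` (`abs_multiplier_le`). Integration in time yields the
direct and inverse inequalities (`IsClassicalSolution.trace_bounds`). The direct one extends the
normal trace by density to a bounded operator `Γ` (`traceOp`) and makes the trace of a mild solution
unique (`IsNormalTrace.ae_eq`); the inverse one makes `Γ* Γ` coercive once `T` exceeds `4 / ((2 -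
μ_a) √a(1))`, which is at most `T_a`.

Solutions by transposition are explicit: if `Y` represents `(y₀, y₁)` on the state space, the state
dual to `(y, y')` at time `s` is `U(s) Y - a(1) Γ* (f(s - ·))` (`dualState`). It satisfies the
transposition identity by construction; the remaining point is that `y'` is the derivative of `y` in
`H^{-1}_a` (`hasDerivWithinAt_waveInv_dualState`). With `f = -w_x(·,1) / a(1)` the state at time `T`
is `U(T) Y + Γ* Γ W`, so steering to a target represented by `Z` amounts to solving `Γ* Γ W = Z -
U(T) Y`, which coercivity allows in exactly one way (`existsUnique_gramian`, `steers_of_inner`). -/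

theorem exists_unit_of_coercive (T : H →L[ℝ] H) {c : ℝ} (hc : 0 < c)
    (h : ∀ x, c * ‖x‖ ^ 2 ≤ inner ℝ (T x) x) : ∃ u : (H →L[ℝ] H)ˣ, (u : H →L[ℝ] H) = T := by
  have hB : IsCoercive (((innerSL ℝ : H →L[ℝ] H →L[ℝ] ℝ)).comp T) := by
    refine ⟨c, hc, fun x => ?_⟩
    have := h x
    simp only [ContinuousLinearMap.comp_apply, innerSL_apply_apply]
    nlinarith
  refine ⟨ContinuousLinearEquiv.toUnit hB.continuousLinearEquivOfBilin, ?_⟩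
  ext x
  refine (hB.unique_continuousLinearEquivOfBilin (v := x) (f := T x) fun w => ?_).symm
  simp

def IsSkew (S : H →L[ℝ] H) : Prop := ∀ x, inner ℝ (S x) x = 0

theorem IsSkew.inner_left {S : H →L[ℝ] H} (hS : IsSkew S) (x y : H) :
    inner ℝ (S x) y = -inner ℝ x (S y) := by
  have h := hS (x + y)
  rw [map_add, inner_add_left, inner_add_right, inner_add_right, hS x, hS y,
    real_inner_comm x (S y)] at h
  linarith

/-- If `x` is orthogonal to the range, then `‖J x‖² = -⟨x, J (J x)⟩ = 0`, so `x = 0` by injectivity.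
-/
theorem IsSkew.denseRange {J : H →L[ℝ] H} (hJ : IsSkew J) (hinj : Function.Injective J) :
    DenseRange J := by
  have h : (LinearMap.range J.toLinearMap).topologicalClosure = ⊤ := by
    rw [Submodule.topologicalClosure_eq_top_iff, Submodule.eq_bot_iff]
    intro x hx
    rw [Submodule.mem_orthogonal] at hx
    apply hinj
    rw [map_zero, ← inner_self_eq_zero (𝕜 := ℝ), hJ.inner_left]
    have := hx (J (J x)) ⟨J x, rfl⟩
    rw [real_inner_comm, this, neg_zero]
  have h2 := (Submodule.dense_iff_topologicalClosure_eq_top).2 h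
  exact h2

theorem hasDerivAt_exp_smul_apply (S : H →L[ℝ] H) (x : H) (t : ℝ) :
    HasDerivAt (fun t : ℝ => NormedSpace.exp (t • S) x) (NormedSpace.exp (t • S) (S x)) t :=
  (hasDerivAt_exp_smul_const S t).clm_apply (hasDerivAt_const t x) |>.congr_deriv (by simp)

theorem exp_smul_apply_comm {S R : H →L[ℝ] H} (h : Commute S R) (x : H) (t : ℝ) :
    R (NormedSpace.exp (t • S) x) = NormedSpace.exp (t • S) (R x) := by
  have h2 : Commute R (NormedSpace.exp (t • S)) := (h.symm.smul_right t).exp_right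
  exact DFunLike.congr_fun h2.eq x

theorem IsSkew.norm_exp_smul {S : H →L[ℝ] H} (hS : IsSkew S) (x : H) (t : ℝ) :
    ‖NormedSpace.exp (t • S) x‖ = ‖x‖ := by
  have hd : ∀ s : ℝ, HasDerivAt
      (fun s : ℝ => inner ℝ (NormedSpace.exp (s • S) x) (NormedSpace.exp (s • S) x)) 0 s := by
    intro s
    have h := hasDerivAt_exp_smul_apply S x s
    refine (h.inner ℝ h).congr_deriv ?_
    rw [← exp_smul_apply_comm (Commute.refl S), real_inner_comm, hS, add_zero]
  have h := is_const_of_deriv_eq_zero (fun s => (hd s).differentiableAt) (fun s => (hd s).deriv) t 0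
  simp only [zero_smul, NormedSpace.exp_zero, one_apply_eq_self,
    real_inner_self_eq_norm_sq] at h
  exact (sq_eq_sq₀ (norm_nonneg _) (norm_nonneg _)).1 h

theorem IsSkew.norm_exp_smul_sub {S : H →L[ℝ] H} (hS : IsSkew S) (x : H) (s t : ℝ) :
    ‖NormedSpace.exp (t • S) x - NormedSpace.exp (s • S) x‖ ≤ ‖S x‖ * |t - s| :=
  Convex.norm_image_sub_le_of_norm_hasDerivWithin_le (s := univ)
    (fun r _ => (hasDerivAt_exp_smul_apply S x r).hasDerivWithinAt)
    (fun r _ => (hS.norm_exp_smul _ r).le) convex_univ (mem_univ _) (mem_univ _)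

/-- Commutation gives `exp(tS) = exp(tR) exp(t(S - R))`; the first factor is an isometry, and `S -
R` is again skew. This is the estimate that makes the approximating groups Cauchy. -/
theorem IsSkew.norm_exp_smul_sub_exp_smul {S R : H →L[ℝ] H} (hS : IsSkew S) (hR : IsSkew R)
    (h : Commute S R) (x : H) (t : ℝ) :
    ‖NormedSpace.exp (t • S) x - NormedSpace.exp (t • R) x‖ ≤ ‖S x - R x‖ * |t| := by
  have hD : IsSkew (S - R) := fun x => by simp [inner_sub_left, hS x, hR x]
  let _ : NormedAlgebra ℚ (H →L[ℝ] H) := NormedAlgebra.restrictScalars ℚ ℝ (H →L[ℝ] H)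
  have h1 : NormedSpace.exp (t • S) = NormedSpace.exp (t • R) * NormedSpace.exp (t • (S - R)) := by
    rw [← NormedSpace.exp_add_of_commute]
    · rw [← smul_add, add_sub_cancel]
    · exact ((h.symm.sub_right (Commute.refl R)).smul_left t).smul_right t
  rw [h1, mul_apply_eq_comp, ← map_sub, hR.norm_exp_smul]
  simpa using hD.norm_exp_smul_sub x 0 t

theorem IsSkew.inner_exp_smul {S : H →L[ℝ] H} (hS : IsSkew S) (x y : H) (t : ℝ) :
    inner ℝ (NormedSpace.exp (t • S) x) y = inner ℝ x (NormedSpace.exp ((-t) • S) y) := by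
  let E : H →ₗᵢ[ℝ] H := ⟨(NormedSpace.exp (t • S) : H →L[ℝ] H).toLinearMap, fun x => hS.norm_exp_smul x t⟩
  let _ : NormedAlgebra ℚ (H →L[ℝ] H) := NormedAlgebra.restrictScalars ℚ ℝ (H →L[ℝ] H)
  have h1 : NormedSpace.exp (t • S) * NormedSpace.exp ((-t) • S) = 1 := by
    rw [← NormedSpace.exp_add_of_commute]
    · simp
    · exact ((Commute.refl S).smul_left t).smul_right (-t)
  have h2 : y = E (NormedSpace.exp ((-t) • S) y) := (DFunLike.congr_fun h1 y).symm
  conv_lhs => rw [h2]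
  exact E.inner_map_map x _

/-- `U` is the strongly continuous unitary group whose generator is the inverse of `J`. -/
structure IsSkewGroup (J : H →L[ℝ] H) (U : ℝ → H →L[ℝ] H) : Prop where
  norm_map : ∀ t x, ‖U t x‖ = ‖x‖
  inner_map : ∀ t x y, inner ℝ (U t x) y = inner ℝ x (U (-t) y)
  map_zero : ∀ x, U 0 x = x
  continuous : ∀ x, Continuous fun t => U t x
  comm : ∀ t x, J (U t x) = U t (J x)
  hasDerivAt : ∀ x t, HasDerivAt (fun t => J (U t x)) (U t x) t

omit [CompleteSpace H] in
theorem tendsto_of_isometries {E : ℕ → H →L[ℝ] H} (hE : ∀ n x, ‖E n x‖ = ‖x‖)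
    {J : H → H} (hJ : DenseRange J) (hC : ∀ y, CauchySeq fun n => E n (J y)) (x : H) :
    CauchySeq fun n => E n x := by
  rw [Metric.cauchySeq_iff']
  intro ε hε
  obtain ⟨y, hy⟩ := hJ.exists_dist_lt x (show 0 < ε / 3 by positivity)
  obtain ⟨N, hN⟩ := Metric.cauchySeq_iff'.1 (hC y) (ε / 3) (by positivity)
  refine ⟨N, fun n hn => ?_⟩
  have h1 : ∀ m, dist (E m x) (E m (J y)) < ε / 3 := fun m => by
    rw [dist_eq_norm, ← map_sub, hE, ← dist_eq_norm]; exact hy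
  have h2 := h1 n
  have h3 := h1 N
  have h4 := hN n hn
  have h5 := dist_triangle4 (E n x) (E n (J y)) (E N (J y)) (E N x)
  rw [dist_comm (E N (J y))] at h5
  linarith

/-- Resolvent of the inverse of a skew operator, in the form `(ε² - J²)⁻¹`. -/
theorem IsSkew.exists_resolvent {J : H →L[ℝ] H} (hJ : IsSkew J) {ε : ℝ} (hε : 0 < ε) :
    ∃ u : (H →L[ℝ] H)ˣ, (u : H →L[ℝ] H) = ε ^ 2 • (1 : H →L[ℝ] H) - J * J := by
  refine exists_unit_of_coercive _ (c := ε ^ 2) (by positivity) fun x => ?_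
  have h := hJ.inner_left (J x) x
  simp only [sub_apply, smul_apply,
    one_apply_eq_self, mul_apply_eq_comp, inner_sub_left,
    real_inner_smul_left, real_inner_self_eq_norm_sq] at h ⊢
  nlinarith [sq_nonneg ‖J x‖]

/-- With `y = R x`, pairing `ε² y - J² y = x` with `y` gives `⟨x, y⟩ = ε² ‖y‖² + ‖J y‖²`, from which
both norm bounds follow. Pairing `J y` with the same equation leaves only terms that vanish by
skewness, so `J R` is skew. -/
theorem resolvent_bounds {J R : H →L[ℝ] H} (hJ : IsSkew J) {ε : ℝ} (hε : 0 < ε)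
    (h : (ε ^ 2 • (1 : H →L[ℝ] H) - J * J) * R = 1) (x : H) :
    ‖ε ^ 2 • R x‖ ≤ ‖x‖ ∧ ‖ε ^ 2 • J (R x)‖ ≤ ε * ‖x‖ ∧ inner ℝ (J (R x)) x = 0 := by
  have hx : ε ^ 2 • R x - J (J (R x)) = x := DFunLike.congr_fun h x
  set y := R x
  have h1 : inner ℝ x y = ε ^ 2 * ‖y‖ ^ 2 + ‖J y‖ ^ 2 := by
    have h := hJ.inner_left (J y) y
    rw [← hx, inner_sub_left, real_inner_smul_left, h]
    simp only [real_inner_self_eq_norm_sq]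
    ring
  have h2 := real_inner_le_norm x y
  have h3 : ε ^ 2 * ‖y‖ ≤ ‖x‖ := by
    by_contra! hlt
    have : 0 < ‖y‖ := by
      by_contra! h0
      have : ‖y‖ = 0 := le_antisymm h0 (norm_nonneg _)
      rw [this] at hlt
      nlinarith [norm_nonneg x]
    nlinarith [sq_nonneg ‖J y‖]
  refine ⟨by rw [norm_smul]; simpa using h3, ?_, ?_⟩
  · rw [norm_smul, Real.norm_of_nonneg (by positivity)]
    refine (sq_le_sq₀ (by positivity) (by positivity)).1 ?_
    have : ‖J y‖ ^ 2 ≤ ‖x‖ * ‖y‖ := by nlinarith [sq_nonneg ‖y‖, sq_nonneg ε, mul_nonneg (sq_nonneg ε) (sq_nonneg ‖y‖)]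
    calc (ε ^ 2 * ‖J y‖) ^ 2 = ε ^ 4 * ‖J y‖ ^ 2 := by ring
      _ ≤ ε ^ 4 * (‖x‖ * ‖y‖) := by gcongr
      _ = ε ^ 2 * (ε ^ 2 * ‖y‖) * ‖x‖ := by ring
      _ ≤ ε ^ 2 * ‖x‖ * ‖x‖ := by gcongr
      _ = (ε * ‖x‖) ^ 2 := by ring
  · conv_lhs => rw [← hx]
    rw [inner_sub_right, real_inner_smul_right, hJ y, real_inner_comm, hJ (J y)]
    simp

/-- Bounded skew approximations of the unbounded operator `J⁻¹`, in the manner of Yosida: `Sₙ = -J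
(εₙ² - J²)⁻¹` with `εₙ → 0`. Then `Sₙ J y = y - εₙ² (εₙ² - J²)⁻¹ y`, and the last term tends to `0`.
-/
theorem IsSkew.exists_approximation {J : H →L[ℝ] H} (hJ : IsSkew J)
    (hinj : Function.Injective J) :
    ∃ S : ℕ → H →L[ℝ] H, (∀ n, IsSkew (S n)) ∧ (∀ m n, Commute (S m) (S n)) ∧
      (∀ n, Commute (S n) J) ∧ (∀ n y, ‖S n (J y)‖ ≤ 2 * ‖y‖) ∧
      ∀ y, Tendsto (fun n => S n (J y)) atTop (𝓝 y) := by
  have hε : ∀ n : ℕ, 0 < 1 / ((n : ℝ) + 1) := fun n => by positivity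
  choose u hu using fun n : ℕ => hJ.exists_resolvent (hε n)
  set ε : ℕ → ℝ := fun n => 1 / ((n : ℝ) + 1)
  let R : ℕ → H →L[ℝ] H := fun n => ((u n)⁻¹ : (H →L[ℝ] H)ˣ)
  have hJT : ∀ n, Commute J (u n : H →L[ℝ] H) := fun n => by
    rw [hu n]
    exact ((Commute.one_right J).smul_right _).sub_right ((Commute.refl J).mul_right (Commute.refl J))
  have hJR : ∀ n, Commute J (R n) := fun n => (hJT n).units_inv_right
  have hTT : ∀ m n, Commute (u m : H →L[ℝ] H) (u n : H →L[ℝ] H) := fun m n => by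
    rw [hu n]
    exact ((Commute.one_right _).smul_right _).sub_right
      ((hJT m).symm.mul_right (hJT m).symm)
  have hRR : ∀ m n, Commute (R m) (R n) := fun m n => ((hTT m n).units_inv_right).units_inv_left
  have hmul : ∀ n, ((ε n) ^ 2 • (1 : H →L[ℝ] H) - J * J) * R n = 1 := fun n => by
    rw [← hu n]; exact (u n).mul_inv
  have hb := fun n => resolvent_bounds hJ (hε n) (hmul n)
  have hS : ∀ n y, (-(J * R n)) (J y) = y - ε n ^ 2 • R n y := fun n y => by
    have h1 : R n (J y) = J (R n y) := DFunLike.congr_fun (hJR n).eq.symm y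
    have h2 : ε n ^ 2 • R n y - J (J (R n y)) = y := DFunLike.congr_fun (hmul n) y
    rw [neg_apply, mul_apply_eq_comp, h1]
    rw [eq_sub_iff_add_eq, neg_add_eq_sub]
    exact h2
  have hε0 : Tendsto ε atTop (𝓝 0) := tendsto_one_div_add_atTop_nhds_zero_nat
  -- The operators `εₙ² Rₙ` are contractions, and on the dense range of `J` they are small because
  -- `‖εₙ² J Rₙ z‖ ≤ εₙ ‖z‖`.
  have h0 : ∀ y, Tendsto (fun n => ε n ^ 2 • R n y) atTop (𝓝 0) := by
    intro y
    rw [Metric.tendsto_atTop]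
    intro δ hδ
    obtain ⟨z, hz⟩ := (hJ.denseRange hinj).exists_dist_lt y (show 0 < δ / 2 by positivity)
    have hlim : Tendsto (fun n => ε n * ‖z‖) atTop (𝓝 0) := by simpa using hε0.mul_const ‖z‖
    obtain ⟨N, hN⟩ := Metric.tendsto_atTop.1 hlim (δ / 2) (by positivity)
    refine ⟨N, fun n hn => ?_⟩
    have h1 : ε n ^ 2 • R n y = ε n ^ 2 • R n (y - J z) + ε n ^ 2 • J (R n z) := by
      rw [map_sub, smul_sub, show R n (J z) = J (R n z) from DFunLike.congr_fun (hJR n).eq.symm z,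
        sub_add_cancel]
    have h2 := (hb n (y - J z)).1
    have h3 := (hb n z).2.1
    have h4 := hN n hn
    rw [dist_zero_right, Real.norm_of_nonneg (by positivity)] at h4
    rw [dist_eq_norm] at hz
    rw [dist_zero_right, h1]
    exact (norm_add_le _ _).trans_lt (by linarith)
  refine ⟨fun n => -(J * R n), fun n x => ?_, fun m n => ?_, fun n => ?_, fun n y => ?_, fun y => ?_⟩
  · simpa using (hb n x).2.2
  · refine (Commute.neg_left ?_).neg_right
    exact ((Commute.refl J).mul_right (hJR n)).mul_left ((hJR m).symm.mul_right (hRR m n))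
  · exact (Commute.neg_left ((Commute.refl J).mul_left (hJR n).symm))
  · rw [hS]
    have := (hb n y).1
    exact (norm_sub_le _ _).trans (by linarith)
  · simp_rw [hS]
    simpa using (h0 y).const_sub y

/-- The isometries `exp(t Sₙ)` converge strongly, first on the range of `J`, where `Sₙ` converges,
and then everywhere by density. Unitarity and commutation with `J` pass to the limit. -/
theorem IsSkew.exists_group {J : H →L[ℝ] H} (hJ : IsSkew J) (hinj : Function.Injective J) :
    ∃ U : ℝ → H →L[ℝ] H, IsSkewGroup J U := by
  obtain ⟨S, hS, hSS, hSJ, hSb, hSt⟩ := hJ.exists_approximation hinj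
  have hd := hJ.denseRange hinj
  let E : ℕ → ℝ → H →L[ℝ] H := fun n t => NormedSpace.exp (t • S n)
  have hE : ∀ n t x, ‖E n t x‖ = ‖x‖ := fun n t x => (hS n).norm_exp_smul x t
  have hC : ∀ t x, CauchySeq fun n => E n t x := by
    intro t x
    refine tendsto_of_isometries (fun n x => hE n t x) hd (fun y => ?_) x
    have hc := (hSt y).cauchySeq
    rw [Metric.cauchySeq_iff'] at hc ⊢
    intro ε hε
    obtain ⟨N, hN⟩ := hc (ε / (|t| + 1)) (by positivity)
    refine ⟨N, fun n hn => ?_⟩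
    have h1 := (hS n).norm_exp_smul_sub_exp_smul (hS N) (hSS n N) (J y) t
    have h2 := hN n hn
    rw [dist_eq_norm] at h2 ⊢
    rw [lt_div_iff₀ (by positivity)] at h2
    nlinarith [norm_nonneg (S n (J y) - S N (J y)), abs_nonneg t]
  choose f hf using fun t x => cauchySeq_tendsto_of_complete (hC t x)
  let U : ℝ → H →L[ℝ] H := fun t => LinearMap.mkContinuous
    { toFun := f t
      map_add' := fun x y => tendsto_nhds_unique (hf t (x + y))
        (by simpa using (hf t x).add (hf t y))
      map_smul' := fun c x => tendsto_nhds_unique (hf t (c • x))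
        (by simpa using (hf t x).const_smul c) } 1 (fun x => by
      rw [one_mul]
      exact le_of_tendsto (hf t x).norm (Eventually.of_forall fun n => (hE n t x).le))
  have hU : ∀ t x, Tendsto (fun n => E n t x) atTop (𝓝 (U t x)) := hf
  have hn : ∀ t x, ‖U t x‖ = ‖x‖ := fun t x =>
    tendsto_nhds_unique (hU t x).norm (by simp [hE])
  have hcont : ∀ x, Continuous fun t => U t x := by
    intro x
    refine continuous_of_uniform_approx_of_continuous fun u hu => ?_
    obtain ⟨ε, hε, hεu⟩ := Metric.mem_uniformity_dist.1 hu
    obtain ⟨y, hy⟩ := hd.exists_dist_lt x hε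
    -- Orbits of points in the range of `J` are Lipschitz with constant `2 ‖y‖`, and they
    -- approximate every orbit uniformly in time.
    refine ⟨fun t => U t (J y), ?_, fun t => hεu ?_⟩
    · refine (LipschitzWith.of_dist_le_mul (K := ⟨2 * ‖y‖, by positivity⟩) fun t s => ?_).continuous
      rw [dist_eq_norm, Real.dist_eq]
      refine le_of_tendsto ((hU t (J y)).sub (hU s (J y))).norm (Eventually.of_forall fun n => ?_)
      refine ((hS n).norm_exp_smul_sub (J y) s t).trans ?_
      exact mul_le_mul_of_nonneg_right (hSb n y) (abs_nonneg _)
    · rw [dist_eq_norm, ← map_sub, hn, ← dist_eq_norm]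
      exact hy
  have hcomm : ∀ t x, J (U t x) = U t (J x) := fun t x =>
    tendsto_nhds_unique ((J.continuous.tendsto _).comp (hU t x))
      ((hU t (J x)).congr fun n => (exp_smul_apply_comm (hSJ n) x t).symm)
  -- The integrated equation holds for all `x`, since the approximate one only involves `Sₙ (J x)`,
  -- which tends to `x` and is dominated by `2 ‖x‖`.
  have hint : ∀ x t, J (U t x) - J x = ∫ s in (0 : ℝ)..t, U s x := by
    intro x t
    have h1 : ∀ n, J (E n t x) - J x = ∫ s in (0 : ℝ)..t, E n s (S n (J x)) := by
      intro n
      have hder : ∀ s : ℝ, HasDerivAt (fun s => E n s (J x)) (E n s (S n (J x))) s := fun s =>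
        hasDerivAt_exp_smul_apply (S n) (J x) s
      have hc : Continuous fun s => E n s (S n (J x)) :=
        continuous_iff_continuousAt.2 fun s =>
          (hasDerivAt_exp_smul_apply (S n) (S n (J x)) s).continuousAt
      rw [intervalIntegral.integral_eq_sub_of_hasDerivAt (fun s _ => hder s)
        (hc.intervalIntegrable _ _)]
      simp only [E, exp_smul_apply_comm (hSJ n), zero_smul, NormedSpace.exp_zero,
        one_apply_eq_self]
    refine tendsto_nhds_unique (((J.continuous.tendsto _).comp (hU t x)).sub_const (J x)) ?_
    simp only [Function.comp_apply, h1]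
    refine intervalIntegral.tendsto_integral_filter_of_dominated_convergence (fun _ => 2 * ‖x‖)
      (Eventually.of_forall fun n => ?_) (Eventually.of_forall fun n => ?_) (by simp) ?_
    · exact (continuous_iff_continuousAt.2 fun s =>
        (hasDerivAt_exp_smul_apply (S n) (S n (J x)) s).continuousAt).aestronglyMeasurable
    · exact Eventually.of_forall fun s _ => (hE n s _).le.trans (hSb n x)
    · refine Eventually.of_forall fun s _ => ?_
      have h2 : Tendsto (fun n => E n s (S n (J x)) - E n s x) atTop (𝓝 0) := by
        rw [tendsto_zero_iff_norm_tendsto_zero]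
        have h3 : Tendsto (fun n => ‖S n (J x) - x‖) atTop (𝓝 0) := by
          simpa using ((hSt x).sub_const x).norm
        refine h3.congr fun n => ?_
        rw [← map_sub, hE]
      simpa using h2.add (hU s x)
  refine ⟨U, hn, fun t x y => ?_, fun x => ?_, hcont, hcomm, fun x t => ?_⟩
  · refine tendsto_nhds_unique ((hU t x).inner tendsto_const_nhds)
      ((tendsto_const_nhds.inner (hU (-t) y)).congr fun n => ?_)
    exact ((hS n).inner_exp_smul x y t).symm
  · exact tendsto_nhds_unique (hU 0 x) (by simp [E])
  · have h1 : (fun t => J (U t x)) = fun t => (∫ s in (0 : ℝ)..t, U s x) + J x := by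
      ext t
      rw [← hint, sub_add_cancel]
    rw [h1]
    exact (intervalIntegral.integral_hasDerivAt_right ((hcont x).intervalIntegrable _ _)
      ((hcont x).stronglyMeasurableAtFilter _ _) (hcont x).continuousAt).add_const _

end SkewGroup


/-! ### Locally absolutely continuous functions on `]0,1]` -/

theorem ae_vol01_of_forall_Ioo {P : ℝ → Prop}
    (h : ∀ ε ∈ Ioo (0 : ℝ) 1, ∀ᵐ x, x ∈ uIcc ε 1 → P x) : ∀ᵐ x ∂vol01, P x := by
  have key : ∀ n : ℕ, ∀ᵐ x, x ∈ uIcc (1 / ((n : ℝ) + 2)) 1 → P x := by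
    intro n
    refine h _ ⟨by positivity, ?_⟩
    rw [div_lt_one (by positivity)]
    linarith [n.cast_nonneg (α := ℝ)]
  rw [ae_restrict_iff' measurableSet_Ioo]
  filter_upwards [ae_all_iff.2 key] with x hx hx01
  obtain ⟨n, hn⟩ := exists_nat_one_div_lt hx01.1
  refine hx n (mem_uIcc.2 (Or.inl ⟨le_trans ?_ hn.le, hx01.2.le⟩))
  gcongr
  norm_num

/-- `F` is locally absolutely continuous on `]0,1]` with derivative `f`. -/
structure HasACDeriv (F f : ℝ → ℝ) : Prop where
  ac : ∀ ε ∈ Ioo (0 : ℝ) 1, AbsolutelyContinuousOnInterval F ε 1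
  hasDerivAt : ∀ᵐ x ∂vol01, HasDerivAt F (f x) x

theorem uIcc_subset_Ioc {x : ℝ} (hx : x ∈ Ioc (0 : ℝ) 1) : uIcc x 1 ⊆ Ioc 0 1 := by
  rw [uIcc_of_le hx.2]
  exact fun y hy => ⟨hx.1.trans_le hy.1, hy.2⟩

namespace HasACDeriv

variable {F G f g : ℝ → ℝ}

theorem of_ac (h : ∀ ε ∈ Ioo (0 : ℝ) 1, AbsolutelyContinuousOnInterval F ε 1)
    (hf : deriv F =ᵐ[vol01] f) : HasACDeriv F f := by
  refine ⟨h, ?_⟩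
  filter_upwards [ae_differentiableAt_of_locallyAC h, hf] with x h1 h2
  rw [← h2]
  exact h1.hasDerivAt

theorem congr (h : HasACDeriv F f) (hf : f =ᵐ[vol01] g) : HasACDeriv F g := by
  refine ⟨h.ac, ?_⟩
  filter_upwards [h.hasDerivAt, hf] with x h1 h2
  exact h2 ▸ h1

theorem mul (hF : HasACDeriv F f) (hG : HasACDeriv G g) :
    HasACDeriv (fun x => F x * G x) (fun x => f x * G x + F x * g x) := by
  refine ⟨fun ε hε => (hF.ac ε hε).fun_mul (hG.ac ε hε), ?_⟩
  filter_upwards [hF.hasDerivAt, hG.hasDerivAt] with x h1 h2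
  exact h1.mul h2

theorem const_add (c : ℝ) (hF : HasACDeriv F f) : HasACDeriv (fun x => c + F x) f := by
  refine ⟨fun ε hε => ?_, ?_⟩
  · exact (contDiffOn_const.absolutelyContinuousOnInterval (f := fun _ => c)).fun_add (hF.ac ε hε)
  · filter_upwards [hF.hasDerivAt] with x h1
    exact h1.const_add c

theorem of_contDiffOn (h : ContDiffOn ℝ 1 F (Ioc 0 1)) : HasACDeriv F (derivWithin F (Ioc 0 1)) := by
  refine ⟨fun ε hε => ?_, ?_⟩
  · exact (h.mono (uIcc_subset_Ioc ⟨hε.1, hε.2.le⟩)).absolutelyContinuousOnInterval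
  · refine (ae_restrict_iff' measurableSet_Ioo).2 (Eventually.of_forall fun x hx => ?_)
    exact ((h.differentiableOn one_ne_zero) x (Ioo_subset_Ioc_self hx)).hasDerivWithinAt.hasDerivAt
      (Ioc_mem_nhds hx.1 hx.2)

theorem id : HasACDeriv (fun x => x) (fun _ => 1) := by
  refine ⟨fun ε _ => contDiffOn_id.absolutelyContinuousOnInterval, ?_⟩
  exact Eventually.of_forall fun x => hasDerivAt_id x

theorem of_integral {c : ℝ} (hc : c ∈ Ioc (0 : ℝ) 1)
    (h : ∀ ε ∈ Ioo (0 : ℝ) 1, IntervalIntegrable f volume ε 1) :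
    HasACDeriv (fun x => ∫ t in c..x, f t) f := by
  have h1 : HasACDeriv (fun x => ∫ t in (1 : ℝ)..x, f t) f := by
    refine ⟨fun ε hε => (h ε hε).absolutelyContinuousOnInterval_intervalIntegral (by simp), ?_⟩
    refine ae_vol01_of_forall_Ioo fun ε hε => ?_
    filter_upwards [(h ε hε).ae_hasDerivAt_integral] with x hx hx1
    exact hx hx1 1 (by simp)
  have hi : ∀ x ∈ Ioc (0 : ℝ) 1, IntervalIntegrable f volume 1 x := by
    intro x hx
    rcases hx.2.eq_or_lt with rfl | hx1
    · simp
    · exact (h x ⟨hx.1, hx1⟩).symm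
  have h2 := h1.const_add (∫ t in c..(1 : ℝ), f t)
  have heq : ∀ x ∈ Ioc (0 : ℝ) 1, (∫ t in c..(1 : ℝ), f t) + ∫ t in (1 : ℝ)..x, f t =
      ∫ t in c..x, f t := fun x hx =>
    intervalIntegral.integral_add_adjacent_intervals (hi c hc).symm (hi x hx)
  refine ⟨fun ε hε => ?_, ?_⟩
  · have h3 : IntervalIntegrable f volume (min ε c) 1 := by
      rcases min_choice ε c with h | h <;> rw [h]
      · exact (hi ε ⟨hε.1, hε.2.le⟩).symm
      · exact (hi c hc).symm
    refine (h3.absolutelyContinuousOnInterval_intervalIntegral (c := c) ?_).mono ?_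
    · rw [uIcc_of_le ((min_le_right _ _).trans hc.2)]
      exact ⟨min_le_right _ _, hc.2⟩
    · rw [uIcc_of_le ((min_le_right _ _).trans hc.2), uIcc_of_le hε.2.le]
      exact Icc_subset_Icc_left (min_le_left _ _)
  · filter_upwards [h2.hasDerivAt, ae_restrict_mem measurableSet_Ioo] with x hx hx01
    refine hx.congr_of_eventuallyEq ?_
    filter_upwards [Ioo_mem_nhds hx01.1 hx01.2] with y hy
    exact (heq y (Ioo_subset_Ioc_self hy)).symm

theorem deriv_ae_eq (h : HasACDeriv F f) : deriv F =ᵐ[vol01] f := by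
  filter_upwards [h.hasDerivAt] with x hx
  exact hx.deriv

theorem continuousOn (h : HasACDeriv F f) : ContinuousOn F (Ioo 0 1) := by
  intro x hx
  have hx2 : x / 2 ∈ Ioo (0 : ℝ) 1 := ⟨by linarith [hx.1], by linarith [hx.1, hx.2]⟩
  have h1 := (h.ac _ hx2).continuousOn
  rw [uIcc_of_le hx2.2.le] at h1
  exact (h1.continuousAt (Icc_mem_nhds (by linarith [hx.1]) hx.2)).continuousWithinAt

theorem ae_uIoc_of_vol01 {P : ℝ → Prop} (h : ∀ᵐ x ∂vol01, P x) {x : ℝ} (hx : x ∈ Ico (0 : ℝ) 1) :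
    ∀ᵐ y ∂volume.restrict (uIoc x 1), P y := by
  rw [uIoc_of_le hx.2.le, ← Measure.restrict_congr_set Ioo_ae_eq_Ioc]
  exact ae_restrict_of_ae_restrict_of_subset (Ioo_subset_Ioo_left hx.1) h

theorem intervalIntegrable (h : HasACDeriv F f) {x : ℝ} (hx : x ∈ Ioc (0 : ℝ) 1) :
    IntervalIntegrable f volume x 1 := by
  rcases hx.2.eq_or_lt with rfl | hx1
  · simp
  · exact (h.ac x ⟨hx.1, hx1⟩).intervalIntegrable_deriv.congr_ae
      (ae_uIoc_of_vol01 h.deriv_ae_eq ⟨hx.1.le, hx1⟩)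

theorem integral_eq (h : HasACDeriv F f) {x : ℝ} (hx : x ∈ Ioc (0 : ℝ) 1) :
    ∫ t in x..1, f t = F 1 - F x := by
  rcases hx.2.eq_or_lt with rfl | hx1
  · simp
  · rw [← (h.ac x ⟨hx.1, hx1⟩).integral_deriv_eq_sub]
    exact intervalIntegral.integral_congr_ae_restrict
      (ae_uIoc_of_vol01 h.deriv_ae_eq.symm ⟨hx.1.le, hx1⟩)

theorem tendsto_zero (h : HasACDeriv F f) (hf : Integrable f vol01) :
    Tendsto F (𝓝[>] 0) (𝓝 (F 1 - ∫ x in Ioo (0 : ℝ) 1, f x)) := by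
  have h1 : IntegrableOn f (uIcc 0 1) volume := by
    rw [uIcc_of_le zero_le_one, integrableOn_Icc_iff_integrableOn_Ioo]
    exact hf
  have h2 : ContinuousWithinAt (fun x => ∫ t in x..1, f t) (uIcc 0 1) 0 :=
    intervalIntegral.continuousOn_primitive_interval_left h1 0 left_mem_uIcc
  rw [uIcc_of_le zero_le_one] at h2
  have h3 : Tendsto (fun x => ∫ t in x..1, f t) (𝓝[>] 0) (𝓝 (∫ t in (0 : ℝ)..1, f t)) :=
    h2.tendsto.mono_left (nhdsWithin_le_of_mem (Icc_mem_nhdsGT one_pos))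
  rw [intervalIntegral.integral_of_le zero_le_one, integral_Ioc_eq_integral_Ioo] at h3
  refine (h3.const_sub (F 1)).congr' ?_
  filter_upwards [Ioc_mem_nhdsGT one_pos] with x hx
  rw [h.integral_eq hx]
  ring

end HasACDeriv

/-- Divergence of `∫ dx / x` at `0`. It is the tool that forces boundary terms at the degenerate
endpoint to vanish. -/
theorem not_eventually_div_le {g : ℝ → ℝ} (hg : Integrable g vol01) {c : ℝ} (hc : 0 < c) :
    ¬ ∀ᶠ x in 𝓝[>] (0 : ℝ), c / x ≤ g x := by
  intro h
  obtain ⟨u, hu, hsub⟩ := mem_nhdsGT_iff_exists_Ioo_subset.1 h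
  have hu0 : (0 : ℝ) < u := hu
  set v := min u 1
  have hv : 0 < v := lt_min hu0 one_pos
  have h1 : IntegrableOn g (Ioo 0 v) := by
    refine IntegrableOn.mono_set (t := Ioo 0 1) hg (Ioo_subset_Ioo_right (min_le_right _ _))
  have h2 : IntegrableOn (fun x : ℝ => x ^ (-1 : ℝ)) (Ioo 0 v) := by
    refine Integrable.mono' (h1.const_mul c⁻¹) (by fun_prop) ?_
    refine (ae_restrict_iff' measurableSet_Ioo).2 (Eventually.of_forall fun x hx => ?_)
    have h3 : c / x ≤ g x := hsub ⟨hx.1, hx.2.trans_le (min_le_left _ _)⟩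
    rw [Real.norm_of_nonneg (Real.rpow_nonneg hx.1.le _), Real.rpow_neg_one]
    calc x⁻¹ = c⁻¹ * (c / x) := by field_simp
      _ ≤ _ := by gcongr
  rw [intervalIntegral.integrableOn_Ioo_rpow_iff hv] at h2
  exact lt_irrefl _ h2

/-- A nonnegative function with integrable derivative of the form `x g(x)`, `g` integrable, tends
to `0` at `0`. -/
theorem HasACDeriv.tendsto_zero_of_eq_mul {F f g : ℝ → ℝ} (h : HasACDeriv F f)
    (hf : Integrable f vol01) (hg : Integrable g vol01)
    (hF : ∀ x ∈ Ioo (0 : ℝ) 1, 0 ≤ F x ∧ F x = x * g x) :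
    Tendsto F (𝓝[>] 0) (𝓝 0) ∧ ∫ x in Ioo (0 : ℝ) 1, f x = F 1 := by
  have h1 := h.tendsto_zero hf
  set l := F 1 - ∫ x in Ioo (0 : ℝ) 1, f x with hl
  have hl0 : 0 ≤ l := ge_of_tendsto h1 (by
    filter_upwards [Ioo_mem_nhdsGT one_pos] with x hx using (hF x hx).1)
  have hl1 : l = 0 := by
    by_contra hne
    have hpos : 0 < l := lt_of_le_of_ne hl0 (Ne.symm hne)
    refine not_eventually_div_le hg (half_pos hpos) ?_
    filter_upwards [h1.eventually (lt_mem_nhds (half_lt_self hpos)), Ioo_mem_nhdsGT one_pos]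
      with x hx hx01
    rw [div_le_iff₀ hx01.1, mul_comm, ← (hF x hx01).2]
    exact hx.le
  rw [hl1] at h1
  exact ⟨h1, by linarith⟩

/-! ### The coefficient -/

section Coefficient

variable {a : ℝ → ℝ} (ha : IsDegenerateCoefficient a)
include ha

theorem IsDegenerateCoefficient.abs_deriv_le {x : ℝ} (hx : x ∈ Ioc (0 : ℝ) 1) :
    x * |derivWithin a (Ioc 0 1) x| ≤ mu a * a x := by
  rw [← div_le_iff₀ (ha.pos x hx)]
  exact le_csSup ha.bddAbove ⟨x, hx, rfl⟩

theorem IsDegenerateCoefficient.one_pos : 0 < a 1 := ha.pos 1 (by simp)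

theorem IsDegenerateCoefficient.mu_nonneg : 0 ≤ mu a := by
  have h := ha.abs_deriv_le (x := 1) (by simp)
  have h1 := ha.one_pos
  rw [one_mul] at h
  exact nonneg_of_mul_nonneg_left ((abs_nonneg _).trans h) h1

theorem IsDegenerateCoefficient.hasDerivAt {x : ℝ} (hx : x ∈ Ioo (0 : ℝ) 1) :
    HasDerivAt a (derivWithin a (Ioc 0 1) x) x :=
  ((ha.contDiffOn.differentiableOn one_ne_zero) x
    (Ioo_subset_Ioc_self hx)).hasDerivWithinAt.hasDerivAt (Ioc_mem_nhds hx.1 hx.2)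

/-- Since `x a' ≤ μ_a a`, the function `a(x) x^(-μ_a)` is nonincreasing, so it is at least its value
at `1`. The lower bounds and integrability statements for `a` rest on this. -/
theorem IsDegenerateCoefficient.rpow_le {x : ℝ} (hx : x ∈ Ioc (0 : ℝ) 1) :
    a 1 * x ^ mu a ≤ a x := by
  have hd : ∀ y ∈ Ioo (0 : ℝ) 1, HasDerivAt (fun y => a y * y ^ (-mu a))
      (derivWithin a (Ioc 0 1) y * y ^ (-mu a) + a y * (-mu a * y ^ (-mu a - 1))) y := fun y hy =>
    (ha.hasDerivAt hy).mul (Real.hasDerivAt_rpow_const (Or.inl hy.1.ne'))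
  have hanti : AntitoneOn (fun y => a y * y ^ (-mu a)) (Ioc 0 1) := by
    refine antitoneOn_of_deriv_nonpos (convex_Ioc 0 1) ?_ ?_ ?_
    · refine (ha.continuousOn.mono Ioc_subset_Icc_self).mul ?_
      exact continuousOn_id.rpow_const fun y hy => Or.inl hy.1.ne'
    · rw [interior_Ioc]
      exact fun y hy => (hd y hy).differentiableAt.differentiableWithinAt
    · rw [interior_Ioc]
      intro y hy
      rw [(hd y hy).deriv]
      have h1 := ha.abs_deriv_le (Ioo_subset_Ioc_self hy)
      have h2 : y ^ (-mu a) = y * y ^ (-mu a - 1) := by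
        rw [Real.rpow_sub_one hy.1.ne']
        field_simp [hy.1.ne']
      have h3 : 0 < y ^ (-mu a - 1) := Real.rpow_pos_of_pos hy.1 _
      have h4 : y * derivWithin a (Ioc 0 1) y ≤ mu a * a y :=
        (mul_le_mul_of_nonneg_left (le_abs_self _) hy.1.le).trans h1
      rw [h2]
      nlinarith
  have h1 := hanti hx (right_mem_Ioc.2 zero_lt_one) hx.2
  simp only [Real.one_rpow, mul_one] at h1
  rw [Real.rpow_neg hx.1.le, ← div_eq_mul_inv, le_div_iff₀ (Real.rpow_pos_of_pos hx.1 _)] at h1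
  exact h1

theorem IsDegenerateCoefficient.sq_le {x : ℝ} (hx : x ∈ Ioc (0 : ℝ) 1) : a 1 * x ^ 2 ≤ a x := by
  refine le_trans (mul_le_mul_of_nonneg_left ?_ ha.one_pos.le) (ha.rpow_le hx)
  rw [← Real.rpow_two]
  exact Real.rpow_le_rpow_of_exponent_ge hx.1 hx.2 ha.mu_lt_two.le

theorem IsDegenerateCoefficient.aestronglyMeasurable : AEStronglyMeasurable a vol01 :=
  (ha.continuousOn.mono Ioo_subset_Icc_self).aestronglyMeasurable measurableSet_Ioo

theorem IsDegenerateCoefficient.integrable_id_div : Integrable (fun x => x / a x) vol01 := by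
  have h1 : IntegrableOn (fun x : ℝ => x ^ (1 - mu a)) (Ioo 0 1) := by
    rw [intervalIntegral.integrableOn_Ioo_rpow_iff zero_lt_one]
    linarith [ha.mu_lt_two]
  refine Integrable.mono' (h1.const_mul (a 1)⁻¹)
    (aestronglyMeasurable_id.div₀ ha.aestronglyMeasurable) ?_
  refine (ae_restrict_iff' measurableSet_Ioo).2 (Eventually.of_forall fun x hx => ?_)
  have h2 := ha.rpow_le (Ioo_subset_Ioc_self hx)
  have h3 := Real.rpow_pos_of_pos hx.1 (mu a)
  have h4 := ha.one_pos
  have hap := ha.pos x (Ioo_subset_Ioc_self hx)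
  rw [Real.norm_of_nonneg (div_nonneg hx.1.le hap.le), Real.rpow_sub hx.1, Real.rpow_one]
  calc x / a x ≤ x / (a 1 * x ^ mu a) := by gcongr; exact hx.1.le
    _ = _ := by field_simp

theorem IsDegenerateCoefficient.integrable_inv (hmu : mu a < 1) :
    Integrable (fun x => 1 / a x) vol01 := by
  have h1 : IntegrableOn (fun x : ℝ => x ^ (-mu a)) (Ioo 0 1) := by
    rw [intervalIntegral.integrableOn_Ioo_rpow_iff zero_lt_one]
    linarith
  refine Integrable.mono' (h1.const_mul (a 1)⁻¹)
    (aestronglyMeasurable_const.div₀ ha.aestronglyMeasurable) ?_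
  refine (ae_restrict_iff' measurableSet_Ioo).2 (Eventually.of_forall fun x hx => ?_)
  have h2 := ha.rpow_le (Ioo_subset_Ioc_self hx)
  have h3 := Real.rpow_pos_of_pos hx.1 (mu a)
  have h4 := ha.one_pos
  have hap := ha.pos x (Ioo_subset_Ioc_self hx)
  rw [Real.norm_of_nonneg (div_nonneg zero_le_one hap.le), Real.rpow_neg hx.1.le]
  calc 1 / a x ≤ 1 / (a 1 * x ^ mu a) := by gcongr
    _ = _ := by field_simp

/-- Here `[μ_a] = 1`, so `a` is `C¹` up to `0`, hence Lipschitz, and `a(0) = 0`. -/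
theorem IsDegenerateCoefficient.exists_le_mul (hmu : 1 ≤ mu a) :
    ∃ C > 0, ∀ x ∈ Ioc (0 : ℝ) 1, a x ≤ C * x := by
  have hfl : ⌊mu a⌋₊ = 1 := by
    rw [Nat.floor_eq_iff (by linarith)]
    exact ⟨by simpa using hmu, by have := ha.mu_lt_two; norm_num; linarith⟩
  have h1 := ha.contDiffOn_floor
  rw [hfl] at h1
  obtain ⟨K, hK⟩ := h1.exists_lipschitzOnWith (by simp) (convex_Icc 0 1) isCompact_Icc
  refine ⟨K + 1, by positivity, fun x hx => ?_⟩
  have h2 := hK.dist_le_mul x ⟨hx.1.le, hx.2⟩ 0 (by simp)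
  rw [ha.zero, dist_zero_right, dist_zero_right, Real.norm_of_nonneg (ha.pos x hx).le,
    Real.norm_of_nonneg hx.1.le] at h2
  nlinarith [hx.1]

theorem IsDegenerateCoefficient.continuousOn_sqrt : ContinuousOn (fun x => √(a x)) (Ioc 0 1) :=
  (ha.continuousOn.mono Ioc_subset_Icc_self).sqrt

theorem IsDegenerateCoefficient.sqrt_pos {x : ℝ} (hx : x ∈ Ioc (0 : ℝ) 1) : 0 < √(a x) :=
  Real.sqrt_pos.2 (ha.pos x hx)

end Coefficient


/-! ### Hardy's inequality and the primitive operator -/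

theorem inner_L2_eq (f g : L2) : inner ℝ f g = ∫ x in Ioo (0 : ℝ) 1, f x * g x := by
  rw [MeasureTheory.L2.inner_def]
  simp [mul_comm]

theorem norm_sq_L2_eq (f : L2) : ‖f‖ ^ 2 = ∫ x in Ioo (0 : ℝ) 1, f x ^ 2 := by
  rw [← real_inner_self_eq_norm_sq, inner_L2_eq]
  simp [sq]

theorem norm_toLp_sq {f : ℝ → ℝ} (hf : MemLp f 2 vol01) :
    ‖hf.toLp f‖ ^ 2 = ∫ x in Ioo (0 : ℝ) 1, f x ^ 2 := by
  rw [norm_sq_L2_eq]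
  refine integral_congr_ae ?_
  filter_upwards [hf.coeFn_toLp] with x hx
  rw [hx]

theorem intervalIntegrable_of_memLp {p : ℝ → ℝ} (hp : MemLp p 2 vol01) :
    IntervalIntegrable p volume 0 1 := by
  rw [intervalIntegrable_iff_integrableOn_Ioo_of_le zero_le_one]
  exact hp.integrable (by norm_num)

section Hardy

variable {a : ℝ → ℝ} (ha : IsDegenerateCoefficient a)
include ha

theorem IsDegenerateCoefficient.aestronglyMeasurable_sqrt :
    AEStronglyMeasurable (fun x => √(a x)) vol01 :=
  (ha.continuousOn_sqrt.mono Ioo_subset_Ioc_self).aestronglyMeasurable measurableSet_Ioo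

theorem IsDegenerateCoefficient.hasACDeriv_integral {p : ℝ → ℝ} (hp : MemLp p 2 vol01) :
    HasACDeriv (fun x => ∫ s in (1 : ℝ)..x, p s / √(a s)) (fun x => p x / √(a x)) := by
  refine HasACDeriv.of_integral (by simp) fun ε hε => ?_
  have h1 := (intervalIntegrable_of_memLp hp).mono_set (c := ε) (d := 1)
    (by rw [uIcc_of_le hε.2.le, uIcc_of_le zero_le_one]; exact Icc_subset_Icc_left hε.1.le)
  have h2 : ContinuousOn (fun x => (√(a x))⁻¹) (uIcc ε 1) := by
    refine (ha.continuousOn_sqrt.mono (uIcc_subset_Ioc ⟨hε.1, hε.2.le⟩)).inv₀ fun x hx => ?_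
    exact (ha.sqrt_pos (uIcc_subset_Ioc ⟨hε.1, hε.2.le⟩ hx)).ne'
  simpa only [div_eq_mul_inv] using h1.mul_continuousOn h2

theorem IsDegenerateCoefficient.sq_mul_div_sqrt_le (p : ℝ → ℝ) {x : ℝ} (hx : x ∈ Ioo (0 : ℝ) 1) :
    (x * (p x / √(a x))) ^ 2 ≤ (a 1)⁻¹ * p x ^ 2 := by
  have h1 := ha.sq_le (Ioo_subset_Ioc_self hx)
  have h2 := ha.pos x (Ioo_subset_Ioc_self hx)
  have h3 := ha.one_pos
  rw [mul_pow, div_pow, Real.sq_sqrt h2.le, ← mul_div_assoc, div_le_iff₀ h2]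
  have : x ^ 2 ≤ (a 1)⁻¹ * a x := by
    rw [inv_mul_eq_div, le_div_iff₀ h3]; linarith
  nlinarith [sq_nonneg (p x)]

theorem IsDegenerateCoefficient.memLp_mul_div_sqrt {p : ℝ → ℝ} (hp : MemLp p 2 vol01) :
    MemLp (fun x => x * (p x / √(a x))) 2 vol01 ∧
      ∫ x in Ioo (0 : ℝ) 1, (x * (p x / √(a x))) ^ 2 ≤ (a 1)⁻¹ * ∫ x in Ioo (0 : ℝ) 1, p x ^ 2 := by
  have hm : AEStronglyMeasurable (fun x => x * (p x / √(a x))) vol01 :=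
    aestronglyMeasurable_id.mul (hp.1.div₀ ha.aestronglyMeasurable_sqrt)
  have hle : ∀ᵐ x ∂vol01, (x * (p x / √(a x))) ^ 2 ≤ (a 1)⁻¹ * p x ^ 2 :=
    (ae_restrict_iff' measurableSet_Ioo).2
      (Eventually.of_forall fun x hx => ha.sq_mul_div_sqrt_le p hx)
  have hi := ((memLp_two_iff_integrable_sq hp.1).1 hp).const_mul (a 1)⁻¹
  have hi2 : Integrable (fun x => (x * (p x / √(a x))) ^ 2) vol01 := by
    refine hi.mono' (hm.pow 2) ?_
    filter_upwards [hle] with x hx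
    rwa [Real.norm_of_nonneg (sq_nonneg _)]
  refine ⟨(memLp_two_iff_integrable_sq hm).2 hi2, ?_⟩
  rw [← integral_const_mul]
  exact integral_mono_ae hi2 hi hle

variable {U p : ℝ → ℝ} (hp : MemLp p 2 vol01) (hU : HasACDeriv U fun x => p x / √(a x))
  (hU1 : U 1 = 0)
include hp hU hU1

/-- From `(U + 2 x U')² ≥ 0` follows `U² ≤ 2 (x U²)' + 4 (x U')²`, and `a(1) x² ≤ a` bounds `(x
U')²` by `p² / a(1)`. On `(ε, 1)` the boundary terms contribute `-2 ε U(ε)² ≤ 0`, so the estimate is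
uniform in `ε`. -/
theorem IsDegenerateCoefficient.hardy :
    MemLp U 2 vol01 ∧ ∫ x in Ioo (0 : ℝ) 1, U x ^ 2 ≤ 4 / a 1 * ∫ x in Ioo (0 : ℝ) 1, p x ^ 2 := by
  have ha1 := ha.one_pos
  have hm : AEStronglyMeasurable U vol01 :=
    hU.continuousOn.aestronglyMeasurable measurableSet_Ioo
  have hp2 : Integrable (fun x => p x ^ 2) vol01 := (memLp_two_iff_integrable_sq hp.1).1 hp
  have hF := HasACDeriv.id.mul (hU.mul hU)
  have hle : ∀ x ∈ Ioo (0 : ℝ) 1, U x ^ 2 ≤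
      2 * (1 * (U x * U x) + x * (p x / √(a x) * U x + U x * (p x / √(a x)))) +
        4 / a 1 * p x ^ 2 := by
    intro x hx
    have h1 := ha.sq_mul_div_sqrt_le p hx
    have h2 : 4 / a 1 * p x ^ 2 = 4 * ((a 1)⁻¹ * p x ^ 2) := by ring
    rw [h2]
    nlinarith [sq_nonneg (U x + 2 * (x * (p x / √(a x))))]
  have hint : ∀ ε ∈ Ioo (0 : ℝ) 1, IntegrableOn (fun x => U x ^ 2) (Ioc ε 1) ∧
      ∫ x in Ioc ε 1, ‖U x ^ 2‖ ≤ 4 / a 1 * ∫ x in Ioo (0 : ℝ) 1, p x ^ 2 := by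
    intro ε hε
    have hεs : Ioo ε 1 ⊆ Ioo 0 1 := Ioo_subset_Ioo_left hε.1.le
    have hc : ContinuousOn U (Icc ε 1) := by
      have := (hU.ac ε hε).continuousOn
      rwa [uIcc_of_le hε.2.le] at this
    have hi : IntegrableOn (fun x => U x ^ 2) (Ioc ε 1) :=
      ((hc.pow 2).integrableOn_Icc).mono_set Ioc_subset_Icc_self
    refine ⟨hi, ?_⟩
    have h3 := hF.integral_eq ⟨hε.1, hε.2.le⟩
    have hFi := (intervalIntegrable_iff_integrableOn_Ioo_of_le hε.2.le).1
      (hF.intervalIntegrable ⟨hε.1, hε.2.le⟩)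
    rw [intervalIntegral.integral_of_le hε.2.le, integral_Ioc_eq_integral_Ioo, hU1] at h3
    have hpε : IntegrableOn (fun x => p x ^ 2) (Ioo ε 1) := IntegrableOn.mono_set hp2 hεs
    have h4 : ∫ x in Ioo ε 1, p x ^ 2 ≤ ∫ x in Ioo (0 : ℝ) 1, p x ^ 2 :=
      setIntegral_mono_set hp2 (Eventually.of_forall fun x => sq_nonneg _)
        hεs.eventuallyLE
    have hn : ∀ x, ‖U x ^ 2‖ = U x ^ 2 := fun x => Real.norm_of_nonneg (sq_nonneg _)
    simp_rw [hn]
    rw [integral_Ioc_eq_integral_Ioo]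
    calc ∫ x in Ioo ε 1, U x ^ 2 ≤ ∫ x in Ioo ε 1,
          (2 * (1 * (U x * U x) + x * (p x / √(a x) * U x + U x * (p x / √(a x)))) +
            4 / a 1 * p x ^ 2) := by
          refine setIntegral_mono_on (hi.mono_set Ioo_subset_Ioc_self)
            ((hFi.const_mul 2).add (hpε.const_mul _)) measurableSet_Ioo fun x hx => hle x (hεs hx)
      _ = 2 * (1 * (0 * 0) - ε * (U ε * U ε)) + 4 / a 1 * ∫ x in Ioo ε 1, p x ^ 2 := by
          rw [integral_add (hFi.const_mul 2) (hpε.const_mul _), integral_const_mul,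
            integral_const_mul, h3]
      _ ≤ _ := by
          have : 4 / a 1 * ∫ x in Ioo ε 1, p x ^ 2 ≤ 4 / a 1 * ∫ x in Ioo (0 : ℝ) 1, p x ^ 2 := by
            gcongr
          nlinarith [mul_nonneg hε.1.le (mul_self_nonneg (U ε))]
  have hlim : Tendsto (fun n : ℕ => 1 / ((n : ℝ) + 2)) atTop (𝓝 0) := by
    have := (tendsto_const_nhds (x := (1 : ℝ))).div_atTop
      (tendsto_atTop_add_const_right atTop (2 : ℝ) tendsto_natCast_atTop_atTop)
    exact this
  have hmem : ∀ n : ℕ, 1 / ((n : ℝ) + 2) ∈ Ioo (0 : ℝ) 1 := by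
    intro n
    refine ⟨by positivity, ?_⟩
    rw [div_lt_one (by positivity)]
    linarith [n.cast_nonneg (α := ℝ)]
  have hi : IntegrableOn (fun x => U x ^ 2) (Ioc 0 1) :=
    integrableOn_Ioc_of_intervalIntegral_norm_bounded_left (fun n => (hint _ (hmem n)).1) hlim
      (Eventually.of_forall fun n => (hint _ (hmem n)).2)
  have hi' : Integrable (fun x => U x ^ 2) vol01 := hi.mono_set Ioo_subset_Ioc_self
  refine ⟨(memLp_two_iff_integrable_sq hm).2 hi', ?_⟩
  have h5 := (intervalIntegral.continuousOn_primitive_interval_left (a := 0) (b := 1)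
    (f := fun x => U x ^ 2) (μ := volume) (by
      rw [uIcc_of_le zero_le_one, integrableOn_Icc_iff_integrableOn_Ioo]; exact hi')) 0
      left_mem_uIcc
  rw [uIcc_of_le zero_le_one] at h5
  have h6 : Tendsto (fun n : ℕ => ∫ t in (1 / ((n : ℝ) + 2))..1, U t ^ 2) atTop
      (𝓝 (∫ t in (0 : ℝ)..1, U t ^ 2)) :=
    h5.tendsto.comp (tendsto_nhdsWithin_iff.2 ⟨hlim, Eventually.of_forall fun n =>
      Ioo_subset_Icc_self (hmem n)⟩)
  rw [intervalIntegral.integral_of_le zero_le_one, integral_Ioc_eq_integral_Ioo] at h6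
  refine le_of_tendsto h6 (Eventually.of_forall fun n => ?_)
  have h7 := (hint _ (hmem n)).2
  rw [intervalIntegral.integral_of_le (hmem n).2.le]
  simpa [abs_of_nonneg, sq_nonneg] using h7

/-- The derivative `U² + 2 x U U'` of `x U²` is integrable, so `x U²` has a limit at `0`; a positive
limit would contradict the integrability of `U²`. -/
theorem IsDegenerateCoefficient.boundary :
    Tendsto (fun x => x * U x ^ 2) (𝓝[>] 0) (𝓝 0) ∧
      ∫ x in Ioo (0 : ℝ) 1, U x * (x * (p x / √(a x))) = -(1 / 2) * ∫ x in Ioo (0 : ℝ) 1, U x ^ 2 := by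
  have h1 := (ha.hardy hp hU hU1).1
  have h2 := (ha.memLp_mul_div_sqrt hp).1
  have hU2 : Integrable (fun x => U x ^ 2) vol01 := (memLp_two_iff_integrable_sq h1.1).1 h1
  have h3 : Integrable (fun x => U x * (x * (p x / √(a x)))) vol01 := h1.integrable_mul h2
  have hF := HasACDeriv.id.mul (hU.mul hU)
  have heq : (fun x => 1 * (U x * U x) + x * (p x / √(a x) * U x + U x * (p x / √(a x)))) =
      fun x => U x ^ 2 + 2 * (U x * (x * (p x / √(a x)))) := by
    ext x; ring
  rw [heq] at hF
  have h4 := hF.tendsto_zero_of_eq_mul (g := fun x => U x ^ 2) (hU2.add (h3.const_mul 2)) hU2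
    fun x hx => ⟨mul_nonneg hx.1.le (mul_self_nonneg _), by ring⟩
  refine ⟨h4.1.congr fun x => by ring, ?_⟩
  have h5 := h4.2
  rw [integral_add hU2 (h3.const_mul 2), integral_const_mul, hU1] at h5
  linarith

end Hardy


/-! ### The space `H¹_a(0,1)` as a closed subspace of `L²(0,1)` -/

/-- The primitive of `p / √a` that vanishes at `1`. -/
def prim (a p : ℝ → ℝ) (x : ℝ) : ℝ := ∫ s in (1 : ℝ)..x, p s / √(a s)

theorem prim_one (a p : ℝ → ℝ) : prim a p 1 = 0 := by simp [prim]

theorem HasACDeriv.continuousWithinAt_one {F f : ℝ → ℝ} (hF : HasACDeriv F f) :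
    ContinuousWithinAt F (Iio 1) 1 := by
  have h1 := (hF.ac (1 / 2) ⟨by norm_num, by norm_num⟩).continuousOn
  rw [uIcc_of_le (by norm_num)] at h1
  have h2 := h1 1 ⟨by norm_num, le_rfl⟩
  exact h2.mono_of_mem_nhdsWithin (Icc_mem_nhdsLT (by norm_num))

theorem HasACDeriv.eqOn {F G f g : ℝ → ℝ} (hF : HasACDeriv F f) (hG : HasACDeriv G g)
    (h : F =ᵐ[vol01] G) : EqOn F G (Ioc 0 1) := by
  have h1 : EqOn F G (Ioo 0 1) :=
    MeasureTheory.Measure.eqOn_open_of_ae_eq h isOpen_Ioo hF.continuousOn hG.continuousOn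
  intro x hx
  rcases hx.2.eq_or_lt with rfl | hx1
  · refine tendsto_nhds_unique (hF.continuousWithinAt_one.tendsto.congr' ?_)
      hG.continuousWithinAt_one.tendsto
    filter_upwards [Ioo_mem_nhdsLT one_pos] with y hy using h1 hy
  · exact h1 ⟨hx.1, hx1⟩

theorem memLp_L2 (p : L2) : MemLp p 2 vol01 := Lp.memLp p

section Prim

variable {a : ℝ → ℝ} (ha : IsDegenerateCoefficient a)
include ha

theorem hasACDeriv_prim (p : L2) : HasACDeriv (prim a p) (fun x => p x / √(a x)) :=
  ha.hasACDeriv_integral (memLp_L2 p)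

theorem memLp_prim (p : L2) : MemLp (prim a p) 2 vol01 :=
  (ha.hardy (memLp_L2 p) (hasACDeriv_prim ha p) (prim_one a p)).1

theorem prim_congr {p q : ℝ → ℝ} (h : p =ᵐ[vol01] q) {x : ℝ} (hx : x ∈ Ioc (0 : ℝ) 1) :
    prim a p x = prim a q x := by
  unfold prim
  refine intervalIntegral.integral_congr_ae_restrict ?_
  rw [uIoc_comm]
  rcases hx.2.eq_or_lt with rfl | hx1
  · rw [uIoc_of_le le_rfl, Ioc_self, Measure.restrict_empty]
    simp [Filter.EventuallyEq]
  · filter_upwards [HasACDeriv.ae_uIoc_of_vol01 h ⟨hx.1.le, hx1⟩] with y hy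
    rw [hy]

theorem prim_add (p q : L2) {x : ℝ} (hx : x ∈ Ioc (0 : ℝ) 1) :
    prim a (p + q : L2) x = prim a p x + prim a q x := by
  rw [prim_congr ha (Lp.coeFn_add p q) hx]
  unfold prim
  rw [← intervalIntegral.integral_add ((hasACDeriv_prim ha p).intervalIntegrable hx).symm
    ((hasACDeriv_prim ha q).intervalIntegrable hx).symm]
  simp only [Pi.add_apply, add_div]

theorem prim_smul (c : ℝ) (p : L2) {x : ℝ} (hx : x ∈ Ioc (0 : ℝ) 1) :
    prim a (c • p : L2) x = c * prim a p x := by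
  rw [prim_congr ha (Lp.coeFn_smul c p) hx]
  unfold prim
  rw [← intervalIntegral.integral_const_mul]
  simp only [Pi.smul_apply, smul_eq_mul, mul_div_assoc]

end Prim

/-- The operator `p ↦ -∫ₓ¹ p / √a` of `L²(0,1)`. -/
def primOp {a : ℝ → ℝ} (ha : IsDegenerateCoefficient a) : L2 →L[ℝ] L2 :=
  LinearMap.mkContinuous
    { toFun := fun p => (memLp_prim ha p).toLp
      map_add' := fun p q => by
        rw [← MemLp.toLp_add, MemLp.toLp_eq_toLp_iff]
        refine (ae_restrict_iff' measurableSet_Ioo).2 (Eventually.of_forall fun x hx => ?_)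
        exact prim_add ha p q (Ioo_subset_Ioc_self hx)
      map_smul' := fun c p => by
        rw [RingHom.id_apply, ← MemLp.toLp_const_smul, MemLp.toLp_eq_toLp_iff]
        refine (ae_restrict_iff' measurableSet_Ioo).2 (Eventually.of_forall fun x hx => ?_)
        exact prim_smul ha c p (Ioo_subset_Ioc_self hx) } (√(4 / a 1)) (fun p => by
      have h0 : 0 ≤ 4 / a 1 := div_nonneg (by norm_num) ha.one_pos.le
      refine (sq_le_sq₀ (norm_nonneg _) (by positivity)).1 ?_
      rw [mul_pow, Real.sq_sqrt h0, norm_sq_L2_eq p]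
      exact (norm_toLp_sq (memLp_prim ha p)).trans_le
        (ha.hardy (memLp_L2 p) (hasACDeriv_prim ha p) (prim_one a p)).2)

theorem primOp_ae_eq {a : ℝ → ℝ} (ha : IsDegenerateCoefficient a) (p : L2) :
    primOp ha p =ᵐ[vol01] prim a p := (memLp_prim ha p).coeFn_toLp

/-- The primitive of `z` that vanishes at `0`. -/
def prim₀ (z : ℝ → ℝ) (x : ℝ) : ℝ := ∫ s in (0 : ℝ)..x, z s

theorem ac_prim₀ (z : L2) : AbsolutelyContinuousOnInterval (prim₀ z) 0 1 :=
  (intervalIntegrable_of_memLp (memLp_L2 z)).absolutelyContinuousOnInterval_intervalIntegral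
    (by simp)

theorem hasACDeriv_of_ac {q z : ℝ → ℝ} (h : AbsolutelyContinuousOnInterval q 0 1)
    (hz : deriv q =ᵐ[vol01] z) : HasACDeriv q z := by
  refine HasACDeriv.of_ac (fun ε hε => h.mono ?_) hz
  rw [uIcc_of_le hε.2.le, uIcc_of_le zero_le_one]
  exact Icc_subset_Icc_left hε.1.le

theorem deriv_prim₀ (z : L2) : deriv (prim₀ z) =ᵐ[vol01] z := by
  refine (ae_restrict_iff' measurableSet_Ioo).2 ?_
  filter_upwards [(intervalIntegrable_of_memLp (memLp_L2 z)).ae_hasDerivAt_integral] with x hx hx1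
  refine (hx ?_ 0 left_mem_uIcc).deriv
  rw [uIcc_of_le zero_le_one]
  exact Ioo_subset_Icc_self hx1

theorem hasACDeriv_prim₀ (z : L2) : HasACDeriv (prim₀ z) z :=
  hasACDeriv_of_ac (ac_prim₀ z) (deriv_prim₀ z)

theorem abs_prim₀_le (z : L2) {x : ℝ} (hx : x ∈ Ioo (0 : ℝ) 1) : |prim₀ z x| ≤ √x * ‖z‖ := by
  have hm : vol01 (Ioo 0 x) ≠ ⊤ := measure_ne_top _ _
  have h1 := MeasureTheory.L2.inner_indicatorConstLp_one (𝕜 := ℝ) measurableSet_Ioo hm z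
  have hsub : Ioo 0 x ∩ Ioo 0 1 = Ioo 0 x :=
    inter_eq_left.2 (Ioo_subset_Ioo_right hx.2.le)
  rw [Measure.restrict_restrict measurableSet_Ioo, hsub, ← integral_Ioc_eq_integral_Ioo,
    ← intervalIntegral.integral_of_le hx.1.le] at h1
  have h2 := abs_real_inner_le_norm (indicatorConstLp 2 measurableSet_Ioo hm (1 : ℝ)) z
  rw [h1, norm_indicatorConstLp (by norm_num) (by norm_num)] at h2
  simp only [norm_one, one_mul] at h2
  rw [measureReal_restrict_apply measurableSet_Ioo, hsub] at h2
  simp only [Real.volume_real_Ioo_of_le hx.1.le, sub_zero] at h2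
  rw [Real.sqrt_eq_rpow, prim₀]
  simpa using h2

/-! ### Integration by parts and the adjoint of the primitive operator. -/

section Adjoint

variable {a : ℝ → ℝ} (ha : IsDegenerateCoefficient a)
include ha

/-- By Cauchy–Schwarz the square is at most `‖z‖² x / a(x)`, which is integrable because `μ_a < 2`.
-/
theorem memLp_prim₀_div (z : L2) : MemLp (fun x => prim₀ z x / √(a x)) 2 vol01 := by
  have hm : AEStronglyMeasurable (fun x => prim₀ z x / √(a x)) vol01 :=
    ((hasACDeriv_prim₀ z).continuousOn.aestronglyMeasurable measurableSet_Ioo).div₀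
      ha.aestronglyMeasurable_sqrt
  rw [memLp_two_iff_integrable_sq hm]
  refine (ha.integrable_id_div.const_mul (‖z‖ ^ 2)).mono' (hm.pow 2) ?_
  refine (ae_restrict_iff' measurableSet_Ioo).2 (Eventually.of_forall fun x hx => ?_)
  have h1 := pow_le_pow_left₀ (abs_nonneg _) (abs_prim₀_le z hx) 2
  rw [mul_pow, Real.sq_sqrt hx.1.le, sq_abs] at h1
  have h2 := ha.pos x (Ioo_subset_Ioc_self hx)
  rw [Real.norm_of_nonneg (sq_nonneg _), div_pow, Real.sq_sqrt h2.le, ← mul_div_assoc]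
  gcongr
  linarith

/-- The function `x ↦ (∫₀ˣ z) / √a(x)` of `L²(0,1)`. -/
def primDiv (z : L2) : L2 := (memLp_prim₀_div ha z).toLp

/-- The bound `√x ‖z‖` for the first factor meets `√x |U(x)| → 0` for the second. -/
theorem tendsto_prim₀_mul (z : L2) {U p : ℝ → ℝ} (hp : MemLp p 2 vol01)
    (hU : HasACDeriv U fun x => p x / √(a x)) (hU1 : U 1 = 0) :
    Tendsto (fun x => prim₀ z x * U x) (𝓝[>] 0) (𝓝 0) := by
  have h1 := ((ha.boundary hp hU hU1).1.sqrt).const_mul ‖z‖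
  rw [Real.sqrt_zero, mul_zero] at h1
  refine squeeze_zero_norm' ?_ h1
  filter_upwards [Ioo_mem_nhdsGT one_pos] with x hx
  rw [norm_mul, Real.norm_eq_abs, Real.norm_eq_abs, Real.sqrt_mul hx.1.le, Real.sqrt_sq_eq_abs]
  calc |prim₀ z x| * |U x| ≤ √x * ‖z‖ * |U x| := by gcongr; exact abs_prim₀_le z hx
    _ = _ := by ring

/-- Integration by parts when the boundary term at `0` vanishes. -/
theorem integral_mul_eq_neg {q z U p : ℝ → ℝ} (hq : HasACDeriv q z)
    (hqa : MemLp (fun x => q x / √(a x)) 2 vol01) (hz : MemLp z 2 vol01) (hp : MemLp p 2 vol01)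
    (hU : HasACDeriv U fun x => p x / √(a x)) (hU1 : U 1 = 0)
    (h0 : Tendsto (fun x => q x * U x) (𝓝[>] 0) (𝓝 0)) :
    ∫ x in Ioo (0 : ℝ) 1, q x / √(a x) * p x = -∫ x in Ioo (0 : ℝ) 1, z x * U x := by
  have hU2 := (ha.hardy hp hU hU1).1
  have h1 : Integrable (fun x => z x * U x) vol01 := hz.integrable_mul hU2
  have h2 : Integrable (fun x => q x / √(a x) * p x) vol01 := hqa.integrable_mul hp
  have hF := hq.mul hU
  have heq : (fun x => z x * U x + q x * (p x / √(a x))) =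
      fun x => z x * U x + q x / √(a x) * p x := by
    ext x; ring
  rw [heq] at hF
  have h3 := tendsto_nhds_unique (hF.tendsto_zero (h1.add h2)) h0
  rw [integral_add h1 h2, hU1] at h3
  linarith

theorem inner_primOp (z p : L2) : inner ℝ z (primOp ha p) = -inner ℝ (primDiv ha z) p := by
  rw [inner_L2_eq, inner_L2_eq]
  have h1 := integral_mul_eq_neg ha (hasACDeriv_prim₀ z) (memLp_prim₀_div ha z) (memLp_L2 z)
    (memLp_L2 p) (hasACDeriv_prim ha p) (prim_one a p)
    (tendsto_prim₀_mul ha z (memLp_L2 p) (hasACDeriv_prim ha p) (prim_one a p))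
  have h2 : ∫ x in Ioo (0 : ℝ) 1, primDiv ha z x * p x =
      ∫ x in Ioo (0 : ℝ) 1, prim₀ z x / √(a x) * p x := by
    refine integral_congr_ae ?_
    filter_upwards [(memLp_prim₀_div ha z).coeFn_toLp] with x hx
    rw [primDiv, hx]
  rw [h2, h1, neg_neg]
  refine integral_congr_ae ?_
  filter_upwards [primOp_ae_eq ha p] with x hx
  rw [hx]

theorem memLp_inv_sqrt (hmu : mu a < 1) : MemLp (fun x => 1 / √(a x)) 2 vol01 := by
  have hm : AEStronglyMeasurable (fun x => 1 / √(a x)) vol01 :=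
    aestronglyMeasurable_const.div₀ ha.aestronglyMeasurable_sqrt
  rw [memLp_two_iff_integrable_sq hm]
  refine (ha.integrable_inv hmu).congr ?_
  refine (ae_restrict_iff' measurableSet_Ioo).2 (Eventually.of_forall fun x hx => ?_)
  simp only [div_pow, one_pow, Real.sq_sqrt (ha.pos x (Ioo_subset_Ioc_self hx)).le]

end Adjoint

open Classical in
/-- The function `1 / √a` in the weakly degenerate case, `0` otherwise. -/
def weight (a : ℝ → ℝ) : L2 :=
  if h : mu a < 1 ∧ MemLp (fun x => 1 / √(a x)) 2 vol01 then h.2.toLp else 0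

/-- The space of all `√a u'`, `u ∈ H¹_a(0,1)`. -/
def energySpace (a : ℝ → ℝ) : Submodule ℝ L2 := (Submodule.span ℝ {weight a})ᗮ

instance (a : ℝ → ℝ) : CompleteSpace (energySpace a) :=
  inferInstanceAs (CompleteSpace (Submodule.span ℝ {weight a})ᗮ)

section EnergySpace

variable {a : ℝ → ℝ}

theorem weight_ae_eq (ha : IsDegenerateCoefficient a) (hmu : mu a < 1) :
    weight a =ᵐ[vol01] fun x => 1 / √(a x) := by
  rw [weight, dif_pos ⟨hmu, memLp_inv_sqrt ha hmu⟩]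
  exact MemLp.coeFn_toLp _

theorem weight_eq_zero (hmu : 1 ≤ mu a) : weight a = 0 := by
  rw [weight, dif_neg fun h => absurd h.1 (not_lt.2 hmu)]

/-- If `μ_a < 1`, then `1 / √a ∈ L²` and the primitive vanishing at `1` tends to `-∫ p / √a` at `0`.
The Dirichlet condition at `0` is thus orthogonality to `1 / √a`, a closed condition. -/
theorem mem_energySpace_iff (ha : IsDegenerateCoefficient a) (p : L2) :
    p ∈ energySpace a ↔ (mu a < 1 → Tendsto (prim a p) (𝓝[>] 0) (𝓝 0)) := by
  rw [energySpace, Submodule.mem_orthogonal_singleton_iff_inner_right]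
  rcases lt_or_ge (mu a) 1 with hmu | hmu
  · have hint : Integrable (fun x => p x / √(a x)) vol01 := by
      have := (memLp_L2 p).integrable_mul (memLp_inv_sqrt ha hmu)
      refine this.congr (Eventually.of_forall fun x => ?_)
      simp [div_eq_mul_inv]
    have h1 := (hasACDeriv_prim ha p).tendsto_zero hint
    have h2 : inner ℝ (weight a) p = ∫ x in Ioo (0 : ℝ) 1, p x / √(a x) := by
      rw [inner_L2_eq]
      refine integral_congr_ae ?_
      filter_upwards [weight_ae_eq ha hmu] with x hx
      rw [hx, one_div_mul_eq_div]
    rw [prim_one, zero_sub, ← h2] at h1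
    refine ⟨fun h _ => by simpa [h] using h1, fun h => ?_⟩
    simpa using tendsto_nhds_unique h1 (h hmu)
  · simp [weight_eq_zero hmu, not_lt.2 hmu]

theorem IsRep.hasACDeriv (ha : IsDegenerateCoefficient a) {u : L2Pair} {U : ℝ → ℝ}
    (h : IsRep a u U) : HasACDeriv U fun x => u.snd x / √(a x) := by
  refine HasACDeriv.of_ac h.locallyAC ?_
  filter_upwards [h.ae_eq_deriv, ae_restrict_mem measurableSet_Ioo] with x hx hx01
  rw [hx, mul_div_cancel_left₀ _ (ha.sqrt_pos (Ioo_subset_Ioc_self hx01)).ne']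

theorem isRep_prim (ha : IsDegenerateCoefficient a) {u : L2Pair}
    (h : u.fst =ᵐ[vol01] prim a u.snd) : IsRep a u (prim a u.snd) where
  ae_eq := h
  locallyAC := (hasACDeriv_prim ha u.snd).ac
  ae_eq_deriv := by
    filter_upwards [(hasACDeriv_prim ha u.snd).deriv_ae_eq, ae_restrict_mem measurableSet_Ioo]
      with x hx hx01
    rw [hx, mul_div_cancel₀ _ (ha.sqrt_pos (Ioo_subset_Ioc_self hx01)).ne']

theorem eqOn_prim_of_hasACDeriv (ha : IsDegenerateCoefficient a) {U : ℝ → ℝ} {p : L2}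
    (hU : HasACDeriv U fun x => p x / √(a x)) (hU1 : U 1 = 0) :
    EqOn U (prim a p) (Ioc 0 1) := by
  intro x hx
  have h1 := hU.integral_eq hx
  have h2 := (hasACDeriv_prim ha p).integral_eq hx
  rw [prim_one] at h2
  linarith

theorem mem_H1aSubmodule_iff (ha : IsDegenerateCoefficient a) (u : L2Pair) :
    u ∈ H1aSubmodule a ↔ u.fst = primOp ha u.snd ∧ u.snd ∈ energySpace a := by
  have hae : u.fst = primOp ha u.snd ↔ u.fst =ᵐ[vol01] prim a u.snd := by
    rw [Lp.ext_iff]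
    exact ⟨fun h => h.trans (primOp_ae_eq ha _), fun h => h.trans (primOp_ae_eq ha _).symm⟩
  rw [hae, mem_energySpace_iff ha]
  constructor
  · rintro ⟨U, hU, hU1, hU0⟩
    have heq := eqOn_prim_of_hasACDeriv ha (hU.hasACDeriv ha) hU1
    refine ⟨?_, fun hmu => (hU0 hmu).congr' ?_⟩
    · filter_upwards [hU.ae_eq, ae_restrict_mem measurableSet_Ioo] with x hx hx01
      rw [hx, heq (Ioo_subset_Ioc_self hx01)]
    · filter_upwards [Ioc_mem_nhdsGT one_pos] with x hx using heq hx
  · rintro ⟨h1, h2⟩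
    exact ⟨_, isRep_prim ha h1, prim_one _ _, h2⟩

theorem IsRep.eqOn_prim (ha : IsDegenerateCoefficient a) {u : H1a a} {U : ℝ → ℝ}
    (h : IsRep a u U) : EqOn U (prim a (u : L2Pair).snd) (Ioc 0 1) := by
  have h1 := ((mem_H1aSubmodule_iff ha u).1 u.2).1
  refine (h.hasACDeriv ha).eqOn (hasACDeriv_prim ha _) (h.ae_eq.symm.trans ?_)
  rw [h1]
  exact primOp_ae_eq ha _

theorem isRep_prim_H1a (ha : IsDegenerateCoefficient a) (u : H1a a) :
    IsRep a u (prim a (u : L2Pair).snd) := by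
  have h1 := ((mem_H1aSubmodule_iff ha u).1 u.2).1
  refine isRep_prim ha ?_
  conv_lhs => rw [h1]
  exact primOp_ae_eq ha _

/-- The isomorphism `u ↦ √a u'` of `H¹_a(0,1)` onto a closed subspace of `L²(0,1)`. -/
def energyEquiv (ha : IsDegenerateCoefficient a) : H1a a ≃L[ℝ] energySpace a where
  toFun u := ⟨(u : L2Pair).snd, ((mem_H1aSubmodule_iff ha u).1 u.2).2⟩
  map_add' _ _ := rfl
  map_smul' _ _ := rfl
  invFun p := ⟨WithLp.toLp 2 (primOp ha p, (p : L2)), (mem_H1aSubmodule_iff ha _).2 ⟨rfl, p.2⟩⟩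
  left_inv u := by
    refine Subtype.ext ?_
    have h1 := ((mem_H1aSubmodule_iff ha u).1 u.2).1
    refine (WithLp.ofLp_injective 2) (Prod.ext ?_ rfl)
    exact h1.symm
  right_inv _ := rfl
  continuous_toFun := by
    refine Continuous.subtype_mk ?_ _
    exact (WithLp.sndL 2 ℝ L2 L2).continuous.comp continuous_subtype_val
  continuous_invFun := by
    refine Continuous.subtype_mk ?_ _
    exact (WithLp.prod_continuous_toLp 2 L2 L2).comp
      (((primOp ha).continuous.comp continuous_subtype_val).prodMk continuous_subtype_val)

/-- The embedding of the energy space into `L²(0,1)`, `√a u' ↦ u`. -/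
def energyEmb (ha : IsDegenerateCoefficient a) : energySpace a →L[ℝ] L2 :=
  (primOp ha).comp (energySpace a).subtypeL

theorem toL2_energyEquiv_symm (ha : IsDegenerateCoefficient a) (p : energySpace a) :
    toL2 a ((energyEquiv ha).symm p) = energyEmb ha p := rfl

theorem energyEmb_energyEquiv (ha : IsDegenerateCoefficient a) (u : H1a a) :
    energyEmb ha (energyEquiv ha u) = toL2 a u := by
  rw [← toL2_energyEquiv_symm, ContinuousLinearEquiv.symm_apply_apply]

end EnergySpace


/-! ### The operator `u ↦ (a u')'` -/

section HasDiv

variable {a : ℝ → ℝ}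

theorem ae_eq_div_sqrt (ha : IsDegenerateCoefficient a) {u : L2Pair} {U q : ℝ → ℝ}
    (hU : IsRep a u U) (hq : q =ᵐ[vol01] fun x => a x * deriv U x) :
    u.snd =ᵐ[vol01] fun x => q x / √(a x) := by
  filter_upwards [hU.ae_eq_deriv, hq, ae_restrict_mem measurableSet_Ioo] with x h1 h2 h3
  have h4 := ha.sqrt_pos (Ioo_subset_Ioc_self h3)
  have h5 := Real.mul_self_sqrt (ha.pos x (Ioo_subset_Ioc_self h3)).le
  rw [h1, h2, eq_div_iff h4.ne']
  linear_combination (deriv U x) * h5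

/-- This is why the condition `a u' → 0` at `0` is automatic in the strongly degenerate case: with
`a ≤ C x`, a nonzero `q(0)` would make `q² / a` at least a multiple of `1 / x` near `0`. -/
theorem eq_zero_of_memLp_div_sqrt (ha : IsDegenerateCoefficient a) (hmu : 1 ≤ mu a) {q : ℝ → ℝ}
    (hq : ContinuousWithinAt q (Ioi 0) 0) (h : MemLp (fun x => q x / √(a x)) 2 vol01) :
    q 0 = 0 := by
  by_contra hne
  obtain ⟨C, hC, hCa⟩ := ha.exists_le_mul hmu
  have h1 : 0 < q 0 ^ 2 := by positivity
  have h2 : Tendsto (fun x => q x ^ 2) (𝓝[>] 0) (𝓝 (q 0 ^ 2)) := hq.tendsto.pow 2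
  refine not_eventually_div_le ((memLp_two_iff_integrable_sq h.1).1 h)
    (show 0 < q 0 ^ 2 / 2 / C by positivity) ?_
  filter_upwards [h2.eventually (lt_mem_nhds (half_lt_self h1)), Ioc_mem_nhdsGT one_pos]
    with x hx hx01
  have h3 := ha.pos x hx01
  have h4 := hCa x hx01
  rw [div_pow, Real.sq_sqrt h3.le, div_div]
  gcongr

/-- Integration by parts against an arbitrary energy vector `k`. The boundary term at `0` vanishes
in the weak case since the primitive of `k / √a` tends to `0` and the flux `q` is bounded, and in
the strong case since `q(0) = 0` makes `q` the primitive of `z`. -/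
theorem HasDiv.eq_neg_adjoint (ha : IsDegenerateCoefficient a) {u : H1a a} {z : L2}
    (h : HasDiv a u z) : energyEquiv ha u = -(energyEmb ha).adjoint z := by
  obtain ⟨U, q, hU, hqac, hq, hz⟩ := h
  have hqz := hasACDeriv_of_ac hqac hz
  have hsnd := ae_eq_div_sqrt ha hU hq
  have hqa : MemLp (fun x => q x / √(a x)) 2 vol01 := (memLp_L2 _).ae_eq hsnd
  have hq0 : ContinuousWithinAt q (Ioi 0) 0 := by
    have h1 := hqac.continuousOn 0 left_mem_uIcc
    rw [uIcc_of_le zero_le_one] at h1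
    exact h1.mono_of_mem_nhdsWithin (Icc_mem_nhdsGT one_pos)
  refine ext_inner_right ℝ fun k => ?_
  have hlim : Tendsto (fun x => q x * prim a (k : L2) x) (𝓝[>] 0) (𝓝 0) := by
    rcases lt_or_ge (mu a) 1 with hmu | hmu
    · simpa using hq0.tendsto.mul ((mem_energySpace_iff ha k).1 k.2 hmu)
    · have h0 := eq_zero_of_memLp_div_sqrt ha hmu hq0 hqa
      refine (tendsto_prim₀_mul ha z (memLp_L2 (k : L2)) (hasACDeriv_prim ha _)
        (prim_one _ _)).congr' ?_
      filter_upwards [Ioo_mem_nhdsGT one_pos] with x hx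
      have h1 := (hqac.mono (c := 0) (d := x) (by
        rw [uIcc_of_le hx.1.le, uIcc_of_le zero_le_one]
        exact Icc_subset_Icc_right hx.2.le)).integral_deriv_eq_sub
      rw [h0, sub_zero] at h1
      rw [← h1, prim₀]
      congr 1
      refine intervalIntegral.integral_congr_ae_restrict ?_
      rw [uIoc_of_le hx.1.le, ← Measure.restrict_congr_set Ioo_ae_eq_Ioc]
      exact ae_restrict_of_ae_restrict_of_subset (Ioo_subset_Ioo_right hx.2.le) hz.symm
  rw [inner_neg_left, ContinuousLinearMap.adjoint_inner_left]
  have h1 := integral_mul_eq_neg ha hqz hqa (memLp_L2 z) (memLp_L2 (k : L2))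
    (hasACDeriv_prim ha _) (prim_one _ _) hlim
  have h2 : inner ℝ (energyEquiv ha u) k = ∫ x in Ioo (0 : ℝ) 1, q x / √(a x) * (k : L2) x := by
    rw [Submodule.coe_inner, inner_L2_eq]
    refine integral_congr_ae ?_
    filter_upwards [hsnd] with x hx
    exact congrArg (· * (k : L2) x) hx
  have h3 : inner ℝ z (energyEmb ha k) = ∫ x in Ioo (0 : ℝ) 1, z x * prim a (k : L2) x := by
    rw [inner_L2_eq]
    refine integral_congr_ae ?_
    filter_upwards [primOp_ae_eq ha (k : L2)] with x hx
    exact congrArg (z x * ·) hx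
  rw [h2, h1, h3]

/-- The hypothesis fixes `√a u'` only modulo the orthogonal complement of the energy space, that is,
up to a multiple of `1 / √a` (or of `0`). This ambiguity is the constant of integration `d` in the
flux `d + ∫₀ˣ z`. -/
theorem hasDiv_of_eq_neg_adjoint (ha : IsDegenerateCoefficient a) {u : H1a a} {z : L2}
    (h : energyEquiv ha u = -(energyEmb ha).adjoint z) : HasDiv a u z := by
  have hU := isRep_prim_H1a ha u
  set p : L2 := (u : L2Pair).snd with hp
  have hmem : p - primDiv ha z ∈ Submodule.span ℝ {weight a} := by
    rw [← Submodule.orthogonal_orthogonal (Submodule.span ℝ {weight a}),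
      Submodule.mem_orthogonal']
    intro r hr
    have h1 : inner ℝ (energyEquiv ha u) (⟨r, hr⟩ : energySpace a) =
        inner ℝ (-(energyEmb ha).adjoint z) (⟨r, hr⟩ : energySpace a) := by rw [h]
    rw [inner_neg_left, ContinuousLinearMap.adjoint_inner_left] at h1
    have h2 : inner ℝ p r = -inner ℝ z (primOp ha r) := h1
    rw [inner_sub_left, h2, inner_primOp]
    ring
  obtain ⟨c, hc⟩ := Submodule.mem_span_singleton.1 hmem
  obtain ⟨d, hd⟩ : ∃ d : ℝ, p =ᵐ[vol01] fun x => (d + prim₀ z x) / √(a x) := by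
    have hpc : p = primDiv ha z + c • weight a := by rw [hc]; abel
    rcases lt_or_ge (mu a) 1 with hmu | hmu
    · refine ⟨c, ?_⟩
      rw [hpc]
      filter_upwards [Lp.coeFn_add (primDiv ha z) (c • weight a), Lp.coeFn_smul c (weight a),
        weight_ae_eq ha hmu, (memLp_prim₀_div ha z).coeFn_toLp] with x h1 h2 h3 h4
      rw [h1, Pi.add_apply, h2, Pi.smul_apply, h3, primDiv, h4, smul_eq_mul]
      ring
    · refine ⟨0, ?_⟩
      rw [hpc, weight_eq_zero hmu, smul_zero, add_zero]
      simp only [zero_add]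
      exact (memLp_prim₀_div ha z).coeFn_toLp
  refine ⟨_, fun x => d + prim₀ z x, hU,
    (contDiffOn_const.absolutelyContinuousOnInterval (f := fun _ => d)).fun_add (ac_prim₀ z), ?_,
    ((hasACDeriv_prim₀ z).const_add d).deriv_ae_eq⟩
  filter_upwards [hd, (hasACDeriv_prim ha p).deriv_ae_eq, ae_restrict_mem measurableSet_Ioo]
    with x h1 h2 h3
  have h4 := ha.pos x (Ioo_subset_Ioc_self h3)
  have h5 := (ha.sqrt_pos (Ioo_subset_Ioc_self h3)).ne'
  rw [h2, h1, div_div, Real.mul_self_sqrt h4.le, mul_div_cancel₀ _ h4.ne']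

theorem hasDiv_iff (ha : IsDegenerateCoefficient a) {u : H1a a} {z : L2} :
    HasDiv a u z ↔ energyEquiv ha u = -(energyEmb ha).adjoint z :=
  ⟨fun h => h.eq_neg_adjoint ha, hasDiv_of_eq_neg_adjoint ha⟩

theorem energyEmb_injective (ha : IsDegenerateCoefficient a) :
    Function.Injective (energyEmb ha) := by
  rw [injective_iff_map_eq_zero]
  intro k hk
  have h1 : prim a (k : L2) =ᵐ[vol01] fun _ => (0 : ℝ) := by
    refine (primOp_ae_eq ha (k : L2)).symm.trans ?_
    have h2 : primOp ha (k : L2) = 0 := hk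
    rw [h2]
    exact Lp.coeFn_zero _ _ _
  have h3 : EqOn (prim a (k : L2)) (fun _ => 0) (Ioo 0 1) :=
    MeasureTheory.Measure.eqOn_open_of_ae_eq h1 isOpen_Ioo (hasACDeriv_prim ha _).continuousOn
      continuousOn_const
  refine Subtype.ext (Lp.ext ?_)
  refine EventuallyEq.trans ?_ (Lp.coeFn_zero ℝ 2 vol01).symm
  filter_upwards [(hasACDeriv_prim ha (k : L2)).hasDerivAt, ae_restrict_mem measurableSet_Ioo]
    with x hx hx01
  have h4 : HasDerivAt (prim a (k : L2)) 0 x := (hasDerivAt_const x (0 : ℝ)).congr_of_eventuallyEq (by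
    filter_upwards [isOpen_Ioo.mem_nhds hx01] with y hy using h3 hy)
  have h5 := hx.unique h4
  simpa [(ha.sqrt_pos (Ioo_subset_Ioc_self hx01)).ne'] using h5

/-- If `B* z = 0`, then `z` is the derivative of the flux of `u = 0`, which vanishes identically on
the open interval. -/
theorem adjoint_energyEmb_injective (ha : IsDegenerateCoefficient a) :
    Function.Injective (energyEmb ha).adjoint := by
  rw [injective_iff_map_eq_zero]
  intro z hz
  obtain ⟨U, q, hU, hqac, hq, hqz⟩ : HasDiv a 0 z := by rw [hasDiv_iff ha, hz]; simp
  have h1 := ae_eq_div_sqrt ha hU hq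
  have h2 := hasACDeriv_of_ac hqac hqz
  have h3 : q =ᵐ[vol01] fun _ => (0 : ℝ) := by
    filter_upwards [h1, Lp.coeFn_zero ℝ 2 vol01, ae_restrict_mem measurableSet_Ioo]
      with x hx hx0 hx01
    have h4 : (0 : L2) x = q x / √(a x) := hx
    rw [hx0, Pi.zero_apply, eq_comm, div_eq_zero_iff] at h4
    exact h4.resolve_right (ha.sqrt_pos (Ioo_subset_Ioc_self hx01)).ne'
  have h4 : EqOn q (fun _ => 0) (Ioo 0 1) :=
    MeasureTheory.Measure.eqOn_open_of_ae_eq h3 isOpen_Ioo h2.continuousOn continuousOn_const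
  refine Lp.ext (EventuallyEq.trans ?_ (Lp.coeFn_zero ℝ 2 vol01).symm)
  filter_upwards [h2.hasDerivAt, ae_restrict_mem measurableSet_Ioo] with x hx hx01
  refine hx.unique ((hasDerivAt_const x (0 : ℝ)).congr_of_eventuallyEq ?_)
  filter_upwards [isOpen_Ioo.mem_nhds hx01] with y hy using h4 hy

end HasDiv


/-! ### Normal derivative and multipliers -/

section Multiplier

variable {a : ℝ → ℝ}

/-- The operator `√a u' ↦ x u'`. -/
def dilOp (ha : IsDegenerateCoefficient a) : L2 →L[ℝ] L2 :=
  LinearMap.mkContinuous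
    { toFun := fun p => (ha.memLp_mul_div_sqrt (memLp_L2 p)).1.toLp
      map_add' := fun p q => by
        rw [← MemLp.toLp_add, MemLp.toLp_eq_toLp_iff]
        filter_upwards [Lp.coeFn_add p q] with x hx
        rw [hx, Pi.add_apply, Pi.add_apply]
        ring
      map_smul' := fun c p => by
        rw [RingHom.id_apply, ← MemLp.toLp_const_smul, MemLp.toLp_eq_toLp_iff]
        filter_upwards [Lp.coeFn_smul c p] with x hx
        rw [hx, Pi.smul_apply, Pi.smul_apply, smul_eq_mul, smul_eq_mul]
        ring } (√((a 1)⁻¹)) (fun p => by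
      have h0 : 0 ≤ (a 1)⁻¹ := inv_nonneg.2 ha.one_pos.le
      refine (sq_le_sq₀ (norm_nonneg _) (by positivity)).1 ?_
      rw [mul_pow, Real.sq_sqrt h0, norm_sq_L2_eq p]
      exact (norm_toLp_sq (ha.memLp_mul_div_sqrt (memLp_L2 p)).1).trans_le
        (ha.memLp_mul_div_sqrt (memLp_L2 p)).2)

theorem dilOp_ae_eq (ha : IsDegenerateCoefficient a) (p : L2) :
    dilOp ha p =ᵐ[vol01] fun x => x * (p x / √(a x)) :=
  (ha.memLp_mul_div_sqrt (memLp_L2 p)).1.coeFn_toLp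

theorem norm_dilOp_sq_le (ha : IsDegenerateCoefficient a) (p : L2) :
    ‖dilOp ha p‖ ^ 2 ≤ (a 1)⁻¹ * ‖p‖ ^ 2 := by
  rw [norm_sq_L2_eq p]
  exact (norm_toLp_sq (ha.memLp_mul_div_sqrt (memLp_L2 p)).1).trans_le
    (ha.memLp_mul_div_sqrt (memLp_L2 p)).2

theorem toL2_ae_eq (ha : IsDegenerateCoefficient a) (u : H1a a) :
    toL2 a u =ᵐ[vol01] prim a (u : L2Pair).snd := (isRep_prim_H1a ha u).ae_eq

theorem inner_dilOp_toL2 (ha : IsDegenerateCoefficient a) (u : H1a a) :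
    inner ℝ (dilOp ha (u : L2Pair).snd) (toL2 a u) = -(1 / 2) * ‖toL2 a u‖ ^ 2 := by
  have h1 := (ha.boundary (memLp_L2 (u : L2Pair).snd) (hasACDeriv_prim ha _) (prim_one a _)).2
  rw [norm_sq_L2_eq, real_inner_comm, inner_L2_eq]
  convert h1 using 1
  · refine integral_congr_ae ?_
    filter_upwards [toL2_ae_eq ha u, dilOp_ae_eq ha (u : L2Pair).snd] with x h1 h2
    rw [h1, h2]
  · congr 1
    refine integral_congr_ae ?_
    filter_upwards [toL2_ae_eq ha u] with x h1
    rw [h1]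

theorem HasDiv.inner_eq (ha : IsDegenerateCoefficient a) {u : H1a a} {z : L2} (h : HasDiv a u z)
    (v : H1a a) : inner ℝ (u : L2Pair).snd (v : L2Pair).snd = -inner ℝ z (toL2 a v) := by
  have h1 := h.eq_neg_adjoint ha
  have h2 : inner ℝ (energyEquiv ha u) (energyEquiv ha v) = -inner ℝ z (toL2 a v) := by
    rw [h1, inner_neg_left, ContinuousLinearMap.adjoint_inner_left, energyEmb_energyEquiv]
  exact h2

theorem memLp_sqrt (ha : IsDegenerateCoefficient a) : MemLp (fun x => √(a x)) 2 vol01 := by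
  obtain ⟨C, hC⟩ := isCompact_Icc.exists_bound_of_continuousOn ha.continuousOn.sqrt
  refine MemLp.of_bound ha.aestronglyMeasurable_sqrt C ?_
  exact (ae_restrict_iff' measurableSet_Ioo).2
    (Eventually.of_forall fun x hx => hC x (Ioo_subset_Icc_self hx))

theorem memLp_id : MemLp (fun x : ℝ => x) 2 vol01 := by
  refine MemLp.of_bound aestronglyMeasurable_id 1 ?_
  refine (ae_restrict_iff' measurableSet_Ioo).2 (Eventually.of_forall fun x hx => ?_)
  rw [Real.norm_of_nonneg hx.1.le]
  exact hx.2.le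

/-- The normal derivative at `1` of a function `u` with `√a u' = p` and `(a u')' = z`. -/
def normalDeriv (ha : IsDegenerateCoefficient a) (p z : L2) : ℝ :=
  (a 1)⁻¹ * (inner ℝ (memLp_sqrt ha).toLp p + inner ℝ memLp_id.toLp z)

/-- For the flux `q = a u'`, `q(1) = ∫₀¹ (x q)' = ∫₀¹ (√a p + x z)`. The normal derivative is
therefore a bounded functional of `(p, z)`, which gives its continuity in time along classical
solutions. -/
theorem HasDiv.exists_flux (ha : IsDegenerateCoefficient a) {u : H1a a} {z : L2}
    (h : HasDiv a u z) : ∃ q : ℝ → ℝ, AbsolutelyContinuousOnInterval q 0 1 ∧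
      deriv q =ᵐ[vol01] z ∧ ((u : L2Pair).snd : ℝ → ℝ) =ᵐ[vol01] (fun x => q x / √(a x)) ∧
      normalDeriv ha (u : L2Pair).snd z = q 1 / a 1 := by
  obtain ⟨U, q, hU, hqac, hq, hz⟩ := h
  have hsnd := ae_eq_div_sqrt ha hU hq
  refine ⟨q, hqac, hz, hsnd, ?_⟩
  have h1 := AbsolutelyContinuousOnInterval.integral_deriv_mul_eq_sub
    (contDiffOn_id.absolutelyContinuousOnInterval (f := fun x : ℝ => x) (a := 0) (b := 1)) hqac
  rw [intervalIntegral.integral_of_le zero_le_one, integral_Ioc_eq_integral_Ioo] at h1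
  have i1 : Integrable (fun x => √(a x) * (u : L2Pair).snd x) vol01 :=
    (memLp_sqrt ha).integrable_mul (memLp_L2 _)
  have i2 : Integrable (fun x => x * z x) vol01 := memLp_id.integrable_mul (memLp_L2 z)
  have h2 : ∫ x in Ioo (0 : ℝ) 1, (deriv (fun x : ℝ => x) x * q x + x * deriv q x) =
      ∫ x in Ioo (0 : ℝ) 1, (√(a x) * (u : L2Pair).snd x + x * z x) := by
    refine integral_congr_ae ?_
    filter_upwards [hsnd, hz, ae_restrict_mem measurableSet_Ioo] with x h1 h2 h3
    rw [h1, h2, mul_div_cancel₀ _ (ha.sqrt_pos (Ioo_subset_Ioc_self h3)).ne']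
    simp
  rw [h2, integral_add i1 i2] at h1
  have h3 : inner ℝ (memLp_sqrt ha).toLp (u : L2Pair).snd =
      ∫ x in Ioo (0 : ℝ) 1, √(a x) * (u : L2Pair).snd x := by
    rw [inner_L2_eq]
    refine integral_congr_ae ?_
    filter_upwards [(memLp_sqrt ha).coeFn_toLp] with x hx
    rw [hx]
  have h4 : inner ℝ memLp_id.toLp z = ∫ x in Ioo (0 : ℝ) 1, x * z x := by
    rw [inner_L2_eq]
    refine integral_congr_ae ?_
    filter_upwards [memLp_id.coeFn_toLp] with x hx
    rw [hx]
  rw [normalDeriv, h3, h4, h1]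
  ring

theorem HasDiv.hasNormalDeriv (ha : IsDegenerateCoefficient a) {u : H1a a} {z : L2}
    (h : HasDiv a u z) : HasNormalDeriv a u (normalDeriv ha (u : L2Pair).snd z) := by
  obtain ⟨q, hq, hz, hp, hd⟩ := h.exists_flux ha
  rw [hd]
  refine ⟨_, isRep_prim_H1a ha u, ?_⟩
  have hc : ContinuousOn (fun x => q x / a x) (Ioc 0 1) := by
    have h1 := hq.continuousOn
    rw [uIcc_of_le zero_le_one] at h1
    exact (h1.mono Ioc_subset_Icc_self).div (ha.continuousOn.mono Ioc_subset_Icc_self)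
      fun x hx => (ha.pos x hx).ne'
  have hmem : Ioc (0 : ℝ) 1 ∈ 𝓝[≤] 1 := Ioc_mem_nhdsLE one_pos
  have h2 : HasDerivWithinAt (fun x => ∫ s in (1 : ℝ)..x, q s / a s) (q 1 / a 1) (Iic 1) 1 := by
    refine intervalIntegral.integral_hasDerivWithinAt_right (by simp)
      ⟨Ioc 0 1, hmem, hc.aestronglyMeasurable measurableSet_Ioc⟩ ?_
    exact (hc 1 (by simp)).mono_of_mem_nhdsWithin hmem
  refine h2.congr_of_eventuallyEq ?_ (by simp [prim])
  filter_upwards [hmem] with x hx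
  refine (prim_congr ha hp hx).trans ?_
  unfold prim
  refine intervalIntegral.integral_congr fun y hy => ?_
  rw [uIcc_comm] at hy
  simp only
  rw [div_div, Real.mul_self_sqrt (ha.pos y (uIcc_subset_Ioc hx hy)).le]

theorem HasNormalDeriv.unique (ha : IsDegenerateCoefficient a) {u : H1a a} {d e : ℝ}
    (hd : HasNormalDeriv a u d) (he : HasNormalDeriv a u e) : d = e := by
  obtain ⟨U, hU, hUd⟩ := hd
  obtain ⟨V, hV, hVe⟩ := he
  have heq : EqOn U V (Ioc 0 1) := (hU.eqOn_prim ha).trans (hV.eqOn_prim ha).symm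
  have h1 : HasDerivWithinAt U e (Iic 1) 1 := by
    refine hVe.congr_of_eventuallyEq ?_ (heq (by simp))
    filter_upwards [Ioc_mem_nhdsLE one_pos] with x hx using heq hx
  exact (uniqueDiffWithinAt_Iic 1).eq_deriv _ hUd h1

theorem abs_div_le_mu (ha : IsDegenerateCoefficient a) {x : ℝ} (hx : x ∈ Ioc (0 : ℝ) 1) :
    |x * derivWithin a (Ioc 0 1) x / a x| ≤ mu a := by
  have h1 := ha.pos x hx
  rw [abs_div, abs_mul, abs_of_pos hx.1, abs_of_pos h1, div_le_iff₀ h1]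
  exact ha.abs_deriv_le hx

/-- With `q = a u'` and `p = √a u'`, `((x / a) q²)' = (1 - x a' / a) p² + 2 x u' z`. The number `m`
is the integral of the first term, and `|x a' / a| ≤ μ_a`. There is no contribution from `0`,
because `q² / a = p²` is integrable. -/
theorem HasDiv.inner_dilOp (ha : IsDegenerateCoefficient a) {u : H1a a} {z : L2}
    (h : HasDiv a u z) : ∃ m : ℝ, (1 - mu a) * ‖(u : L2Pair).snd‖ ^ 2 ≤ m ∧
      m ≤ (1 + mu a) * ‖(u : L2Pair).snd‖ ^ 2 ∧
      2 * inner ℝ (dilOp ha (u : L2Pair).snd) z =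
        a 1 * normalDeriv ha (u : L2Pair).snd z ^ 2 - m := by
  obtain ⟨q, hq, hz, hp, hd⟩ := h.exists_flux ha
  set p : L2 := (u : L2Pair).snd
  have hqz := hasACDeriv_of_ac hq hz
  set b : ℝ → ℝ := derivWithin a (Ioc 0 1)
  have hb : ContinuousOn b (Ioc 0 1) :=
    ha.contDiffOn.continuousOn_derivWithin (uniqueDiffOn_Ioc 0 1) le_rfl
  have hp2 : Integrable (fun x => p x ^ 2) vol01 :=
    (memLp_two_iff_integrable_sq (memLp_L2 p).1).1 (memLp_L2 p)
  have hmeas : AEStronglyMeasurable (fun x => 1 - x * b x / a x) vol01 :=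
    aestronglyMeasurable_const.sub ((aestronglyMeasurable_id.mul
      ((hb.mono Ioo_subset_Ioc_self).aestronglyMeasurable measurableSet_Ioo)).div₀
        ha.aestronglyMeasurable)
  have hbd : ∀ x ∈ Ioo (0 : ℝ) 1, 1 - mu a ≤ 1 - x * b x / a x ∧ 1 - x * b x / a x ≤ 1 + mu a := by
    intro x hx
    have h1 := abs_le.1 (abs_div_le_mu ha (Ioo_subset_Ioc_self hx))
    constructor <;> linarith [h1.1, h1.2]
  have hm : Integrable (fun x => (1 - x * b x / a x) * p x ^ 2) vol01 := by
    refine hp2.bdd_mul (c := 1 + mu a) hmeas ?_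
    refine (ae_restrict_iff' measurableSet_Ioo).2 (Eventually.of_forall fun x hx => ?_)
    have h1 := hbd x hx
    rw [Real.norm_eq_abs, abs_le]
    constructor <;> linarith [h1.1, h1.2, ha.mu_nonneg]
  have hD : Integrable (fun x => x * (p x / √(a x)) * z x) vol01 :=
    (ha.memLp_mul_div_sqrt (memLp_L2 p)).1.integrable_mul (memLp_L2 z)
  have hxa : HasACDeriv (fun x => x / a x)
      (derivWithin (fun x => x / a x) (Ioc 0 1)) :=
    HasACDeriv.of_contDiffOn (contDiffOn_id.div ha.contDiffOn fun x hx => (ha.pos x hx).ne')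
  have hF : HasACDeriv (fun x => x / a x * (q x * q x))
      (fun x => (1 - x * b x / a x) * p x ^ 2 + 2 * (x * (p x / √(a x)) * z x)) := by
    refine (hxa.mul (hqz.mul hqz)).congr ?_
    filter_upwards [hp, ae_restrict_mem measurableSet_Ioo] with x h1 h2
    have h3 := ha.pos x (Ioo_subset_Ioc_self h2)
    have h4 : derivWithin (fun x => x / a x) (Ioc 0 1) x = (1 * a x - x * b x) / a x ^ 2 := by
      rw [derivWithin_of_mem_nhds (Ioc_mem_nhds h2.1 h2.2)]
      exact ((hasDerivAt_id x).div (ha.hasDerivAt h2) h3.ne').deriv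
    have h5 : (q x / √(a x)) ^ 2 = q x ^ 2 / a x := by rw [div_pow, Real.sq_sqrt h3.le]
    have h6 : q x / √(a x) / √(a x) = q x / a x := by rw [div_div, Real.mul_self_sqrt h3.le]
    rw [h4, h1, h5, h6]
    field_simp
    ring
  have hg : Integrable (fun x => q x ^ 2 / a x) vol01 := by
    refine hp2.congr ?_
    filter_upwards [hp, ae_restrict_mem measurableSet_Ioo] with x h1 h2
    rw [h1, div_pow, Real.sq_sqrt (ha.pos x (Ioo_subset_Ioc_self h2)).le]
  have h7 := (hF.tendsto_zero_of_eq_mul (hm.add (hD.const_mul 2)) hg fun x hx => by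
    have h3 := ha.pos x (Ioo_subset_Ioc_self hx)
    refine ⟨mul_nonneg (div_nonneg hx.1.le h3.le) (mul_self_nonneg _), by ring⟩).2
  rw [integral_add hm (hD.const_mul 2), integral_const_mul] at h7
  refine ⟨∫ x in Ioo (0 : ℝ) 1, (1 - x * b x / a x) * p x ^ 2, ?_, ?_, ?_⟩
  · rw [norm_sq_L2_eq, ← integral_const_mul]
    exact setIntegral_mono_on (hp2.const_mul _) hm measurableSet_Ioo fun x hx =>
      mul_le_mul_of_nonneg_right (hbd x hx).1 (sq_nonneg _)
  · rw [norm_sq_L2_eq, ← integral_const_mul]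
    exact setIntegral_mono_on hm (hp2.const_mul _) measurableSet_Ioo fun x hx =>
      mul_le_mul_of_nonneg_right (hbd x hx).2 (sq_nonneg _)
  · have h8 : inner ℝ (dilOp ha p) z = ∫ x in Ioo (0 : ℝ) 1, x * (p x / √(a x)) * z x := by
      rw [inner_L2_eq]
      refine integral_congr_ae ?_
      filter_upwards [dilOp_ae_eq ha p] with x hx
      rw [hx]
    have h9 := ha.one_pos
    have h10 : a 1 * (q 1 / a 1) ^ 2 = 1 / a 1 * (q 1 * q 1) := by field_simp
    rw [h8, hd, h10, ← h7]
    ring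

/-- The multiplier `∫ (2 x w_x + (μ_a / 2) w) w_t dx`. -/
def multiplier (ha : IsDegenerateCoefficient a) (w : H1a a) (v : L2) : ℝ :=
  2 * inner ℝ (dilOp ha (w : L2Pair).snd) v + mu a / 2 * inner ℝ (toL2 a w) v

/-- Since `⟨x w', w⟩ = -‖w‖² / 2`, expanding gives `‖2 x w' + (μ_a / 2) w‖² = 4 ‖x w'‖² - (μ_a (4 -
μ_a) / 4) ‖w‖²`. The lower-order term only helps, so no Poincaré constant enters. -/
theorem abs_multiplier_le (ha : IsDegenerateCoefficient a) (w : H1a a) (v : L2) :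
    |multiplier ha w v| ≤ (√(a 1))⁻¹ * (‖(w : L2Pair).snd‖ ^ 2 + ‖v‖ ^ 2) := by
  set p : L2 := (w : L2Pair).snd with hp
  set y : L2 := (2 : ℝ) • dilOp ha p + (mu a / 2) • toL2 a w with hy
  have h1 : multiplier ha w v = inner ℝ y v := by
    rw [hy, inner_add_left, real_inner_smul_left, real_inner_smul_left, multiplier]
  have h2 : ‖y‖ ^ 2 ≤ (2 * ((√(a 1))⁻¹ * ‖p‖)) ^ 2 := by
    have h3 := norm_dilOp_sq_le ha p
    have h4 := inner_dilOp_toL2 ha w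
    have h5 := ha.mu_nonneg
    have h6 := ha.mu_lt_two
    rw [hy, norm_add_sq_real, norm_smul, norm_smul, real_inner_smul_left, real_inner_smul_right,
      ← hp] at *
    rw [h4, mul_pow, mul_pow, mul_pow, mul_pow, inv_pow, Real.sq_sqrt ha.one_pos.le,
      Real.norm_of_nonneg (by norm_num), Real.norm_of_nonneg (by positivity)]
    nlinarith [mul_nonneg (mul_nonneg h5 (by linarith : 0 ≤ 4 - mu a)) (sq_nonneg ‖toL2 a w‖)]
  have h0 : 0 ≤ (√(a 1))⁻¹ := by positivity
  have h3 := (sq_le_sq₀ (norm_nonneg y) (by positivity)).1 h2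
  rw [h1]
  calc |inner ℝ y v| ≤ ‖y‖ * ‖v‖ := abs_real_inner_le_norm _ _
    _ ≤ 2 * ((√(a 1))⁻¹ * ‖p‖) * ‖v‖ := by gcongr
    _ = (√(a 1))⁻¹ * (2 * ‖p‖ * ‖v‖) := by ring
    _ ≤ _ := by gcongr; exact two_mul_le_add_sq ‖p‖ ‖v‖

/-- The time derivative of the multiplier along classical solutions. -/
def multiplierDeriv (ha : IsDegenerateCoefficient a) (w v : H1a a) (z : L2) : ℝ :=
  2 * (inner ℝ (dilOp ha (w : L2Pair).snd) z + inner ℝ (dilOp ha (v : L2Pair).snd) (toL2 a v)) +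
    mu a / 2 * (inner ℝ (toL2 a w) z + inner ℝ (toL2 a v) (toL2 a v))

/-- The weight `μ_a / 2` on `w` moves energy between the two parts: as `⟨w, z⟩ = -‖√a w'‖²`, it
lowers the coefficient of the kinetic part from `1` to `1 - μ_a / 2` and raises that of the
potential part from at least `1 - μ_a` to at least `1 - μ_a / 2`. -/
theorem multiplier_bounds (ha : IsDegenerateCoefficient a) {w : H1a a} {z : L2}
    (h : HasDiv a w z) (v : H1a a) :
    multiplierDeriv ha w v z + (1 - mu a / 2) * (‖(w : L2Pair).snd‖ ^ 2 + ‖toL2 a v‖ ^ 2) ≤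
        a 1 * normalDeriv ha (w : L2Pair).snd z ^ 2 ∧
      a 1 * normalDeriv ha (w : L2Pair).snd z ^ 2 ≤
        multiplierDeriv ha w v z + 4 * (‖(w : L2Pair).snd‖ ^ 2 + ‖toL2 a v‖ ^ 2) := by
  obtain ⟨m, hm1, hm2, hm⟩ := h.inner_dilOp ha
  have h1 := inner_dilOp_toL2 ha v
  have h2 := h.inner_eq ha w
  rw [real_inner_self_eq_norm_sq, real_inner_comm] at h2
  have h3 := ha.mu_nonneg
  have h4 := ha.mu_lt_two
  have h5 : multiplierDeriv ha w v z = a 1 * normalDeriv ha (w : L2Pair).snd z ^ 2 - m -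
      (1 - mu a / 2) * ‖toL2 a v‖ ^ 2 - mu a / 2 * ‖(w : L2Pair).snd‖ ^ 2 := by
    rw [multiplierDeriv, real_inner_self_eq_norm_sq, h1]
    linear_combination hm + mu a / 2 * h2
  rw [h5]
  have h6 := sq_nonneg ‖toL2 a v‖
  have h7 := sq_nonneg ‖(w : L2Pair).snd‖
  constructor <;> nlinarith

end Multiplier


/-! ### Energy identities -/

theorem eq_of_hasDerivWithinAt_zero {f : ℝ → ℝ} {T : ℝ}
    (h : ∀ t ∈ Icc 0 T, HasDerivWithinAt f 0 (Icc 0 T) t) {s t : ℝ} (hs : s ∈ Icc 0 T)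
    (ht : t ∈ Icc 0 T) : f s = f t := by
  have := Convex.norm_image_sub_le_of_norm_hasDerivWithin_le (C := 0) h (by simp)
    (convex_Icc 0 T) ht hs
  rw [zero_mul] at this
  exact sub_eq_zero.1 (norm_le_zero_iff.1 this)

section Energy

variable {a : ℝ → ℝ}

/-- The map `u ↦ √a u'` from `H¹_a(0,1)` to `L²(0,1)`. -/
def sndL2 (a : ℝ → ℝ) : H1a a →L[ℝ] L2 :=
  (WithLp.sndL 2 ℝ L2 L2).comp (H1aSubmodule a).subtypeL

theorem norm_energyEquiv (ha : IsDegenerateCoefficient a) (u : H1a a) :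
    ‖energyEquiv ha u‖ = ‖sndL2 a u‖ := rfl

theorem eq_zero_of_sndL2 (ha : IsDegenerateCoefficient a) {u : H1a a} (h : ‖sndL2 a u‖ = 0) :
    u = 0 := by
  rw [← norm_energyEquiv ha, norm_eq_zero] at h
  exact (energyEquiv ha).map_eq_zero_iff.1 h

theorem HasDiv.sub (ha : IsDegenerateCoefficient a) {u v : H1a a} {y z : L2} (hu : HasDiv a u y)
    (hv : HasDiv a v z) : HasDiv a (u - v) (y - z) := by
  rw [hasDiv_iff ha] at *
  rw [map_sub, map_sub, hu, hv]
  abel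

/-- The energy form of two curves related by the wave equation is conserved. -/
theorem energy_eq (ha : IsDegenerateCoefficient a) {T : ℝ} {w w' : ℝ → H1a a} {v z : ℝ → L2}
    (hw : ∀ t ∈ Icc 0 T, HasDerivWithinAt w (w' t) (Icc 0 T) t)
    (hv : ∀ t ∈ Icc 0 T, HasDerivWithinAt v (z t) (Icc 0 T) t)
    (hvw : ∀ t ∈ Icc 0 T, v t = toL2 a (w' t))
    (hz : ∀ t ∈ Icc 0 T, HasDiv a (w t) (z t)) {s t : ℝ} (hs : s ∈ Icc 0 T) (ht : t ∈ Icc 0 T) :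
    ‖sndL2 a (w s)‖ ^ 2 + ‖v s‖ ^ 2 = ‖sndL2 a (w t)‖ ^ 2 + ‖v t‖ ^ 2 := by
  refine eq_of_hasDerivWithinAt_zero (f := fun t => ‖sndL2 a (w t)‖ ^ 2 + ‖v t‖ ^ 2)
    (fun r hr => ?_) hs ht
  have h1 := ((sndL2 a).hasFDerivAt.comp_hasDerivWithinAt r (hw r hr)).norm_sq
  refine (h1.add (hv r hr).norm_sq).congr_deriv ?_
  have h2 : inner ℝ (sndL2 a (w r)) (sndL2 a (w' r)) = -inner ℝ (z r) (toL2 a (w' r)) :=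
    (hz r hr).inner_eq ha (w' r)
  simp only [Function.comp_apply]
  rw [h2, ← hvw r hr, real_inner_comm (z r)]
  ring

theorem IsClassicalSolution.energy (ha : IsDegenerateCoefficient a) {T : ℝ} {w w' : ℝ → H1a a}
    {w'' : ℝ → L2} (h : IsClassicalSolution a T w w' w'') {s t : ℝ} (hs : s ∈ Icc 0 T)
    (ht : t ∈ Icc 0 T) :
    ‖sndL2 a (w s)‖ ^ 2 + ‖toL2 a (w' s)‖ ^ 2 = ‖sndL2 a (w t)‖ ^ 2 + ‖toL2 a (w' t)‖ ^ 2 :=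
  energy_eq ha h.hasDeriv h.hasDeriv₂ (fun _ _ => rfl) h.equation hs ht

theorem IsClassicalSolution.sub (ha : IsDegenerateCoefficient a) {T : ℝ} {w w' v v' : ℝ → H1a a}
    {w'' v'' : ℝ → L2} (hw : IsClassicalSolution a T w w' w'')
    (hv : IsClassicalSolution a T v v' v'') :
    IsClassicalSolution a T (fun t => w t - v t) (fun t => w' t - v' t)
      (fun t => w'' t - v'' t) where
  hasDeriv t ht := (hw.hasDeriv t ht).sub (hv.hasDeriv t ht)
  continuousOn_deriv := hw.continuousOn_deriv.sub hv.continuousOn_deriv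
  hasDeriv₂ t ht := by
    simp only [map_sub]
    exact (hw.hasDeriv₂ t ht).sub (hv.hasDeriv₂ t ht)
  continuousOn_deriv₂ := hw.continuousOn_deriv₂.sub hv.continuousOn_deriv₂
  equation t ht := (hw.equation t ht).sub ha (hv.equation t ht)

/-- A mild solution need not be regular enough for the energy identity, but its time primitive is.
-/
theorem IsMildSolution.eq (ha : IsDegenerateCoefficient a) {T : ℝ} (hT : 0 ≤ T)
    {w v : ℝ → H1a a} {w' v' : ℝ → L2} (hw : IsMildSolution a T w w')
    (hv : IsMildSolution a T v v') (h0 : w T = v T) (h1 : w' T = v' T) {t : ℝ}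
    (ht : t ∈ Icc 0 T) : w t = v t ∧ w' t = v' t := by
  obtain ⟨Z, -, hZ⟩ := hw.equation
  obtain ⟨Y, -, hY⟩ := hv.equation
  have hTm : T ∈ Icc 0 T := ⟨hT, le_rfl⟩
  -- The primitive of the difference, normalised to vanish at `T`: its energy is zero there, hence
  -- at all times.
  let X : ℝ → H1a a := fun t => (Z t - Y t) - (Z T - Y T)
  have hX : ∀ r ∈ Icc 0 T, HasDerivWithinAt X (w r - v r) (Icc 0 T) r := fun r hr =>
    ((hZ r hr).1.sub (hY r hr).1).sub_const _
  have hXd : ∀ r ∈ Icc 0 T, HasDiv a (X r) (w' r - v' r) := fun r hr => by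
    have h2 := (((hZ r hr).2.sub ha (hY r hr).2)).sub ha ((hZ T hTm).2.sub ha (hY T hTm).2)
    convert h2 using 1
    rw [h1]
    abel
  have hder : ∀ r ∈ Icc 0 T, HasDerivWithinAt (fun s => toL2 a (w s) - toL2 a (v s))
      (w' r - v' r) (Icc 0 T) r := fun r hr => (hw.hasDeriv r hr).sub (hv.hasDeriv r hr)
  have hen : ∀ r ∈ Icc 0 T, X r = 0 ∧ toL2 a (w r) - toL2 a (v r) = 0 := by
    intro r hr
    have h2 := energy_eq ha hX hder (fun s _ => by simp) hXd hr hTm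
    have h3 : X T = 0 := sub_self _
    rw [h3, h0, sub_self, map_zero, norm_zero] at h2
    have h4 := sq_nonneg ‖sndL2 a (X r)‖
    have h5 := sq_nonneg ‖toL2 a (w r) - toL2 a (v r)‖
    have h6 : ‖sndL2 a (X r)‖ ^ 2 = 0 := by linarith
    have h7 : ‖toL2 a (w r) - toL2 a (v r)‖ ^ 2 = 0 := by linarith
    exact ⟨eq_zero_of_sndL2 ha (pow_eq_zero_iff two_ne_zero |>.1 h6),
      norm_eq_zero.1 (pow_eq_zero_iff two_ne_zero |>.1 h7)⟩
  constructor
  · have h2 := (hen t ht).2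
    rw [← map_sub, ← energyEmb_energyEquiv ha] at h2
    have h3 := energyEmb_injective ha (h2.trans (map_zero _).symm)
    exact sub_eq_zero.1 ((energyEquiv ha).map_eq_zero_iff.1 h3)
  · have h2 := (hasDiv_iff ha).1 (hXd t ht)
    rw [(hen t ht).1, map_zero, eq_comm, neg_eq_zero] at h2
    exact sub_eq_zero.1 (adjoint_energyEmb_injective ha (h2.trans (map_zero _).symm))

/-! ### Direct and inverse inequalities for classical solutions -/

theorem IsClassicalSolution.continuousOn {T : ℝ} {w w' : ℝ → H1a a}
    {w'' : ℝ → L2} (h : IsClassicalSolution a T w w' w'') : ContinuousOn w (Icc 0 T) :=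
  fun t ht => (h.hasDeriv t ht).continuousWithinAt

theorem IsClassicalSolution.continuousOn_normalDeriv (ha : IsDegenerateCoefficient a) {T : ℝ}
    {w w' : ℝ → H1a a} {w'' : ℝ → L2} (h : IsClassicalSolution a T w w' w'') :
    ContinuousOn (fun t => normalDeriv ha (sndL2 a (w t)) (w'' t)) (Icc 0 T) := by
  have h1 : ContinuousOn (fun t => sndL2 a (w t)) (Icc 0 T) :=
    (sndL2 a).continuous.comp_continuousOn h.continuousOn
  have h2 := h.continuousOn_deriv₂
  exact ((continuousOn_const.inner h1).add (continuousOn_const.inner h2)).const_mul (a 1)⁻¹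

theorem IsClassicalSolution.integral_multiplierDeriv (ha : IsDegenerateCoefficient a) {T : ℝ}
    (hT : 0 ≤ T) {w w' : ℝ → H1a a} {w'' : ℝ → L2} (h : IsClassicalSolution a T w w' w'') :
    IntervalIntegrable (fun t => multiplierDeriv ha (w t) (w' t) (w'' t)) volume 0 T ∧
    ∫ t in (0 : ℝ)..T, multiplierDeriv ha (w t) (w' t) (w'' t) =
      multiplier ha (w T) (toL2 a (w' T)) - multiplier ha (w 0) (toL2 a (w' 0)) := by
  have hd : ∀ t ∈ Icc 0 T, HasDerivWithinAt (fun t => multiplier ha (w t) (toL2 a (w' t)))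
      (multiplierDeriv ha (w t) (w' t) (w'' t)) (Icc 0 T) t := by
    intro t ht
    have h1 := ((dilOp ha).comp (sndL2 a)).hasFDerivAt.comp_hasDerivWithinAt t (h.hasDeriv t ht)
    have h2 := (toL2 a).hasFDerivAt.comp_hasDerivWithinAt t (h.hasDeriv t ht)
    have h3 := h.hasDeriv₂ t ht
    exact ((h1.inner ℝ h3).const_mul 2).add ((h2.inner ℝ h3).const_mul (mu a / 2))
  have hc : ContinuousOn (fun t => multiplierDeriv ha (w t) (w' t) (w'' t)) (Icc 0 T) := by
    have c1 : ContinuousOn (fun t => dilOp ha (sndL2 a (w t))) (Icc 0 T) :=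
      (dilOp ha).continuous.comp_continuousOn ((sndL2 a).continuous.comp_continuousOn h.continuousOn)
    have c2 : ContinuousOn (fun t => dilOp ha (sndL2 a (w' t))) (Icc 0 T) :=
      (dilOp ha).continuous.comp_continuousOn
        ((sndL2 a).continuous.comp_continuousOn h.continuousOn_deriv)
    have c3 := (toL2 a).continuous.comp_continuousOn h.continuousOn
    have c4 := (toL2 a).continuous.comp_continuousOn h.continuousOn_deriv
    have c5 := h.continuousOn_deriv₂
    exact (((c1.inner c5).add (c2.inner c4)).const_mul 2).add
      (((c3.inner c5).add (c4.inner c4)).const_mul (mu a / 2))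
  have hi : IntervalIntegrable (fun t => multiplierDeriv ha (w t) (w' t) (w'' t)) volume 0 T := by
    refine ContinuousOn.intervalIntegrable ?_
    rwa [uIcc_of_le hT]
  refine ⟨hi, intervalIntegral.integral_eq_sub_of_hasDerivAt_of_le hT
    (fun t ht => (hd t ht).continuousWithinAt) (fun t ht => ?_) hi⟩
  exact (hd t (Ioo_subset_Icc_self ht)).hasDerivAt (Icc_mem_nhds ht.1 ht.2)

/-- The bounds for the multiplier derivative are integrated over `(0, T)` with constant energy; each
of the two endpoint values of the multiplier costs at most `(√a(1))⁻¹` times the energy. -/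
theorem IsClassicalSolution.trace_bounds (ha : IsDegenerateCoefficient a) {T : ℝ}
    (hT : 0 ≤ T) {w w' : ℝ → H1a a} {w'' : ℝ → L2} (h : IsClassicalSolution a T w w' w'') :
    ((1 - mu a / 2) * T - 2 * (√(a 1))⁻¹) * (‖sndL2 a (w T)‖ ^ 2 + ‖toL2 a (w' T)‖ ^ 2) ≤
        a 1 * ∫ t in (0 : ℝ)..T, normalDeriv ha (sndL2 a (w t)) (w'' t) ^ 2 ∧
      a 1 * ∫ t in (0 : ℝ)..T, normalDeriv ha (sndL2 a (w t)) (w'' t) ^ 2 ≤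
        (4 * T + 2 * (√(a 1))⁻¹) * (‖sndL2 a (w T)‖ ^ 2 + ‖toL2 a (w' T)‖ ^ 2) := by
  have hTm : T ∈ Icc 0 T := ⟨hT, le_rfl⟩
  have h0m : (0 : ℝ) ∈ Icc 0 T := ⟨le_rfl, hT⟩
  set N := ‖sndL2 a (w T)‖ ^ 2 + ‖toL2 a (w' T)‖ ^ 2 with hN
  obtain ⟨hi, hint⟩ := h.integral_multiplierDeriv ha hT
  have hb := fun t (ht : t ∈ Icc 0 T) => multiplier_bounds ha (h.equation t ht) (w' t)
  have hNt : ∀ t ∈ Icc 0 T, ‖sndL2 a (w t)‖ ^ 2 + ‖toL2 a (w' t)‖ ^ 2 = N := fun t ht =>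
    h.energy ha ht hTm
  have hdi : IntervalIntegrable (fun t => a 1 * normalDeriv ha (sndL2 a (w t)) (w'' t) ^ 2)
      volume 0 T := by
    refine ContinuousOn.intervalIntegrable ?_
    rw [uIcc_of_le hT]
    exact ((h.continuousOn_normalDeriv ha).pow 2).const_mul _
  have hc : ∀ c : ℝ, IntervalIntegrable (fun _ : ℝ => c * N) volume 0 T := fun c => by simp
  have h1 : ∫ t in (0 : ℝ)..T, (multiplierDeriv ha (w t) (w' t) (w'' t) + (1 - mu a / 2) * N) ≤
      ∫ t in (0 : ℝ)..T, a 1 * normalDeriv ha (sndL2 a (w t)) (w'' t) ^ 2 := by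
    refine intervalIntegral.integral_mono_on hT (hi.add (hc _)) hdi fun t ht => ?_
    rw [← hNt t ht]
    exact (hb t ht).1
  have h2 : ∫ t in (0 : ℝ)..T, a 1 * normalDeriv ha (sndL2 a (w t)) (w'' t) ^ 2 ≤
      ∫ t in (0 : ℝ)..T, (multiplierDeriv ha (w t) (w' t) (w'' t) + 4 * N) := by
    refine intervalIntegral.integral_mono_on hT hdi (hi.add (hc _)) fun t ht => ?_
    rw [← hNt t ht]
    exact (hb t ht).2
  rw [intervalIntegral.integral_add hi (hc _), hint, intervalIntegral.integral_const,
    smul_eq_mul, sub_zero, intervalIntegral.integral_const_mul] at h1 h2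
  have h3 := abs_le.1 (abs_multiplier_le ha (w T) (toL2 a (w' T)))
  have h4 := abs_le.1 (abs_multiplier_le ha (w 0) (toL2 a (w' 0)))
  have h5 : ‖((w 0 : H1a a) : L2Pair).snd‖ ^ 2 + ‖toL2 a (w' 0)‖ ^ 2 = N := hNt 0 h0m
  have h6 : ‖((w T : H1a a) : L2Pair).snd‖ ^ 2 + ‖toL2 a (w' T)‖ ^ 2 = N := rfl
  rw [h5] at h4
  rw [h6] at h3
  constructor <;> linarith [h3.1, h3.2, h4.1, h4.2]

end Energy


/-! ### The wave group -/

/-- The energy space of pairs `(√a w_x, w_t)`. -/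
abbrev WaveState (a : ℝ → ℝ) : Type := WithLp 2 (energySpace a × L2)

/-- `L²(0,M)`. -/
abbrev L2T (M : ℝ) : Type := Lp ℝ 2 ((volume : Measure ℝ).restrict (Ioo 0 M))

section Group

variable {a : ℝ → ℝ} (ha : IsDegenerateCoefficient a)

/-- The inverse of the generator of the wave group. -/
def waveInv : WaveState a →L[ℝ] WaveState a :=
  ((WithLp.prodContinuousLinearEquiv 2 ℝ (energySpace a) L2).symm.toContinuousLinearMap).comp
    (((-((energyEmb ha).adjoint.comp (WithLp.sndL 2 ℝ (energySpace a) L2))).prod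
      ((energyEmb ha).comp (WithLp.fstL 2 ℝ (energySpace a) L2))))

theorem waveInv_fst (V : WaveState a) : (waveInv ha V).fst = -(energyEmb ha).adjoint V.snd := rfl

theorem waveInv_snd (V : WaveState a) : (waveInv ha V).snd = energyEmb ha V.fst := rfl

theorem isSkew_waveInv : IsSkew (waveInv ha) := by
  intro V
  rw [WithLp.prod_inner_apply]
  change inner ℝ (waveInv ha V).fst V.fst + inner ℝ (waveInv ha V).snd V.snd = 0
  rw [waveInv_fst, waveInv_snd, inner_neg_left, ContinuousLinearMap.adjoint_inner_left,
    real_inner_comm, neg_add_cancel]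

theorem waveInv_injective : Function.Injective (waveInv ha) := by
  rw [injective_iff_map_eq_zero]
  intro V hV
  have h1 : (waveInv ha V).fst = 0 := by rw [hV]; rfl
  have h2 : (waveInv ha V).snd = 0 := by rw [hV]; rfl
  rw [waveInv_fst, neg_eq_zero] at h1
  rw [waveInv_snd] at h2
  have h3 := adjoint_energyEmb_injective ha (h1.trans (map_zero _).symm)
  have h4 := energyEmb_injective ha (h2.trans (map_zero _).symm)
  exact (WithLp.ofLp_injective 2) (Prod.ext h4 h3)

/-- The wave group. -/
def waveGroup : ℝ → WaveState a →L[ℝ] WaveState a :=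
  Classical.choose ((isSkew_waveInv ha).exists_group (waveInv_injective ha))

theorem isSkewGroup_waveGroup : IsSkewGroup (waveInv ha) (waveGroup ha) :=
  Classical.choose_spec ((isSkew_waveInv ha).exists_group (waveInv_injective ha))

theorem denseRange_waveInv : DenseRange (waveInv ha) :=
  (isSkew_waveInv ha).denseRange (waveInv_injective ha)

/-- The position `w` of the state `(√a w_x, w_t)`. -/
def posL : WaveState a →L[ℝ] H1a a :=
  ((energyEquiv ha).symm.toContinuousLinearMap).comp (WithLp.fstL 2 ℝ (energySpace a) L2)

/-- The velocity `w_t` of the state `(√a w_x, w_t)`. -/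
def velL (a : ℝ → ℝ) : WaveState a →L[ℝ] L2 := WithLp.sndL 2 ℝ (energySpace a) L2

/-- The state of the data `(w, w_t)`. -/
def stateL : H1a a × L2 →L[ℝ] WaveState a :=
  ((WithLp.prodContinuousLinearEquiv 2 ℝ (energySpace a) L2).symm.toContinuousLinearMap).comp
    (((energyEquiv ha).toContinuousLinearMap).prodMap (ContinuousLinearMap.id ℝ L2))

theorem posL_stateL (W : H1a a × L2) : posL ha (stateL ha W) = W.1 :=
  (energyEquiv ha).symm_apply_apply W.1

theorem velL_stateL (W : H1a a × L2) : velL a (stateL ha W) = W.2 := rfl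

theorem stateL_posL_velL (V : WaveState a) : stateL ha (posL ha V, velL a V) = V :=
  (WithLp.ofLp_injective 2) (Prod.ext ((energyEquiv ha).apply_symm_apply V.fst) rfl)

theorem norm_sq_waveState (V : WaveState a) : ‖V‖ ^ 2 = ‖sndL2 a (posL ha V)‖ ^ 2 + ‖velL a V‖ ^ 2 :=
  WithLp.prod_norm_sq_eq_of_L2 V

theorem inner_waveState (V W : WaveState a) :
    inner ℝ V W = inner ℝ V.fst W.fst + inner ℝ V.snd W.snd := WithLp.prod_inner_apply V W

theorem toL2_posL (V : WaveState a) : toL2 a (posL ha V) = velL a (waveInv ha V) := rfl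

theorem hasDiv_posL (V : WaveState a) : HasDiv a (posL ha (waveInv ha V)) (velL a V) := by
  rw [hasDiv_iff ha]
  exact (energyEquiv ha).apply_symm_apply _

theorem hasDerivAt_waveInv_waveGroup (S : ℝ) (V : WaveState a) (t : ℝ) :
    HasDerivAt (fun t => waveInv ha (waveGroup ha (t - S) V)) (waveGroup ha (t - S) V) t :=
  ((isSkewGroup_waveGroup ha).hasDerivAt V (t - S)).comp_sub_const t S

theorem continuous_waveGroup (S : ℝ) (V : WaveState a) :
    Continuous fun t => waveGroup ha (t - S) V :=
  ((isSkewGroup_waveGroup ha).continuous V).comp (continuous_id.sub continuous_const)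

/-- The range of `J` is the domain of the generator. With final state `J V`, the orbit is `J U(t -
S) V` and its derivative is `U(t - S) V`. -/
theorem isClassicalSolution_waveGroup (S : ℝ) (V : WaveState a) :
    IsClassicalSolution a S (fun t => posL ha (waveInv ha (waveGroup ha (t - S) V)))
      (fun t => posL ha (waveGroup ha (t - S) V)) (fun t => velL a (waveGroup ha (t - S) V)) where
  hasDeriv t _ := ((posL ha).hasFDerivAt.comp_hasDerivAt t
    (hasDerivAt_waveInv_waveGroup ha S V t)).hasDerivWithinAt
  continuousOn_deriv := ((posL ha).continuous.comp (continuous_waveGroup ha S V)).continuousOn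
  hasDeriv₂ t _ := ((velL a).hasFDerivAt.comp_hasDerivAt t
    (hasDerivAt_waveInv_waveGroup ha S V t)).hasDerivWithinAt
  continuousOn_deriv₂ := ((velL a).continuous.comp (continuous_waveGroup ha S V)).continuousOn
  equation t _ := hasDiv_posL ha _

theorem isMildSolution_waveGroup (S : ℝ) (V : WaveState a) :
    IsMildSolution a S (fun t => posL ha (waveGroup ha (t - S) V))
      (fun t => velL a (waveGroup ha (t - S) V)) where
  continuousOn := ((posL ha).continuous.comp (continuous_waveGroup ha S V)).continuousOn
  continuousOn_deriv := ((velL a).continuous.comp (continuous_waveGroup ha S V)).continuousOn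
  hasDeriv t _ := ((velL a).hasFDerivAt.comp_hasDerivAt t
    (hasDerivAt_waveInv_waveGroup ha S V t)).hasDerivWithinAt
  equation := by
    refine ⟨fun t => posL ha (waveInv ha (waveGroup ha (t - S) V)) -
      posL ha (waveInv ha (waveGroup ha (0 - S) V)), sub_self _, fun t _ => ⟨?_, ?_⟩⟩
    · exact (((posL ha).hasFDerivAt.comp_hasDerivAt t
        (hasDerivAt_waveInv_waveGroup ha S V t)).sub_const _).hasDerivWithinAt
    · exact (hasDiv_posL ha _).sub ha (hasDiv_posL ha _)

/-! ### The trace operator -/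

/-- The normal derivative of the position of the state `A⁻¹ V`. -/
def traceFun : WaveState a →L[ℝ] ℝ :=
  (a 1)⁻¹ • ((innerSL ℝ (memLp_sqrt ha).toLp).comp ((sndL2 a).comp ((posL ha).comp (waveInv ha))) +
    (innerSL ℝ (memLp_id.toLp : L2)).comp (velL a))

theorem traceFun_apply (V : WaveState a) :
    traceFun ha V = normalDeriv ha (sndL2 a (posL ha (waveInv ha V))) (velL a V) := rfl

theorem hasNormalDeriv_posL (V : WaveState a) :
    HasNormalDeriv a (posL ha (waveInv ha V)) (traceFun ha V) :=
  (hasDiv_posL ha V).hasNormalDeriv ha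

theorem continuous_traceFun (V : WaveState a) :
    Continuous fun r : ℝ => traceFun ha (waveGroup ha (-r) V) :=
  (traceFun ha).continuous.comp (((isSkewGroup_waveGroup ha).continuous V).comp continuous_neg)

theorem memLp_traceFun (M : ℝ) (V : WaveState a) :
    MemLp (fun r : ℝ => traceFun ha (waveGroup ha (-r) V)) 2 (volume.restrict (Ioo 0 M)) := by
  refine MemLp.of_bound (continuous_traceFun ha V).aestronglyMeasurable (‖traceFun ha‖ * ‖V‖)
    (Eventually.of_forall fun r => ?_)
  refine ((traceFun ha).le_opNorm _).trans ?_
  rw [(isSkewGroup_waveGroup ha).norm_map]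

/-- The trace of the solutions with data in the domain of the generator. -/
def traceLin (M : ℝ) : WaveState a →ₗ[ℝ] L2T M where
  toFun V := (memLp_traceFun ha M V).toLp
  map_add' V W := by
    rw [← MemLp.toLp_add, MemLp.toLp_eq_toLp_iff]
    exact Eventually.of_forall fun r => by simp
  map_smul' c V := by
    rw [RingHom.id_apply, ← MemLp.toLp_const_smul, MemLp.toLp_eq_toLp_iff]
    exact Eventually.of_forall fun r => by simp

/-- The trace `r ↦ w_x(-r,1)`, `0 < r < M`, of the solution with state `W` at time `0`. -/
def traceOp (M : ℝ) : WaveState a →L[ℝ] L2T M :=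
  (traceLin ha M).extendOfNorm (waveInv ha).toLinearMap

theorem norm_sq_toLp {M : ℝ} {f : ℝ → ℝ} (hf : MemLp f 2 (volume.restrict (Ioo 0 M))) :
    ‖hf.toLp f‖ ^ 2 = ∫ x in Ioo 0 M, f x ^ 2 := by
  rw [← real_inner_self_eq_norm_sq, MeasureTheory.L2.inner_def]
  refine integral_congr_ae ?_
  filter_upwards [hf.coeFn_toLp] with x hx
  rw [hx]
  simp [sq]

theorem norm_sq_traceLin {M : ℝ} (hM : 0 ≤ M) (V : WaveState a) :
    ‖traceLin ha M V‖ ^ 2 = ∫ t in (0 : ℝ)..M, traceFun ha (waveGroup ha (t - M) V) ^ 2 := by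
  have h1 : ‖traceLin ha M V‖ ^ 2 = ∫ r in Ioo 0 M, traceFun ha (waveGroup ha (-r) V) ^ 2 :=
    norm_sq_toLp (memLp_traceFun ha M V)
  rw [h1, ← integral_Ioc_eq_integral_Ioo, ← intervalIntegral.integral_of_le hM]
  have h2 := intervalIntegral.integral_comp_sub_left (a := 0) (b := M)
    (fun t => traceFun ha (waveGroup ha (t - M) V) ^ 2) M
  rw [sub_self, sub_zero] at h2
  rw [← h2]
  congr 1
  ext r
  congr 4
  ring

/-- The solution whose trace is taken has state `J V` at the final time, so its energy is `‖J V‖²`;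
this is what allows the extension by density along `J`. -/
theorem traceLin_bounds {M : ℝ} (hM : 0 ≤ M) (V : WaveState a) :
    ((1 - mu a / 2) * M - 2 * (√(a 1))⁻¹) * ‖waveInv ha V‖ ^ 2 ≤ a 1 * ‖traceLin ha M V‖ ^ 2 ∧
      a 1 * ‖traceLin ha M V‖ ^ 2 ≤ (4 * M + 2 * (√(a 1))⁻¹) * ‖waveInv ha V‖ ^ 2 := by
  have h1 := (isClassicalSolution_waveGroup ha M V).trace_bounds ha hM
  simp only [sub_self, (isSkewGroup_waveGroup ha).map_zero] at h1
  rw [toL2_posL, ← norm_sq_waveState] at h1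
  rw [norm_sq_traceLin ha hM]
  exact h1

theorem exists_traceLin_bound {M : ℝ} (hM : 0 ≤ M) :
    ∃ C, ∀ V, ‖traceLin ha M V‖ ≤ C * ‖(waveInv ha).toLinearMap V‖ := by
  have h0 := ha.one_pos
  set C := (a 1)⁻¹ * (4 * M + 2 * (√(a 1))⁻¹)
  have hC : 0 ≤ C := by positivity
  refine ⟨√C, fun V => ?_⟩
  refine (sq_le_sq₀ (norm_nonneg _) (by positivity)).1 ?_
  rw [mul_pow, Real.sq_sqrt hC, mul_assoc]
  have h1 := (traceLin_bounds ha hM V).2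
  rw [inv_mul_eq_div, le_div_iff₀ h0]
  have h2 : (waveInv ha).toLinearMap V = waveInv ha V := rfl
  rw [h2]
  linarith

theorem traceOp_waveInv {M : ℝ} (hM : 0 ≤ M) (V : WaveState a) :
    traceOp ha M (waveInv ha V) = traceLin ha M V :=
  (traceLin ha M).extendOfNorm_eq (denseRange_waveInv ha) (exists_traceLin_bound ha hM) V

theorem le_norm_sq_traceOp {M : ℝ} (hM : 0 ≤ M) (W : WaveState a) :
    ((1 - mu a / 2) * M - 2 * (√(a 1))⁻¹) * ‖W‖ ^ 2 ≤ a 1 * ‖traceOp ha M W‖ ^ 2 := by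
  refine (denseRange_waveInv ha).induction_on (p := fun W => ((1 - mu a / 2) * M -
    2 * (√(a 1))⁻¹) * ‖W‖ ^ 2 ≤ a 1 * ‖traceOp ha M W‖ ^ 2) W ?_ fun V => ?_
  · exact isClosed_le (by fun_prop) (by fun_prop)
  · rw [traceOp_waveInv ha hM]
    exact (traceLin_bounds ha hM V).1

end Group


/-! ### Normal traces of mild solutions -/

theorem eLpNorm_eq_ofReal_sqrt {M : ℝ} {f : ℝ → ℝ} (hf : MemLp f 2 (volume.restrict (Ioo 0 M))) :
    eLpNorm f 2 (volume.restrict (Ioo 0 M)) = ENNReal.ofReal √(∫ x in Ioo 0 M, f x ^ 2) := by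
  rw [← norm_sq_toLp hf, Real.sqrt_sq (norm_nonneg _), Lp.norm_toLp,
    ENNReal.ofReal_toReal hf.2.ne]

theorem memLp_of_continuousOn {M : ℝ} {f : ℝ → ℝ} (hf : ContinuousOn f (Icc 0 M)) :
    MemLp f 2 (volume.restrict (Ioo 0 M)) := by
  obtain ⟨C, hC⟩ := isCompact_Icc.exists_bound_of_continuousOn hf
  refine MemLp.of_bound ((hf.mono Ioo_subset_Icc_self).aestronglyMeasurable measurableSet_Ioo) C ?_
  exact (ae_restrict_iff' measurableSet_Ioo).2
    (Eventually.of_forall fun x hx => hC x (Ioo_subset_Icc_self hx))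

theorem measurePreserving_sub_left_Ioo (S : ℝ) :
    MeasurePreserving (fun t : ℝ => S - t) (volume.restrict (Ioo 0 S))
      (volume.restrict (Ioo 0 S)) := by
  have h1 : (fun t : ℝ => S - t) ⁻¹' Ioo 0 S = Ioo 0 S := by
    ext t
    simp only [mem_preimage, mem_Ioo]
    constructor <;> rintro ⟨h1, h2⟩ <;> constructor <;> linarith
  have h2 := (Measure.measurePreserving_sub_left (volume : Measure ℝ) S).restrict_preimage
    (measurableSet_Ioo (a := 0) (b := S))
  rwa [h1] at h2

theorem restrict_Ioo_le {S M : ℝ} (h : S ≤ M) :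
    (volume : Measure ℝ).restrict (Ioo 0 S) ≤ volume.restrict (Ioo 0 M) :=
  Measure.restrict_mono (Ioo_subset_Ioo_right h) le_rfl

section Trace

variable {a : ℝ → ℝ} (ha : IsDegenerateCoefficient a)
include ha

theorem normalDeriv_sub (p q y z : L2) :
    normalDeriv ha (p - q) (y - z) = normalDeriv ha p y - normalDeriv ha q z := by
  simp only [normalDeriv, inner_sub_right]
  ring

/-- Measuring time backwards from the final instant, `r = S - t`, lets one trace operator on `(0,
M)` serve all horizons `S ≤ M`. -/
theorem isNormalTrace_waveGroup {S M : ℝ} (hS : 0 ≤ S) (hSM : S ≤ M) (W : WaveState a) :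
    IsNormalTrace a S (fun t => posL ha (waveGroup ha (t - S) W))
      (fun t => velL a (waveGroup ha (t - S) W)) (fun t => traceOp ha M W (S - t)) := by
  have hmp := measurePreserving_sub_left_Ioo S
  have hT : MemLp (traceOp ha M W) 2 (volume.restrict (Ioo 0 S)) :=
    (Lp.memLp (traceOp ha M W)).mono_measure (restrict_Ioo_le hSM)
  refine ⟨hT.comp_measurePreserving hmp, ?_⟩
  obtain ⟨X, hX, hXW⟩ := mem_closure_iff_seq_limit.1 ((denseRange_waveInv ha).closure_range ▸
    mem_univ W : W ∈ closure (range (waveInv ha)))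
  choose V hV using hX
  have hU0 := (isSkewGroup_waveGroup ha).map_zero
  have hlim : Tendsto (fun n => waveInv ha (V n)) atTop (𝓝 W) := by simpa only [hV] using hXW
  refine ⟨_, _, _, fun n t => traceFun ha (waveGroup ha (t - S) (V n)),
    fun n => isClassicalSolution_waveGroup ha S (V n), fun n t _ => hasNormalDeriv_posL ha _,
    ?_, ?_, ?_⟩
  · simp only [sub_self, hU0]
    exact ((posL ha).continuous.tendsto _).comp hlim
  · simp only [sub_self, hU0, toL2_posL]
    exact ((velL a).continuous.tendsto _).comp hlim
  · have h1 : Tendsto (fun n => traceLin ha M (V n)) atTop (𝓝 (traceOp ha M W)) := by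
      simp only [← traceOp_waveInv ha (hS.trans hSM)]
      exact ((traceOp ha M).continuous.tendsto _).comp hlim
    rw [Lp.tendsto_Lp_iff_tendsto_eLpNorm'] at h1
    refine tendsto_of_tendsto_of_tendsto_of_le_of_le tendsto_const_nhds h1
      (fun _ => zero_le) fun n => ?_
    have h2 : (fun t => traceFun ha (waveGroup ha (t - S) (V n))) - (fun t => traceOp ha M W (S - t)) =
        ((fun r => traceFun ha (waveGroup ha (-r) (V n))) - ⇑(traceOp ha M W)) ∘ fun t => S - t := by
      ext t
      simp
    have h3 : eLpNorm (((fun r => traceFun ha (waveGroup ha (-r) (V n))) - ⇑(traceOp ha M W)) ∘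
        fun t => S - t) 2 (volume.restrict (Ioo 0 S)) =
        eLpNorm ((fun r => traceFun ha (waveGroup ha (-r) (V n))) - ⇑(traceOp ha M W)) 2
          (volume.restrict (Ioo 0 S)) := by
      refine eLpNorm_comp_measurePreserving ?_ hmp
      exact (continuous_traceFun ha (V n)).aestronglyMeasurable.sub hT.1
    rw [h2, h3]
    refine (eLpNorm_mono_measure _ (restrict_Ioo_le hSM)).trans (le_of_eq ?_)
    refine eLpNorm_congr_ae ?_
    filter_upwards [(memLp_traceFun ha M (V n)).coeFn_toLp] with r hr
    rw [Pi.sub_apply, Pi.sub_apply]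
    exact congrArg (· - _) hr.symm

/-- The direct inequality, applied to the difference of the two approximating classical solutions,
bounds the distance of their traces by that of their final data. -/
theorem IsNormalTrace.ae_eq {S : ℝ} (hS : 0 ≤ S) {w v : ℝ → H1a a} {w' v' : ℝ → L2}
    {g k : ℝ → ℝ} (hg : IsNormalTrace a S w w' g) (hk : IsNormalTrace a S v v' k)
    (h0 : w S = v S) (h1 : w' S = v' S) : g =ᵐ[volume.restrict (Ioo 0 S)] k := by
  obtain ⟨hgm, z, z', z'', h, hz, hzh, hzw, hzw', hhg⟩ := hg
  obtain ⟨hkm, y, y', y'', l, hy, hyl, hyw, hyw', hlk⟩ := hk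
  set μ := (volume : Measure ℝ).restrict (Ioo 0 S)
  have hSm : S ∈ Icc 0 S := ⟨hS, le_rfl⟩
  have hhe : ∀ n, ∀ t ∈ Icc 0 S, h n t = normalDeriv ha (sndL2 a (z n t)) (z'' n t) :=
    fun n t ht => (hzh n t ht).unique ha (((hz n).equation t ht).hasNormalDeriv ha)
  have hle : ∀ n, ∀ t ∈ Icc 0 S, l n t = normalDeriv ha (sndL2 a (y n t)) (y'' n t) :=
    fun n t ht => (hyl n t ht).unique ha (((hy n).equation t ht).hasNormalDeriv ha)
  have hhc : ∀ n, ContinuousOn (h n) (Icc 0 S) := fun n =>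
    ((hz n).continuousOn_normalDeriv ha).congr (hhe n)
  have hlc : ∀ n, ContinuousOn (l n) (Icc 0 S) := fun n =>
    ((hy n).continuousOn_normalDeriv ha).congr (hle n)
  set N : ℕ → ℝ := fun n => ‖sndL2 a (z n S - y n S)‖ ^ 2 + ‖toL2 a (z' n S - y' n S)‖ ^ 2
  set C := (a 1)⁻¹ * (4 * S + 2 * (√(a 1))⁻¹)
  have hN : Tendsto N atTop (𝓝 0) := by
    have e1 : Tendsto (fun n => z n S - y n S) atTop (𝓝 0) := by
      simpa [h0] using hzw.sub hyw
    have e2 : Tendsto (fun n => toL2 a (z' n S - y' n S)) atTop (𝓝 0) := by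
      simpa [h1] using hzw'.sub hyw'
    have e3 := ((sndL2 a).continuous.tendsto _).comp e1
    have e4 := (e3.norm.pow 2).add (e2.norm.pow 2)
    simp only [map_zero, norm_zero, ne_eq, OfNat.ofNat_ne_zero, not_false_eq_true, zero_pow,
      add_zero] at e4
    exact e4
  have hint : ∀ n, ∫ t in Ioo 0 S, (h n t - l n t) ^ 2 ≤ C * N n := by
    intro n
    have e1 := (((hz n).sub ha (hy n)).trace_bounds ha hS).2
    have e2 : ∫ t in (0 : ℝ)..S, normalDeriv ha (sndL2 a (z n t - y n t)) (z'' n t - y'' n t) ^ 2 =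
        ∫ t in Ioo 0 S, (h n t - l n t) ^ 2 := by
      rw [intervalIntegral.integral_of_le hS, integral_Ioc_eq_integral_Ioo]
      refine setIntegral_congr_fun measurableSet_Ioo fun t ht => ?_
      have ht' := Ioo_subset_Icc_self ht
      rw [map_sub, normalDeriv_sub, ← hhe n t ht', ← hle n t ht']
    rw [e2] at e1
    have e3 := ha.one_pos
    rw [mul_assoc, inv_mul_eq_div, le_div_iff₀ e3]
    linarith
  have hdiff : Tendsto (fun n => eLpNorm (h n - l n) 2 μ) atTop (𝓝 0) := by
    have e1 : Tendsto (fun n => ENNReal.ofReal √(C * N n)) atTop (𝓝 0) := by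
      have := ENNReal.tendsto_ofReal (hN.const_mul C).sqrt
      simpa using this
    refine tendsto_of_tendsto_of_tendsto_of_le_of_le tendsto_const_nhds e1
      (fun _ => zero_le) fun n => ?_
    simp only
    rw [eLpNorm_eq_ofReal_sqrt (memLp_of_continuousOn ((hhc n).sub (hlc n)))]
    exact ENNReal.ofReal_le_ofReal (Real.sqrt_le_sqrt (hint n))
  have hzero : eLpNorm (g - k) 2 μ = 0 := by
    refine le_antisymm (ge_of_tendsto' (by simpa using (hhg.add hdiff).add hlk) fun n => ?_) zero_le
    have m1 := (memLp_of_continuousOn (hhc n)).1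
    have m2 := (memLp_of_continuousOn (hlc n)).1
    have e1 : g - k = (g - h n) + (h n - l n) + (l n - k) := by abel
    rw [e1]
    refine (eLpNorm_add_le ((hgm.1.sub m1).add (m1.sub m2)) (m2.sub hkm.1) (by norm_num)).trans ?_
    gcongr
    refine (eLpNorm_add_le (hgm.1.sub m1) (m1.sub m2) (by norm_num)).trans ?_
    rw [eLpNorm_sub_comm]
  rw [eLpNorm_eq_zero_iff (hgm.1.sub hkm.1) (by norm_num)] at hzero
  filter_upwards [hzero] with t ht
  exact sub_eq_zero.1 ht

theorem isBackwardSolution_waveGroup {S M : ℝ} (hS : 0 ≤ S) (hSM : S ≤ M) (W : H1a a × L2) :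
    IsBackwardSolution a S W (fun t => posL ha (waveGroup ha (t - S) (stateL ha W)))
      (fun t => velL a (waveGroup ha (t - S) (stateL ha W)))
      (fun t => traceOp ha M (stateL ha W) (S - t)) where
  mild := isMildSolution_waveGroup ha S _
  final := by rw [sub_self, (isSkewGroup_waveGroup ha).map_zero, posL_stateL]
  final_deriv := by rw [sub_self, (isSkewGroup_waveGroup ha).map_zero, velL_stateL]
  trace := isNormalTrace_waveGroup ha hS hSM _

theorem IsBackwardSolution.eq_waveGroup {S M : ℝ} (hS : 0 ≤ S) (hSM : S ≤ M) {W : H1a a × L2}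
    {w : ℝ → H1a a} {w' : ℝ → L2} {g : ℝ → ℝ} (h : IsBackwardSolution a S W w w' g) :
    w 0 = posL ha (waveGroup ha (-S) (stateL ha W)) ∧
      w' 0 = velL a (waveGroup ha (-S) (stateL ha W)) ∧
      g =ᵐ[volume.restrict (Ioo 0 S)] fun t => traceOp ha M (stateL ha W) (S - t) := by
  have hb := isBackwardSolution_waveGroup ha hS hSM W
  have h1 := h.mild.eq ha hS hb.mild (h.final.trans hb.final.symm)
    (h.final_deriv.trans hb.final_deriv.symm) (t := 0) ⟨le_rfl, hS⟩
  simp only [zero_sub] at h1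
  exact ⟨h1.1, h1.2, h.trace.ae_eq ha hS hb.trace (h.final.trans hb.final.symm)
    (h.final_deriv.trans hb.final_deriv.symm)⟩

end Trace


/-! ### Translations in `L²` -/

section Shift

/-- The function `r ↦ f(s - r)` in `L²(0,M)`. -/
def shift {f : ℝ → ℝ} (hf : MemLp f 2 volume) (M s : ℝ) : L2T M :=
  LpToLpRestrictCLM ℝ ℝ ℝ volume 2 (Ioo 0 M)
    (Lp.compMeasurePreserving (fun r => s - r)
      (Measure.measurePreserving_sub_left volume s) hf.toLp)

theorem shift_ae_eq {f : ℝ → ℝ} (hf : MemLp f 2 volume) (M s : ℝ) :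
    shift hf M s =ᵐ[volume.restrict (Ioo 0 M)] fun r => f (s - r) := by
  have hmp := Measure.measurePreserving_sub_left (volume : Measure ℝ) s
  refine (LpToLpRestrictCLM_coeFn ℝ (Ioo 0 M) _).trans (ae_restrict_of_ae ?_)
  refine (Lp.coeFn_compMeasurePreserving _ hmp).trans ?_
  exact hmp.quasiMeasurePreserving.ae_eq_comp hf.coeFn_toLp

theorem continuous_shift {f : ℝ → ℝ} (hf : MemLp f 2 volume) (M : ℝ) :
    Continuous fun s => shift hf M s := by
  refine (LpToLpRestrictCLM ℝ ℝ ℝ volume 2 (Ioo 0 M)).continuous.comp ?_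
  let g : C(ℝ × ℝ, ℝ) := ⟨fun P => P.1 - P.2, by fun_prop⟩
  exact Continuous.compMeasurePreservingLp (f := fun _ : ℝ => hf.toLp) (g := fun s => g.curry s)
    continuous_const g.curry.continuous
    (fun s => Measure.measurePreserving_sub_left volume s) (by norm_num)

theorem inner_shift {f : ℝ → ℝ} (hf : MemLp f 2 volume) (M s : ℝ) (k : L2T M) :
    inner ℝ (shift hf M s) k = ∫ r in Ioo 0 M, f (s - r) * k r := by
  rw [MeasureTheory.L2.inner_def]
  refine integral_congr_ae ?_
  filter_upwards [shift_ae_eq hf M s] with r hr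
  rw [hr]
  simp [mul_comm]

theorem integral_shift_mul {f : ℝ → ℝ} (hf0 : ∀ x ≤ 0, f x = 0) {S M : ℝ} (hSM : S ≤ M)
    (k : ℝ → ℝ) :
    ∫ r in Ioo 0 M, f (S - r) * k r = ∫ t in Ioo 0 S, f t * k (S - t) := by
  have h1 : ∫ r in Ioo 0 M, f (S - r) * k r = ∫ r in Ioo 0 S, f (S - r) * k r := by
    refine setIntegral_eq_of_subset_of_forall_sdiff_eq_zero measurableSet_Ioo
      (Ioo_subset_Ioo_right hSM) fun r hr => ?_
    rw [hf0, zero_mul]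
    by_contra! h
    exact hr.2 ⟨hr.1.1, by linarith⟩
  rw [h1]
  rcases le_or_gt S 0 with hS | hS
  · simp [Ioo_eq_empty (not_lt.2 hS)]
  · rw [← integral_Ioc_eq_integral_Ioo, ← integral_Ioc_eq_integral_Ioo,
      ← intervalIntegral.integral_of_le hS.le, ← intervalIntegral.integral_of_le hS.le]
    have h2 := intervalIntegral.integral_comp_sub_left (a := 0) (b := S)
      (fun t => f t * k (S - t)) S
    simpa using h2

/-- Convolution with a primitive is the primitive of the convolution. -/
theorem integral_shift_mul_primitive {f κ : ℝ → ℝ} (hf : Integrable f) (hf0 : ∀ x ≤ 0, f x = 0)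
    {M s : ℝ} (hs : 0 ≤ s) (hsM : s ≤ M) (hκ : IntegrableOn κ (Ioo 0 M)) :
    ∫ r in Ioo 0 M, f (s - r) * ∫ ρ in (0 : ℝ)..r, κ ρ =
      ∫ σ in (0 : ℝ)..s, ∫ r in Ioo 0 M, f (σ - r) * κ r := by
  have hM : 0 ≤ M := hs.trans hsM
  have hκi : IntervalIntegrable κ volume 0 M :=
    (intervalIntegrable_iff_integrableOn_Ioo_of_le hM).2 hκ
  have hG : Integrable fun x => f (s - x) := hf.comp_sub_left s
  have hprod : Integrable (fun P : ℝ × ℝ => f (P.1 - P.2) * κ P.2)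
      ((volume.restrict (Ioc 0 s)).prod (volume.restrict (Ioo 0 M))) := by
    have h1 : Integrable ((Ioo 0 M).indicator κ) := hκ.integrable_indicator measurableSet_Ioo
    have h2 := Integrable.convolution_integrand (ContinuousLinearMap.mul ℝ ℝ) h1 hf
      (μ := volume) (ν := volume)
    have h3 := h2.integrableOn (s := Ioc 0 s ×ˢ Ioo 0 M)
    rw [IntegrableOn, ← Measure.prod_restrict] at h3
    refine h3.congr ?_
    rw [Measure.prod_restrict]
    refine (ae_restrict_iff' (measurableSet_Ioc.prod measurableSet_Ioo)).2
      (Eventually.of_forall fun P hP => ?_)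
    simp only [ContinuousLinearMap.mul_apply', indicator_of_mem hP.2, mul_comm]
  -- Both sides equal `∫₀^{s-r} f`; the part over negative arguments drops out because `f` vanishes
  -- there.
  have hA : ∀ r ∈ Ioo 0 M, ∫ σ in (0 : ℝ)..s, f (σ - r) = ∫ x in r..s, f (s - x) := by
    intro r hr
    rw [intervalIntegral.integral_comp_sub_right, intervalIntegral.integral_comp_sub_left, sub_self,
      zero_sub, ← intervalIntegral.integral_add_adjacent_intervals (b := 0)
        hf.intervalIntegrable hf.intervalIntegrable]
    rw [intervalIntegral.integral_zero_ae, zero_add]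
    refine Eventually.of_forall fun x hx => hf0 x ?_
    rw [uIoc_of_le (by linarith [hr.1])] at hx
    exact hx.2
  rw [intervalIntegral.integral_of_le hs, integral_integral_swap hprod]
  have hR : ∫ r in Ioo 0 M, ∫ σ in Ioc 0 s, f (σ - r) * κ r =
      ∫ r in (0 : ℝ)..M, (∫ x in r..s, f (s - x)) * κ r := by
    rw [intervalIntegral.integral_of_le hM, integral_Ioc_eq_integral_Ioo]
    refine setIntegral_congr_fun measurableSet_Ioo fun r hr => ?_
    rw [integral_mul_const, ← intervalIntegral.integral_of_le hs, hA r hr]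
  rw [hR, ← integral_Ioc_eq_integral_Ioo, ← intervalIntegral.integral_of_le hM]
  -- After Fubini the claim is an integration by parts. The boundary term at `0` vanishes with the
  -- primitive of `κ`, the one at `M` since `f (s - x) = 0` for `x ≥ s`.
  have hacA : AbsolutelyContinuousOnInterval (fun r => -∫ x in s..r, f (s - x)) 0 M :=
    (hG.intervalIntegrable.absolutelyContinuousOnInterval_intervalIntegral
      (by rw [uIcc_of_le hM]; exact ⟨hs, hsM⟩)).fun_neg
  have hack : AbsolutelyContinuousOnInterval (fun r => ∫ ρ in (0 : ℝ)..r, κ ρ) 0 M :=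
    hκi.absolutelyContinuousOnInterval_intervalIntegral left_mem_uIcc
  have hparts := hacA.integral_deriv_mul_eq_sub hack
  have hd1 : ∀ᵐ r, r ∈ uIoc 0 M → deriv (fun r => -∫ x in s..r, f (s - x)) r = -f (s - r) := by
    filter_upwards [(hG.intervalIntegrable (a := 0) (b := M)).ae_hasDerivAt_integral] with r hr hrm
    exact (hr (uIoc_subset_uIcc hrm) s (by rw [uIcc_of_le hM]; exact ⟨hs, hsM⟩)).neg.deriv
  have hd2 : ∀ᵐ r, r ∈ uIoc 0 M → deriv (fun r => ∫ ρ in (0 : ℝ)..r, κ ρ) r = κ r := by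
    filter_upwards [hκi.ae_hasDerivAt_integral] with r hr hrm
    exact (hr (uIoc_subset_uIcc hrm) 0 left_mem_uIcc).deriv
  have hi1 : IntervalIntegrable (fun r => f (s - r) * ∫ ρ in (0 : ℝ)..r, κ ρ) volume 0 M :=
    hG.intervalIntegrable.mul_continuousOn hack.continuousOn
  have hi2 : IntervalIntegrable (fun r => (∫ x in r..s, f (s - x)) * κ r) volume 0 M := by
    refine hκi.continuousOn_mul ?_
    refine hacA.continuousOn.congr fun r _ => ?_
    exact intervalIntegral.integral_symm _ _
  have hsum : ∫ r in (0 : ℝ)..M, (deriv (fun r => -∫ x in s..r, f (s - x)) r *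
      (∫ ρ in (0 : ℝ)..r, κ ρ) + (-∫ x in s..r, f (s - x)) *
        deriv (fun r => ∫ ρ in (0 : ℝ)..r, κ ρ) r) =
      ∫ r in (0 : ℝ)..M, (-(f (s - r) * ∫ ρ in (0 : ℝ)..r, κ ρ) +
        (∫ x in r..s, f (s - x)) * κ r) := by
    refine intervalIntegral.integral_congr_ae ?_
    filter_upwards [hd1, hd2] with r h1 h2 hr
    rw [h1 hr, h2 hr, ← intervalIntegral.integral_symm]
    ring
  have hend : ∫ x in s..M, f (s - x) = 0 := by
    refine intervalIntegral.integral_zero_ae (Eventually.of_forall fun x hx => hf0 _ ?_)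
    rw [uIoc_of_le hsM] at hx
    linarith [hx.1]
  have hi1' : IntervalIntegrable (fun r => -(f (s - r) * ∫ ρ in (0 : ℝ)..r, κ ρ)) volume 0 M :=
    hi1.neg
  rw [hsum, intervalIntegral.integral_add hi1' hi2, intervalIntegral.integral_neg, hend,
    intervalIntegral.integral_same] at hparts
  linarith

end Shift


/-! ### Solutions by transposition -/

section Transposition

variable {a : ℝ → ℝ} (ha : IsDegenerateCoefficient a)

/-- The Riesz representative of `V ↦ ⟨y₁, w⟩ - ∫ y₀ w_t`, where `V = (√a w_x, w_t)`. -/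
def dataState (y₀ : L2) (y₁ : Hm1a a) : WaveState a :=
  (InnerProductSpace.toDual ℝ (WaveState a)).symm
    (y₁.comp (posL ha) - (innerSL ℝ y₀).comp (velL a))

theorem inner_dataState (y₀ : L2) (y₁ : Hm1a a) (V : WaveState a) :
    inner ℝ (dataState ha y₀ y₁) V = y₁ (posL ha V) - inner ℝ y₀ (velL a V) := by
  rw [dataState, InnerProductSpace.toDual_symm_apply]
  rfl

/-- The dual state at time `s` of the problem controlled by `f`, from the initial state `Y`. -/
def dualState {f : ℝ → ℝ} (hf : MemLp f 2 volume) (Y : WaveState a) (M s : ℝ) : WaveState a :=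
  waveGroup ha s Y - a 1 • (traceOp ha M).adjoint (shift hf M s)

theorem continuous_dualState {f : ℝ → ℝ} (hf : MemLp f 2 volume) (Y : WaveState a) (M : ℝ) :
    Continuous fun s => dualState ha hf Y M s :=
  ((isSkewGroup_waveGroup ha).continuous Y).sub
    (((traceOp ha M).adjoint.continuous.comp (continuous_shift hf M)).const_smul (a 1))

/-- Moving `U(S)` and `Γ*` to the other side turns the definition into the right-hand side of the
transposition identity. -/
theorem inner_dualState {f : ℝ → ℝ} (hf : MemLp f 2 volume) (hf0 : ∀ x ≤ 0, f x = 0)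
    (Y : WaveState a) {M S : ℝ} (hSM : S ≤ M) (V : WaveState a) :
    inner ℝ (dualState ha hf Y M S) V = inner ℝ Y (waveGroup ha (-S) V) -
      a 1 * ∫ t in Ioo 0 S, f t * traceOp ha M V (S - t) := by
  have h1 : inner ℝ (a 1 • (traceOp ha M).adjoint (shift hf M S)) V =
      a 1 * inner ℝ ((traceOp ha M).adjoint (shift hf M S)) V :=
    real_inner_smul_left (F := WaveState a) _ _ _
  rw [dualState, inner_sub_left, (isSkewGroup_waveGroup ha).inner_map, h1,
    ContinuousLinearMap.adjoint_inner_left, inner_shift, integral_shift_mul hf0 hSM]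

theorem inner_dualState_of_isBackwardSolution {f : ℝ → ℝ} (hf : MemLp f 2 volume)
    (hf0 : ∀ x ≤ 0, f x = 0) (y₀ : L2) (y₁ : Hm1a a) {M S : ℝ} (hS : 0 ≤ S) (hSM : S ≤ M)
    {W : H1a a × L2} {w : ℝ → H1a a} {w' : ℝ → L2} {g : ℝ → ℝ}
    (h : IsBackwardSolution a S W w w' g) :
    inner ℝ (dualState ha hf (dataState ha y₀ y₁) M S) (stateL ha W) =
      y₁ (w 0) - inner ℝ y₀ (w' 0) - a 1 * ∫ t in Ioo 0 S, f t * g t := by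
  obtain ⟨h1, h2, h3⟩ := h.eq_waveGroup ha hS hSM
  rw [inner_dualState ha hf hf0 _ hSM, inner_dataState, ← h1, ← h2]
  congr 2
  refine integral_congr_ae ?_
  filter_upwards [h3] with t ht
  rw [ht]

theorem dualState_eq {f : ℝ → ℝ} (hf : MemLp f 2 volume) (hf0 : ∀ x ≤ 0, f x = 0)
    (y₀ : L2) (y₁ : Hm1a a) {M N S : ℝ} (hS : 0 ≤ S) (hSM : S ≤ M) (hSN : S ≤ N) :
    dualState ha hf (dataState ha y₀ y₁) M S = dualState ha hf (dataState ha y₀ y₁) N S := by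
  refine ext_inner_right ℝ fun V => ?_
  have hb := isBackwardSolution_waveGroup ha hS hSM (posL ha V, velL a V)
  have h1 := inner_dualState_of_isBackwardSolution ha hf hf0 y₀ y₁ hS hSM hb
  have h2 := inner_dualState_of_isBackwardSolution ha hf hf0 y₀ y₁ hS hSN hb
  rw [stateL_posL_velL] at h1 h2
  exact h1.trans h2.symm

/-! ### The derivative in time of a solution by transposition -/

theorem setIntegral_traceOp {M r : ℝ} (hr : 0 ≤ r) (hrM : r ≤ M) (k : L2T M) :
    ∫ ρ in (0 : ℝ)..r, k ρ = inner ℝ (indicatorConstLp 2 (measurableSet_Ioo (a := 0) (b := r))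
      (measure_ne_top ((volume : Measure ℝ).restrict (Ioo 0 M)) _) (1 : ℝ)) k := by
  rw [L2.inner_indicatorConstLp_one, Measure.restrict_restrict measurableSet_Ioo,
    inter_eq_left.2 (Ioo_subset_Ioo_right hrM), intervalIntegral.integral_of_le hr,
    integral_Ioc_eq_integral_Ioo]

/-- On the range of `J` this is the fundamental theorem of calculus, the derivative of `J U(-ρ) V`
being `-U(-ρ) V`. Both sides are continuous in `V`, so density concludes. -/
theorem traceFun_waveGroup_neg {M r : ℝ} (hr : 0 ≤ r) (hrM : r ≤ M) (V : WaveState a) :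
    traceFun ha (waveGroup ha (-r) V) = traceFun ha V - ∫ ρ in (0 : ℝ)..r, traceOp ha M V ρ := by
  have hG := isSkewGroup_waveGroup ha
  refine (denseRange_waveInv ha).induction_on (p := fun V => traceFun ha (waveGroup ha (-r) V) =
    traceFun ha V - ∫ ρ in (0 : ℝ)..r, traceOp ha M V ρ) V ?_ fun V => ?_
  -- As a pairing with an indicator function, the integral is visibly continuous in `V`.
  · simp only [setIntegral_traceOp hr hrM]
    exact isClosed_eq (by fun_prop) (by fun_prop)
  · have h1 : ∀ ρ, HasDerivAt (fun ρ : ℝ => traceFun ha (waveInv ha (waveGroup ha (-ρ) V)))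
        (-traceFun ha (waveGroup ha (-ρ) V)) ρ := by
      intro ρ
      have h2 := (traceFun ha).hasFDerivAt.comp_hasDerivAt ρ
        ((hG.hasDerivAt V (-ρ)).scomp ρ (hasDerivAt_neg ρ))
      rwa [neg_one_smul, map_neg] at h2
    have h2 := intervalIntegral.integral_eq_sub_of_hasDerivAt (a := 0) (b := r)
      (fun ρ _ => h1 ρ) ((continuous_traceFun ha V).neg.intervalIntegrable _ _)
    have h3 : ∫ ρ in (0 : ℝ)..r, traceOp ha M (waveInv ha V) ρ =
        ∫ ρ in (0 : ℝ)..r, traceFun ha (waveGroup ha (-ρ) V) := by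
      rw [traceOp_waveInv ha (hr.trans hrM), intervalIntegral.integral_of_le hr,
        intervalIntegral.integral_of_le hr, integral_Ioc_eq_integral_Ioo,
        integral_Ioc_eq_integral_Ioo]
      refine integral_congr_ae ?_
      exact ae_mono (restrict_Ioo_le hrM) (memLp_traceFun ha M V).coeFn_toLp
    rw [intervalIntegral.integral_neg, neg_zero, hG.map_zero, hG.comm] at h2
    rw [h3]
    linarith

theorem inner_fst (V : WaveState a) (φ : energySpace a) :
    inner ℝ V.fst φ = inner ℝ V (WithLp.toLp 2 (φ, 0) : WaveState a) := by
  rw [inner_waveState]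
  change inner ℝ V.fst φ = inner ℝ V.fst φ + inner ℝ V.snd (0 : L2)
  rw [inner_zero_right, add_zero]

theorem traceFun_toLp (φ : energySpace a) :
    traceFun ha (WithLp.toLp 2 (φ, 0) : WaveState a) = 0 := by
  have h1 : waveInv ha (WithLp.toLp 2 (φ, 0) : WaveState a) =
      WithLp.toLp 2 (0, energyEmb ha φ) := by
    refine (WithLp.ofLp_injective 2) (Prod.ext ?_ rfl)
    change -(energyEmb ha).adjoint 0 = 0
    rw [map_zero, neg_zero]
  have h2 : posL ha (WithLp.toLp 2 (0, energyEmb ha φ) : WaveState a) = 0 :=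
    map_zero (energyEquiv ha).symm
  have h3 : velL a (WithLp.toLp 2 (φ, 0) : WaveState a) = 0 := rfl
  rw [traceFun_apply, h1, h2, h3]
  simp [normalDeriv]

/-- The inhomogeneous term satisfies the integrated wave equation in its first component. Tested
with `V = (φ, 0)`, the left side is `-∫ f(s - r) traceFun (U(-r) V) dr`; as `traceFun V = 0`, the
trace is minus the primitive of `Γ V`, and the convolution identity applies. -/
theorem waveInv_adjoint_traceOp_fst {f : ℝ → ℝ} (hf : MemLp f 2 volume) (hfi : Integrable f)
    (hf0 : ∀ x ≤ 0, f x = 0) {M s : ℝ} (hs : 0 ≤ s) (hsM : s ≤ M) :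
    (waveInv ha ((traceOp ha M).adjoint (shift hf M s))).fst =
      ∫ σ in (0 : ℝ)..s, ((traceOp ha M).adjoint (shift hf M σ)).fst := by
  have hM := hs.trans hsM
  have hc : Continuous fun σ => ((traceOp ha M).adjoint (shift hf M σ)).fst :=
    (WithLp.fstL 2 ℝ (energySpace a) L2).continuous.comp
      ((traceOp ha M).adjoint.continuous.comp (continuous_shift hf M))
  refine ext_inner_left ℝ fun φ => ?_
  have h1 := (innerSL ℝ φ).intervalIntegral_comp_comm (μ := volume)
    (hc.intervalIntegrable 0 s)
  simp only [innerSL_apply_apply] at h1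
  rw [← h1]
  set V : WaveState a := WithLp.toLp 2 (φ, 0)
  have h2 : ∀ σ, inner ℝ φ ((traceOp ha M).adjoint (shift hf M σ)).fst =
      ∫ r in Ioo 0 M, f (σ - r) * traceOp ha M V r := by
    intro σ
    rw [real_inner_comm, inner_fst, ContinuousLinearMap.adjoint_inner_left, inner_shift]
  simp only [h2]
  rw [real_inner_comm, inner_fst, (isSkew_waveInv ha).inner_left,
    ContinuousLinearMap.adjoint_inner_left, inner_shift, traceOp_waveInv ha hM, ← integral_neg]
  rw [← integral_shift_mul_primitive hfi hf0 hs hsM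
    ((Lp.memLp (traceOp ha M V)).integrable one_le_two)]
  refine integral_congr_ae ?_
  filter_upwards [(memLp_traceFun ha M V).coeFn_toLp, ae_restrict_mem measurableSet_Ioo]
    with r hr hrm
  have h3 : traceLin ha M V r = traceFun ha (waveGroup ha (-r) V) := hr
  rw [h3, traceFun_waveGroup_neg ha hrm.1.le hrm.2.le, traceFun_toLp]
  ring

theorem hasDerivWithinAt_waveInv_dualState {f : ℝ → ℝ} (hf : MemLp f 2 volume)
    (hfi : Integrable f) (hf0 : ∀ x ≤ 0, f x = 0) (Y : WaveState a) {M s : ℝ} (hs : 0 ≤ s)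
    (hsM : s < M) :
    HasDerivWithinAt (fun s => (waveInv ha (dualState ha hf Y M s)).fst)
      (dualState ha hf Y M s).fst (Ici 0) s := by
  set F := WithLp.fstL 2 ℝ (energySpace a) L2
  have hc : Continuous fun σ => ((traceOp ha M).adjoint (shift hf M σ)).fst :=
    F.continuous.comp ((traceOp ha M).adjoint.continuous.comp (continuous_shift hf M))
  have h1 := F.hasFDerivAt.comp_hasDerivAt s ((isSkewGroup_waveGroup ha).hasDerivAt Y s)
  have h2 := (hc.integral_hasStrictDerivAt 0 s).hasDerivAt
  have h3 := (h1.sub (h2.const_smul (a 1))).hasDerivWithinAt (s := Ici 0)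
  have h4 : ∀ σ, 0 ≤ σ → σ ≤ M → (waveInv ha (dualState ha hf Y M σ)).fst =
      (waveInv ha (waveGroup ha σ Y)).fst -
        a 1 • ∫ σ in (0 : ℝ)..σ, ((traceOp ha M).adjoint (shift hf M σ)).fst := by
    intro σ h5 h6
    rw [← waveInv_adjoint_traceOp_fst ha hf hfi hf0 h5 h6, dualState, map_sub, map_smul]
    rfl
  refine HasDerivWithinAt.congr_of_eventuallyEq h3 ?_ (h4 s hs hsM.le)
  filter_upwards [self_mem_nhdsWithin, mem_nhdsWithin_of_mem_nhds (Iio_mem_nhds hsM)]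
    with σ h5 h6
  exact h4 σ h5 (le_of_lt h6)

theorem _root_.HasDerivWithinAt.map_clm {E F : Type*} [NormedAddCommGroup E] [NormedSpace ℝ E]
    [NormedAddCommGroup F] [NormedSpace ℝ F] {u : ℝ → E} {u' : E} {s : Set ℝ} {t : ℝ}
    (h : HasDerivWithinAt u u' s t) (L : E →L[ℝ] F) :
    HasDerivWithinAt (fun x => L (u x)) (L u') s t :=
  L.hasFDerivAt.comp_hasDerivWithinAt t h

/-- The functional `u ↦ ⟨k, √a u'⟩` on `H¹_a(0,1)`. -/
def energyDual : energySpace a →L[ℝ] Hm1a a :=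
  LinearMap.mkContinuous
    { toFun := fun k => (innerSL ℝ k).comp (energyEquiv ha).toContinuousLinearMap
      map_add' := fun k l => by ext u; exact inner_add_left k l (energyEquiv ha u)
      map_smul' := fun c k => by ext u; exact real_inner_smul_left k (energyEquiv ha u) c }
    ‖(energyEquiv ha).toContinuousLinearMap‖ fun k => by
      refine (ContinuousLinearMap.opNorm_comp_le _ _).trans ?_
      rw [innerSL_apply_norm, mul_comm]

theorem energyDual_apply (k : energySpace a) (u : H1a a) :
    energyDual ha k u = inner ℝ k (energyEquiv ha u) := rfl

/-- With `y = -V.snd`, the pivot embedding of `y` is read off from the first component of `J V`;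
differentiating `y` in `H^{-1}_a` thus reduces to differentiating that component. -/
theorem pivot_neg_snd (V : WaveState a) : pivot a (-V.snd) = energyDual ha (waveInv ha V).fst := by
  ext u
  rw [energyDual_apply, waveInv_fst, inner_neg_left, ContinuousLinearMap.adjoint_inner_left,
    energyEmb_energyEquiv, ← inner_neg_left]
  rfl

include ha in
theorem exists_isTranspositionSolution {f : ℝ → ℝ} (hf : MemLp f 2 volume) (hfi : Integrable f)
    (hf0 : ∀ x ≤ 0, f x = 0) (y₀ : L2) (y₁ : Hm1a a) :
    ∃ y y', IsTranspositionSolution a y₀ y₁ f y y' := by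
  set Y := dataState ha y₀ y₁
  -- The dual state needs a horizon beyond the current time. Since it does not depend on the choice,
  -- the moving horizon `t + 1` may be frozen at `s + 1` near `s`.
  have hloc : ∀ s, 0 ≤ s → (fun t => dualState ha hf Y (t + 1) t) =ᶠ[𝓝[Ici 0] s]
      fun t => dualState ha hf Y (s + 1) t := by
    intro s hs
    filter_upwards [self_mem_nhdsWithin,
      mem_nhdsWithin_of_mem_nhds (Iio_mem_nhds (lt_add_one s))] with t h1 h2
    exact dualState_eq ha hf hf0 y₀ y₁ h1 (by linarith) (le_of_lt h2)
  have hcont : ContinuousOn (fun t => dualState ha hf Y (t + 1) t) (Ici 0) := fun s hs =>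
    ((continuous_dualState ha hf Y (s + 1)).continuousWithinAt).congr_of_eventuallyEq
      (hloc s hs) rfl
  have hfst : ContinuousOn (fun t => (dualState ha hf Y (t + 1) t).fst) (Ici 0) :=
    (WithLp.fstL 2 ℝ (energySpace a) L2).continuous.comp_continuousOn hcont
  refine ⟨fun s => -(dualState ha hf Y (s + 1) s).snd,
    fun s => energyDual ha (dualState ha hf Y (s + 1) s).fst, ?_, ?_, ?_, ?_, ?_⟩
  · exact fun S _ => hf.mono_measure Measure.restrict_le_self
  · exact ((WithLp.sndL 2 ℝ (energySpace a) L2).continuous.comp_continuousOn hcont).neg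
  · intro s hs
    simp only [pivot_neg_snd ha]
    have h1 := hasDerivWithinAt_waveInv_dualState ha hf hfi hf0 Y hs (lt_add_one s)
    have h2 : HasDerivWithinAt (fun t => (waveInv ha (dualState ha hf Y (t + 1) t)).fst)
        (dualState ha hf Y (s + 1) s).fst (Ici 0) s := by
      refine h1.congr_of_eventuallyEq ?_ rfl
      filter_upwards [hloc s hs] with t ht
      rw [ht]
    exact HasDerivWithinAt.map_clm (F := Hm1a a) h2 (energyDual ha)
  · exact (energyDual ha).continuous.comp_continuousOn hfst
  · intro S hS W w w' g h
    rw [← inner_dualState_of_isBackwardSolution ha hf hf0 y₀ y₁ hS.le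
      (show S ≤ S + 1 by linarith) h, energyDual_apply, inner_waveState, inner_neg_left,
      sub_neg_eq_add]
    rfl

end Transposition


/-! ### The Hilbert uniqueness method -/

/-- The variational problem of the Hilbert uniqueness method. -/
theorem existsUnique_inner_map_eq {H K : Type*} [NormedAddCommGroup H] [InnerProductSpace ℝ H]
    [CompleteSpace H] [NormedAddCommGroup K] [InnerProductSpace ℝ K] [CompleteSpace K]
    (G : H →L[ℝ] K) {c : ℝ} (hc : 0 < c) (hG : ∀ x, c * ‖x‖ ^ 2 ≤ ‖G x‖ ^ 2) (z : H) :
    ∃! x, ∀ y, inner ℝ (G x) (G y) = inner ℝ z y := by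
  have hin : ∀ x y, inner ℝ ((G.adjoint.comp G) x) y = inner ℝ (G x) (G y) := fun x y => by
    rw [ContinuousLinearMap.comp_apply, ContinuousLinearMap.adjoint_inner_left]
  obtain ⟨u, hu⟩ := exists_unit_of_coercive (G.adjoint.comp G) hc
    fun x => by rw [hin, real_inner_self_eq_norm_sq]; exact hG x
  have h1 : ∀ x, (u : H →L[ℝ] H) x = z ↔ ∀ y, inner ℝ (G x) (G y) = inner ℝ z y := fun x => by
    simp only [← hin, ← hu]
    exact ⟨fun h y => by rw [h], fun h => ext_inner_right ℝ h⟩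
  simp only [← h1]
  refine ⟨(↑u⁻¹ : H →L[ℝ] H) z, ?_, fun x hx => ?_⟩
  · change ((u : H →L[ℝ] H) * ↑u⁻¹) z = z
    rw [Units.mul_inv]
    rfl
  · rw [← hx]
    change x = ((↑u⁻¹ : H →L[ℝ] H) * u) x
    rw [Units.inv_mul]
    rfl

theorem setIntegral_Ioo_comp_sub_left {S : ℝ} (hS : 0 ≤ S) (F : ℝ → ℝ) :
    ∫ t in Ioo 0 S, F (S - t) = ∫ t in Ioo 0 S, F t := by
  rw [← integral_Ioc_eq_integral_Ioo, ← integral_Ioc_eq_integral_Ioo,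
    ← intervalIntegral.integral_of_le hS, ← intervalIntegral.integral_of_le hS]
  simp

section HUM

variable {a : ℝ → ℝ} (ha : IsDegenerateCoefficient a)

include ha in
-- The inverse inequality needs `T > 4 / ((2 - μ_a) √a(1))`. This follows from `min {1, a(1)} ≤
-- √a(1)` and the nonnegativity of the second summand of `T_a`.
theorem observability_time {T : ℝ} (hT : controlTime a < T) :
    0 < T ∧ 0 < (1 - mu a / 2) * T - 2 * (√(a 1))⁻¹ := by
  have h1 := ha.one_pos
  have h2 : 0 < 2 - mu a := by linarith [ha.mu_lt_two]
  have hs : 0 < √(a 1) := Real.sqrt_pos.2 h1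
  have h3 : min 1 (a 1) ≤ √(a 1) := by
    rcases le_total (a 1) 1 with h | h
    · rw [min_eq_right h]
      exact Real.le_sqrt_of_sq_le (by nlinarith)
    · rw [min_eq_left h]
      exact Real.one_le_sqrt.2 h
  have h4 : 0 < min 1 (a 1) := lt_min one_pos h1
  have h5 : 4 / ((2 - mu a) * √(a 1)) ≤ 4 / ((2 - mu a) * min 1 (a 1)) := by gcongr
  have h6 : 0 ≤ 2 * mu a * √(poincareConst a) :=
    mul_nonneg (mul_nonneg zero_le_two ha.mu_nonneg) (Real.sqrt_nonneg _)
  have h7 : 4 / ((2 - mu a) * √(a 1)) < T := by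
    rw [controlTime] at hT
    linarith
  have h8 : 0 < 4 / ((2 - mu a) * √(a 1)) := by positivity
  refine ⟨h8.trans h7, ?_⟩
  have h9 : (1 - mu a / 2) * (4 / ((2 - mu a) * √(a 1))) = 2 * (√(a 1))⁻¹ := by
    field_simp
    ring
  have h10 : (1 - mu a / 2) * (4 / ((2 - mu a) * √(a 1))) < (1 - mu a / 2) * T :=
    mul_lt_mul_of_pos_left h7 (by linarith)
  linarith

include ha in
theorem exists_observability {T : ℝ} (hT : controlTime a < T) :
    ∃ c > 0, ∀ W, c * ‖W‖ ^ 2 ≤ ‖traceOp ha T W‖ ^ 2 := by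
  obtain ⟨h0, h1⟩ := observability_time ha hT
  have h2 := ha.one_pos
  refine ⟨((1 - mu a / 2) * T - 2 * (√(a 1))⁻¹) / a 1, div_pos h1 h2, fun W => ?_⟩
  rw [div_mul_eq_mul_div, div_le_iff₀ h2, mul_comm (‖traceOp ha T W‖ ^ 2)]
  exact le_norm_sq_traceOp ha h0.le W

theorem existsUnique_gramian {T : ℝ} (hT : controlTime a < T) (Z : WaveState a) :
    ∃! W, ∀ V, inner ℝ (traceOp ha T W) (traceOp ha T V) = inner ℝ Z V := by
  obtain ⟨c, hc, hcW⟩ := exists_observability ha hT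
  exact existsUnique_inner_map_eq (traceOp ha T) hc hcW Z

theorem integral_mul_eq_inner_traceOp {T : ℝ} (hT : 0 ≤ T) {W V : H1a a × L2} {w v : ℝ → H1a a}
    {w' v' : ℝ → L2} {g h : ℝ → ℝ} (hW : IsBackwardSolution a T W w w' g)
    (hV : IsBackwardSolution a T V v v' h) :
    ∫ t in Ioo 0 T, g t * h t =
      inner ℝ (traceOp ha T (stateL ha W)) (traceOp ha T (stateL ha V)) := by
  rw [MeasureTheory.L2.inner_def]
  refine Eq.trans (integral_congr_ae ?_) (setIntegral_Ioo_comp_sub_left hT _)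
  filter_upwards [(hW.eq_waveGroup ha hT le_rfl).2.2, (hV.eq_waveGroup ha hT le_rfl).2.2]
    with t h1 h2
  rw [h1, h2]
  exact mul_comm _ _

include ha in
theorem isHUMCoercive {T : ℝ} (hT : controlTime a < T) : IsHUMCoercive a T := by
  obtain ⟨c, hc, hcW⟩ := exists_observability ha hT
  -- The constant of the passage from the energy norm of the state to the norm of `H¹_a × L²`.
  set K := ‖posL ha‖ ^ 2 + 1
  have hK : 0 < K := by positivity
  refine ⟨c / K, by positivity, fun W w w' g h => ?_⟩
  rw [integral_mul_eq_inner_traceOp ha (observability_time ha hT).1.le h h,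
    real_inner_self_eq_norm_sq]
  refine le_trans ?_ (hcW _)
  rw [div_mul_eq_mul_div, div_le_iff₀ hK, mul_assoc]
  refine mul_le_mul_of_nonneg_left ?_ hc.le
  have h1 : ‖W.1‖ ≤ ‖posL ha‖ * ‖stateL ha W‖ := by
    simpa only [posL_stateL] using (posL ha).le_opNorm (stateL ha W)
  have h2 : ‖W.2‖ ^ 2 ≤ ‖stateL ha W‖ ^ 2 := by
    rw [norm_sq_waveState ha, velL_stateL]
    exact le_add_of_nonneg_left (sq_nonneg _)
  have h3 : ‖W.1‖ ^ 2 ≤ (‖posL ha‖ * ‖stateL ha W‖) ^ 2 := by gcongr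
  rw [mul_pow] at h3
  linarith

/-- Every backward solution is given by the group, so the variational problem is `Γ* Γ W = -U(T) Y`
in weak form. -/
theorem isHUMDatum_iff {T : ℝ} (hT : 0 ≤ T) (y₀ : L2) (y₁ : Hm1a a) (W : H1a a × L2) :
    IsHUMDatum a T y₀ y₁ W ↔ ∀ V, inner ℝ (traceOp ha T (stateL ha W)) (traceOp ha T V) =
      inner ℝ (-(waveGroup ha T (dataState ha y₀ y₁))) V := by
  have hZ : ∀ V, inner ℝ (-(waveGroup ha T (dataState ha y₀ y₁))) V =
      -(y₁ (posL ha (waveGroup ha (-T) V)) - inner ℝ y₀ (velL a (waveGroup ha (-T) V))) := by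
    intro V
    rw [inner_neg_left, (isSkewGroup_waveGroup ha).inner_map, inner_dataState]
  constructor
  · intro h V
    have hb := isBackwardSolution_waveGroup ha hT le_rfl (posL ha V, velL a V)
    have hW := isBackwardSolution_waveGroup ha hT le_rfl W
    have h1 := h _ _ _ hW _ _ _ _ hb
    rw [integral_mul_eq_inner_traceOp ha hT hW hb, stateL_posL_velL, zero_sub] at h1
    rw [h1, hZ]
  · intro h w w' g hW V v v' k hV
    obtain ⟨h1, h2, -⟩ := hV.eq_waveGroup ha hT le_rfl
    rw [integral_mul_eq_inner_traceOp ha hT hW hV, h, hZ, h1, h2]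

include ha in
theorem existsUnique_isHUMDatum {T : ℝ} (hT : controlTime a < T) (y₀ : L2) (y₁ : Hm1a a) :
    ∃! W, IsHUMDatum a T y₀ y₁ W := by
  obtain ⟨W, hW, huniq⟩ := existsUnique_gramian ha hT (-(waveGroup ha T (dataState ha y₀ y₁)))
  simp only [isHUMDatum_iff ha (observability_time ha hT).1.le]
  refine ⟨(posL ha W, velL a W), by simpa only [stateL_posL_velL] using hW, fun V hV => ?_⟩
  rw [← huniq _ hV, posL_stateL, velL_stateL]

/-- The transposition identity at `S = T`, tested with all final data, determines `(y, y')(T)` for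
any solution; no uniqueness theorem at other times is required. -/
theorem steers_of_inner {T : ℝ} (hT : 0 < T) {y₀ z₀ : L2} {y₁ z₁ : Hm1a a} {W : H1a a × L2}
    {w : ℝ → H1a a} {w' : ℝ → L2} {g : ℝ → ℝ} (hW : IsBackwardSolution a T W w w' g)
    (h : ∀ V, inner ℝ (traceOp ha T (stateL ha W)) (traceOp ha T V) =
      inner ℝ (dataState ha z₀ z₁ - waveGroup ha T (dataState ha y₀ y₁)) V) :
    Steers a T (fun t => -g t / a 1) y₀ y₁ z₀ z₁ := by
  have ha1 := ha.one_pos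
  have hf : MemLp (fun t => -g t / a 1) 2 (volume.restrict (Ioo 0 T)) := by
    have h1 : (fun t => -g t / a 1) = fun t => -(a 1)⁻¹ * g t := by
      ext t
      ring
    rw [h1]
    exact hW.trace.1.const_mul _
  refine ⟨hf, ?_, fun y y' hy => ?_⟩
  · refine exists_isTranspositionSolution ha ((memLp_indicator_iff_restrict measurableSet_Ioo).2 hf)
      ((integrable_indicator_iff measurableSet_Ioo).2 (hf.integrable one_le_two)) (fun x hx => ?_)
      y₀ y₁
    exact indicator_of_notMem (fun h => absurd h.1 (not_lt.2 hx)) _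
  · have key : ∀ V : H1a a × L2, y' T V.1 - inner ℝ (y T) V.2 = z₁ V.1 - inner ℝ z₀ V.2 := by
      intro V
      have hb := isBackwardSolution_waveGroup ha hT.le le_rfl V
      have h1 := hy.transposition T hT _ _ _ _ hb
      -- The factor `1 / a(1)` in the control cancels the weight of the boundary term and leaves the
      -- Gramian form.
      have h2 : a 1 * ∫ t in Ioo 0 T, (Ioo 0 T).indicator (fun t => -g t / a 1) t *
          traceOp ha T (stateL ha V) (T - t) =
          -inner ℝ (traceOp ha T (stateL ha W)) (traceOp ha T (stateL ha V)) := by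
        rw [← integral_mul_eq_inner_traceOp ha hT.le hW hb, ← integral_const_mul, ← integral_neg]
        refine setIntegral_congr_fun measurableSet_Ioo fun t ht => ?_
        simp only [indicator_of_mem ht]
        field_simp
      rw [h2, h, inner_sub_left, (isSkewGroup_waveGroup ha).inner_map, inner_dataState,
        inner_dataState, posL_stateL, velL_stateL, zero_sub] at h1
      linarith
    constructor
    · refine ext_inner_right ℝ fun v => ?_
      simpa using key (0, v)
    · ext v
      simpa using key (v, 0)

include ha in
theorem isExactlyControllable {T : ℝ} (hT : controlTime a < T) : IsExactlyControllable a T := by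
  intro y₀ y₁ z₀ z₁
  have hT0 := (observability_time ha hT).1
  obtain ⟨W, hW, -⟩ := existsUnique_gramian ha hT
    (dataState ha z₀ z₁ - waveGroup ha T (dataState ha y₀ y₁))
  refine ⟨_, steers_of_inner ha hT0
    (isBackwardSolution_waveGroup ha hT0.le le_rfl (posL ha W, velL a W)) ?_⟩
  rwa [stateL_posL_velL]

include ha in
theorem IsHUMDatum.steers {T : ℝ} (hT : 0 < T) {y₀ : L2} {y₁ : Hm1a a} {W : H1a a × L2}
    (hW : IsHUMDatum a T y₀ y₁ W) {w : ℝ → H1a a} {w' : ℝ → L2} {g : ℝ → ℝ}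
    (hb : IsBackwardSolution a T W w w' g) : Steers a T (fun t => -g t / a 1) y₀ y₁ 0 0 := by
  refine steers_of_inner ha hT hb ?_
  have h0 : dataState ha 0 0 = 0 := by
    refine ext_inner_right ℝ fun V => ?_
    rw [inner_dataState]
    simp
  rw [h0, zero_sub]
  exact (isHUMDatum_iff ha hT.le y₀ y₁ W).1 hW

end HUM


end DegenerateWave

end


theorem mainTheorem3 (a : ℝ → ℝ) (ha : DegenerateWave.IsDegenerateCoefficient a)
    (T : ℝ) (hT : DegenerateWave.controlTime a < T) :
    DegenerateWave.IsExactlyControllable a T ∧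
    DegenerateWave.IsHUMCoercive a T ∧
    ∀ (y₀ : DegenerateWave.L2) (y₁ : DegenerateWave.Hm1a a),
      (∃! W : DegenerateWave.H1a a × DegenerateWave.L2, DegenerateWave.IsHUMDatum a T y₀ y₁ W) ∧
      ∃ (W : DegenerateWave.H1a a × DegenerateWave.L2) (w : ℝ → DegenerateWave.H1a a)
        (w' : ℝ → DegenerateWave.L2) (g : ℝ → ℝ),
        DegenerateWave.IsHUMDatum a T y₀ y₁ W ∧
        DegenerateWave.IsBackwardSolution a T W w w' g ∧
        DegenerateWave.Steers a T (fun t => -g t / a 1) y₀ y₁ 0 0 := by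
  have hT0 := (DegenerateWave.observability_time ha hT).1
  refine ⟨DegenerateWave.isExactlyControllable ha hT, DegenerateWave.isHUMCoercive ha hT,
    fun y₀ y₁ => ⟨DegenerateWave.existsUnique_isHUMDatum ha hT y₀ y₁, ?_⟩⟩
  obtain ⟨W, hW, -⟩ := DegenerateWave.existsUnique_isHUMDatum ha hT y₀ y₁
  have hb := DegenerateWave.isBackwardSolution_waveGroup ha hT0.le le_rfl W
  exact ⟨W, _, _, _, hW, hb, hW.steers ha hT0 hb⟩
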